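/- **Setting.** A permutation of length $n$ is a sequence $\sigma$ containing each element of $[n]$ exactly once; $\mathrm{perm}(s)$ is the permutation order isomorphic to a sequence $s$ of distinct numbers. Write $\sigma\le_f\tau$ if $\sigma=\mathrm{perm}(s)$ for some block $s$ of consecutive entries of $\tau$. Let $C$ be a downward closed set of permutations under $\le_f$ whose basis (the set of minimal permutations not in $C$) is finite, and let $\mathfrak b$ be the maximum length of a basis element ($0$ if the basis is empty). $C$ is *well quasi-ordered* (wqo) if it is well-founded and has no infinite antichain. *Factor graph.* $\Gamma(C)$ is the digraph whose vertices are the permutations in $C$ of length $\mathfrak b$, with an edge $\sigma\to\tau$ iff the last $\mathfrak b-1$ entries of $\sigma$ are order isomorphic to the first $\mathfrak b-1$ entries of $\tau$. For a path $\pi=\tau_1\to\dots\to\tau_n$ ($n\ge1$), $\Sigma(\pi)$ is the set of permutations $\sigma$ of length $n+\mathfrak b-1$ whose block of $\mathfrak b$ consecutive entries starting at position $i$ is order isomorphic to $\tau_i$, for all $i\in[n]$; $\pi$ is *ambiguous* if $|\Sigma(\pi)|>1$. A *cycle* is a path with at least one edge and equal end vertices (other vertices may repeat). *Bicycles.* A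 *bicycle* consists of two vertex-disjoint simple cycles (initial and terminal) and a simple path connecting a vertex of the initial cycle to a vertex of the terminal cycle, with no internal vertex on either cycle; one or both cycles may be absent, so a simple path, a simple cycle, and a simple cycle with a simple path leaving or entering it (meeting the cycle only at that one end) are also bicycles. A *path-complete decomposition* of $\Gamma(C)$ into bicycles is a finite family of subgraphs $\mathcal B_1,\dots,\mathcal B_n$ of $\Gamma(C)$ that are bicycles, such that every path of $\Gamma(C)$ lies in some $\mathcal B_i$. *Splittable pairs.* Let $\mathcal B$ be a bicycle in $\Gamma(C)$ no cycle of which is ambiguous. If the initial cycle has length $r$, its augmented cycle is its $s$-fold repetition, with $s$ minimal such that $rs\ge\mathfrak b$, based at the vertex where the connecting path leaves; the augmented terminal cycle is defined likewise, based at the vertex where the connecting path arrives. A *balanced permutation* of cycle length $m$ is an element of $\Sigma(\pi)$, where $\pi$ goes $m$ times around the augmented initial cycle, along the connecting path, then $m$ times around the augmented terminal cycle. It is written $\alpha_m\cdots\alpha_1\beta\gamma_1\cdots\gamma_m$, where each $|\alpha_t|$ (each $|\gamma_t|$) is the length of the augmented initial (terminal) cycle and $|\beta|$ is $\mathfrak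 b$ plus the number of edges of the connecting path; the blocks belonging to an absent cycle are empty. All $\alpha_t$ are order isomorphic to one permutation $\alpha$, and all $\gamma_t$ to one permutation $\gamma$ (the *iterators*). Let $\mathfrak c=\max(|\alpha|,|\gamma|)$; a *core* is a balanced permutation of cycle length $\mathfrak c$. Write $s|_i$ for the $i$-th entry of $s$. A pair $(\gamma|_i,\gamma|_j)$ of consecutive values of $\gamma$, $\gamma|_j=\gamma|_i+1$, is *shrinking* if $\gamma_1|_i<\gamma_2|_i<\gamma_2|_j<\gamma_1|_j$. The boundary pairs $(-\infty,\gamma|_j)$ with $\gamma|_j=1$, and $(\gamma|_i,\infty)$ with $\gamma|_i=|\gamma|$, are also considered, and are shrinking if $\gamma_2|_j<\gamma_1|_j$, respectively $\gamma_1|_i<\gamma_2|_i$. A shrinking pair $(\gamma|_i,\gamma|_j)$ is *splittable* if in some core $\alpha_{\mathfrak c}\cdots\alpha_1\beta\gamma_1\cdots\gamma_{\mathfrak c}$ an entry $p$ of $\alpha_{\mathfrak c}\cdots\alpha_1\beta$ satisfies $\gamma_1|_i<p<\gamma_1|_j$ (with the obvious meaning for boundary pairs). Shrinking and splittable pairs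 of $\alpha$ are defined in the same way, with $\alpha_1,\alpha_2$ in place of $\gamma_1,\gamma_2$ and with $p$ an entry of $\beta\gamma_1\cdots\gamma_{\mathfrak c}$. **Theorem.** $C$ is well quasi-ordered if and only if the following are satisfied: (i) the factor graph $\Gamma(C)$ has a path-complete decomposition into bicycles $\mathcal B_1,\dots,\mathcal B_n$; (ii) $\Gamma(C)$ has no ambiguous cycles; and (iii) no bicycle $\mathcal B_i$ has a splittable pair. Here it does not matter which decomposition is chosen: the equivalence holds with "for some path-complete decomposition" in (i) and (iii), and for each given path-complete decomposition of $\Gamma(C)$ into bicycles, $C$ is wqo if and only if (ii) holds and (iii) holds for that decomposition. -/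

import Mathlib

namespace ConsecPerm

/-! ### Digraphs: paths, cycles, bicycles -/

section Graphs

variable {V : Type*}

/-- The paths of a digraph, as nonempty vertex sequences `v₁ → ⋯ → vₖ`
(one-vertex paths are allowed). -/
def paths (G : Digraph V) : Set (List V) :=
  {π | π ≠ [] ∧ π.IsChain G.Adj}

/-- A cycle is a path with at least two terms whose first and last vertices agree
(other vertices may be repeated). -/
def IsCycle (G : Digraph V) (π : List V) : Prop :=
  π ∈ paths G ∧ 2 ≤ π.length ∧ π.head? = π.getLast?

/-- `k`-fold repetition of a list. -/
def iter (k : ℕ) (l : List V) : List V :=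
  (List.replicate k l).flatten

/-- A bicycle that is a subgraph of `G`.

* `init = [v₁, …, vᵣ]` lists the initial cycle `v₁ → ⋯ → vᵣ → v₁`, starting at the vertex where
  the connecting path leaves it; `init = []` means that this cycle is absent.
* `conn = [u₁, …, uₚ]` lists the connecting path (`p = 1` is a path with no edges).
* `term = [w₁, …, wₗ]` lists the terminal cycle `w₁ → ⋯ → wₗ → w₁`, starting at the vertex where
  the connecting path arrives; `term = []` means that this cycle is absent.

A simple path has both cycles absent, and a single cycle has one of them absent and a
connecting path with no edges. -/
structure Bicycle (G : Digraph V) where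
  init : List V
  conn : List V
  term : List V
  conn_ne_nil : conn ≠ []
  init_nodup : init.Nodup
  conn_nodup : conn.Nodup
  term_nodup : term.Nodup
  init_head : init ≠ [] → init.head? = conn.head?
  term_head : term ≠ [] → term.head? = conn.getLast?
  init_disjoint_term : ∀ v ∈ init, v ∉ term
  /-- Only the first vertex of the connecting path can lie on the initial cycle. -/
  conn_tail_init : ∀ v ∈ conn.tail, v ∉ init
  /-- Only the last vertex of the connecting path can lie on the terminal cycle. -/
  conn_dropLast_term : ∀ v ∈ conn.dropLast, v ∉ term
  init_adj : (init ++ init.take 1).IsChain G.Adj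
  conn_adj : conn.IsChain G.Adj
  term_adj : (term ++ term.take 1).IsChain G.Adj

namespace Bicycle

variable {G : Digraph V} (B : Bicycle G)

/-- The edges of a bicycle: the pairs of consecutive vertices on its cycles and
connecting path. -/
def Adj (u v : V) : Prop :=
  [u, v] <:+: B.init ++ B.init.take 1 ∨ [u, v] <:+: B.conn ∨ [u, v] <:+: B.term ++ B.term.take 1

/-- The vertices of a bicycle. -/
def verts : Set V :=
  {v | v ∈ B.init ∨ v ∈ B.conn ∨ v ∈ B.term}

/-- The paths inside a bicycle. -/
def paths : Set (List V) :=
  {π | π ≠ [] ∧ (∀ v ∈ π, v ∈ B.verts) ∧ π.IsChain B.Adj}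

end Bicycle

/-- A finite family of bicycles in `G` is a path-complete decomposition of `G` if the paths
of `G` are exactly the paths of the members of the family. -/
def IsPathComplete {G : Digraph V} {n : ℕ} (B : Fin n → Bicycle G) : Prop :=
  paths G = ⋃ i, (B i).paths

end Graphs

/-! ### Permutations under the consecutive subpermutation order -/

/-- A finite permutation: a length together with a permutation of `{0, …, len - 1}`. -/
@[ext]
structure Permutation where
  len : ℕ
  toPerm : Equiv.Perm (Fin len)

/-- The `i`-th entry of a permutation, with positions and values counted from `0`
(and the value `0` at positions out of range). -/
def Permutation.entry (σ : Permutation) (i : ℕ) : ℕ :=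
  if h : i < σ.len then (σ.toPerm ⟨i, h⟩ : ℕ) else 0

/-- `σ` is the permutation which is order isomorphic to the `|σ|` consecutive entries of `τ`
that begin at position `i`. -/
def IsFactorAt (σ τ : Permutation) (i : ℕ) : Prop :=
  i + σ.len ≤ τ.len ∧ ∀ a b, a < σ.len → b < σ.len →
    (τ.entry (i + a) ≤ τ.entry (i + b) ↔ σ.entry a ≤ σ.entry b)

theorem eq_of_isFactorAt_zero {σ τ : Permutation} (hl : σ.len = τ.len)
    (h : IsFactorAt σ τ 0) : σ = τ := by
  obtain ⟨n, s⟩ := σ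
  obtain ⟨m, t⟩ := τ
  obtain rfl : n = m := hl
  have key : ∀ a b : Fin n, t a ≤ t b ↔ s a ≤ s b := by
    intro a b
    have := h.2 a b a.2 b.2
    simpa [Permutation.entry] using this
  let e : Fin n ≃o Fin n :=
    { toEquiv := s.symm.trans t
      map_rel_iff' := by
        intro a b
        simpa using key (s.symm a) (s.symm b) }
  have he : e = OrderIso.refl _ := Subsingleton.elim _ _
  have : s = t := by
    ext a
    have h1 : e (s a) = s a := by rw [he]; rfl
    have h2 : e (s a) = t a := by simp [e]
    rw [← h1, h2]
  rw [this]

/-- The consecutive subpermutation order. -/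
instance : PartialOrder Permutation where
  le σ τ := ∃ i, IsFactorAt σ τ i
  le_refl σ := ⟨0, by simp [IsFactorAt]⟩
  le_trans := by
    rintro ρ σ τ ⟨i, hi, hi'⟩ ⟨j, hj, hj'⟩
    refine ⟨j + i, by omega, fun a b ha hb => ?_⟩
    rw [← hi' a b ha hb, ← hj' (i + a) (i + b) (by omega) (by omega), add_assoc, add_assoc]
  le_antisymm := by
    rintro σ τ ⟨i, hi⟩ ⟨j, hj⟩
    have h1 := hi.1
    have h2 := hj.1
    obtain rfl : i = 0 := by omega
    exact eq_of_isFactorAt_zero (by omega) hi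

/-- A set in a partial order is well quasi-ordered if it is well founded and contains no infinite
antichain. -/
def IsWqo {α : Type*} [PartialOrder α] (C : Set α) : Prop :=
  C.IsWF ∧ ∀ A ⊆ C, IsAntichain (· ≤ ·) A → A.Finite

/-- The basis of a downward closed set: the minimal elements of its complement. -/
def basis (C : Set Permutation) : Set Permutation :=
  {β | Minimal (· ∉ C) β}

/-- The maximum length of a basis element (for a finite nonempty basis). -/
noncomputable def maxBasisLen (C : Set Permutation) : ℕ :=
  sSup (Permutation.len '' basis C)

/-! ### Factor graphs -/

/-- The elements of `C` of length `m`. -/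
abbrev Level (m : ℕ) (C : Set Permutation) : Type :=
  {σ : Permutation // σ ∈ C ∧ σ.len = m}

/-- The `m`-dimensional factor graph of `C`: there is an edge `σ → τ` if and only if the last
`m - 1` entries of `σ` are order isomorphic to the first `m - 1` entries of `τ`. -/
def levelGraph (m : ℕ) (C : Set Permutation) : Digraph (Level m C) where
  Adj σ τ := ∀ a b, a + 1 < m → b + 1 < m →
    (σ.1.entry (a + 1) ≤ σ.1.entry (b + 1) ↔ τ.1.entry a ≤ τ.1.entry b)

/-- The factor graph of `C`. -/
noncomputable def factorGraph (C : Set Permutation) : Digraph (Level (maxBasisLen C) C) :=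
  levelGraph (maxBasisLen C) C

section

variable {m : ℕ} {C : Set Permutation}

/-- The permutations that trace a given path `τ₁ → ⋯ → τₙ` of an `m`-dimensional factor graph:
those of length `n + m - 1` in which the `m` consecutive entries from the `i`-th on are order
isomorphic to `τᵢ`, for every `i`. -/
def perms (π : List (Level m C)) : Set Permutation :=
  {σ | σ.len + 1 = π.length + m ∧ ∀ (i : ℕ) (h : i < π.length), IsFactorAt π[i].1 σ i}

/-- A path is ambiguous if more than one permutation traces it. -/
def Ambiguous (π : List (Level m C)) : Prop :=
  (perms π).Nontrivial

/-! ### Iterators, cores and splittable pairs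

A pair of entries of a permutation is given by two positions; `none` as the lower (upper) member
stands for a fictitious entry of value `-∞` (`∞`). -/

/-- The two members of the pair carry consecutive values of `γ`; the lowest and the highest value
form consecutive pairs with `-∞` and `∞`, respectively. -/
def IsConsecutivePair (γ : Permutation) : Option ℕ → Option ℕ → Prop
  | some i, some j => i < γ.len ∧ j < γ.len ∧ γ.entry j = γ.entry i + 1
  | none, some j => j < γ.len ∧ γ.entry j = 0
  | some i, none => i < γ.len ∧ γ.entry i + 1 = γ.len
  | none, none => False

/-- The pair is shrinking from the sequence `s` to the sequence `t`. -/
def IsShrinkingPair (s t : ℕ → ℕ) : Option ℕ → Option ℕ → Prop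
  | some i, some j => s i < t i ∧ t i < t j ∧ t j < s j
  | none, some j => t j < s j
  | some i, none => s i < t i
  | none, none => False

/-- The value `p` lies strictly between the two members of the pair in the sequence `s`. -/
def IsBetween (s : ℕ → ℕ) (lo hi : Option ℕ) (p : ℕ) : Prop :=
  (∀ i ∈ lo, s i < p) ∧ (∀ j ∈ hi, p < s j)

/-- The smallest number of times a cycle of length `r` has to be repeated for the total length to
be at least `m` (and `0` for an absent cycle, if `m > 0`). -/
noncomputable def numRep (m r : ℕ) : ℕ :=
  sInf {s : ℕ | m ≤ r * s}

namespace Bicycle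

variable (B : Bicycle (levelGraph m C))

/-- The vertices of the augmented initial cycle, from the exit vertex on. -/
noncomputable def augInit : List (Level m C) :=
  iter (numRep m B.init.length) B.init

/-- The vertices of the augmented terminal cycle, in the order in which they are visited after the
entry vertex; the last one is the entry vertex. -/
noncomputable def augTerm : List (Level m C) :=
  iter (numRep m B.term.length) (B.term.rotate 1)

/-- The length `|α|` of the initial iterator, `0` if the initial cycle is absent. -/
noncomputable def initLen : ℕ := B.augInit.length

/-- The length `|γ|` of the terminal iterator, `0` if the terminal cycle is absent. -/
noncomputable def termLen : ℕ := B.augTerm.length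

/-- The length `|β|` of the middle part: the number of edges of the connecting path plus `m`. -/
def midLen : ℕ := B.conn.length - 1 + m

/-- The path traced by balanced permutations `α_k ⋯ α_1 β γ_1 ⋯ γ_k` of cycle length `k`: it goes
`k` times around the augmented initial cycle, then along the connecting path, then `k` times
around the augmented terminal cycle. -/
noncomputable def balancedPath (k : ℕ) : List (Level m C) :=
  iter k B.augInit ++ B.conn ++ iter k B.augTerm

/-- The cycle length of a core, `max (|α|, |γ|)`. -/
noncomputable def coreLen : ℕ := max B.initLen B.termLen

/-- The cores: the balanced permutations of cycle length `B.coreLen`. -/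
noncomputable def cores : Set Permutation := perms (B.balancedPath B.coreLen)

/-- The permutations `α_k ⋯ α_1` made of `k` copies of the initial iterator. They trace the
initial cycle from the exit vertex on. For `k = 1` this is the initial iterator `α`. -/
noncomputable def initIterates (k : ℕ) : Set Permutation :=
  perms ((iter k B.augInit).take (k * B.initLen + 1 - m))

/-- The permutations `γ_1 ⋯ γ_k` made of `k` copies of the terminal iterator. They trace the
terminal cycle, and their last `m` entries form the entry vertex. For `k = 1` this is the
terminal iterator `γ`. -/
noncomputable def termIterates (k : ℕ) : Set Permutation :=
  perms ((iter k B.augTerm).drop (m - 1))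

/-- `(lo, hi)` is a splittable pair of the initial iterator: it is a consecutive pair of `α`, it
is shrinking in `α_2 α_1` (from `α_1` to `α_2`), and in some core
`α_c ⋯ α_1 β γ_1 ⋯ γ_c` an entry of `β γ_1 ⋯ γ_c` lies between its members in `α_1`. -/
def IsInitSplittable (lo hi : Option ℕ) : Prop :=
  B.init ≠ [] ∧
  (∃ α ∈ B.initIterates 1, IsConsecutivePair α lo hi) ∧
  (∃ ρ ∈ B.initIterates 2,
    IsShrinkingPair (fun i => ρ.entry (B.initLen + i)) ρ.entry lo hi) ∧
  ∃ κ ∈ B.cores, ∃ q, B.coreLen * B.initLen ≤ q ∧ q < κ.len ∧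
    IsBetween (fun i => κ.entry ((B.coreLen - 1) * B.initLen + i)) lo hi (κ.entry q)

/-- `(lo, hi)` is a splittable pair of the terminal iterator: it is a consecutive pair of `γ`, it
is shrinking in `γ_1 γ_2` (from `γ_1` to `γ_2`), and in some core
`α_c ⋯ α_1 β γ_1 ⋯ γ_c` an entry of `α_c ⋯ α_1 β` lies between its members in `γ_1`. -/
def IsTermSplittable (lo hi : Option ℕ) : Prop :=
  B.term ≠ [] ∧
  (∃ γ ∈ B.termIterates 1, IsConsecutivePair γ lo hi) ∧
  (∃ ρ ∈ B.termIterates 2,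
    IsShrinkingPair ρ.entry (fun i => ρ.entry (B.termLen + i)) lo hi) ∧
  ∃ κ ∈ B.cores, ∃ q < B.coreLen * B.initLen + B.midLen,
    IsBetween (fun i => κ.entry (B.coreLen * B.initLen + B.midLen + i)) lo hi (κ.entry q)

/-- The bicycle has a splittable pair. -/
def HasSplittablePair : Prop :=
  ∃ lo hi, B.IsInitSplittable lo hi ∨ B.IsTermSplittable lo hi

end Bicycle

end

end ConsecPerm

/-!
Let `m` be the maximal length of a basis element. A permutation of length at least `m` lies in `C`
if and only if all its windows of length `M` do, for any fixed `M ≥ m` not exceeding the length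
(`windowClosed_of_maxBasisLen_le`); so it belongs to `C` exactly when it traces a path of the
`M`-dimensional factor graph. Permutations that agree on an overlap can be amalgamated
(`exists_amalgam`), hence every path is traced, and a permutation tracing part of a path extends to
one tracing the whole path (`Traces.extend`).

**Well quasi-order implies the three conditions.** Suppose that a simple cycle of the
`M`-dimensional factor graph has both an edge that enters it and an edge that leaves it. The
permutations tracing walks that enter the cycle, go round it `k` times and leave it form an infinite
antichain, because an embedding has to match the entering edges as well as the leaving edges
(`in_closed_or_out_closed`). Without such cycles a path can at most leave one cycle, run along a
simple path and end up on a second cycle, so the bicycles, of which there are finitely many, form a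
path-complete decomposition (`exists_isPathComplete`). If two permutations `σ ≠ σ'` of length `M`
trace the same cycle with `N` edges, then in the `M`-dimensional factor graph there are walks of
length `N` from each of `σ`, `σ'` to each of them, and this is impossible if no simple cycle has
both an entering and a leaving edge (`not_ambiguous_of_isWqo`). Finally, let an entry `q` of
`α_k ⋯ α_1 β` lie in a shrinking pair of `γ_1`, and choose the last such entry. The intervals bounded by
the pair in `γ_1, γ_2, …` are nested. Deleting the entries before `q`, and moving `q` next to a
bound of the pair in a block `γ_d` while going round the terminal cycle a fixed number of times
beyond that block, gives an infinite antichain as `d` varies, since an embedding has to respect the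
position of `q` (`not_between_of_isWqo`). Reversal handles the initial cycle.

**The three conditions imply well quasi-order.** If a walk is traced by only one permutation, then
entries of consecutive values lie in a common window, as they could be exchanged otherwise
(`Unambiguous.exists_between`); moreover the relative order of entries on an unambiguous cycle is
invariant under a turn around the cycle. From this it follows that every entry of `γ_t` with
`t > |γ|` lies between the members of a shrinking pair of `γ_1` (`BlockSeq.exists_isGap`): a chain of
entries of consecutive values leads through all the blocks to `γ_1`, and by the pigeonhole principle
two of them occupy the same place in their blocks. If no core splits a pair, then no balanced
permutation does (`not_between_of_core`), so the entries of `α_k ⋯ α_1 β` compare with such a late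
entry as they compare with a bound of the pair. With the symmetric statement for `α`, a balanced
permutation is determined by its cycle length and its core (`Bicycle.eq_of_core_eq`). Every path of
a bicycle is a segment of a balanced path (`Bicycle.exists_eq_seg_walk`), so every permutation
tracing it is a factor of a balanced permutation, and it is described by the core of the latter and
by its extents to the left and to the right. There are finitely many cores, the extents are natural
numbers, and factors of balanced permutations with the same core are comparable if their extents
are; this is a well quasi-order by Dickson's lemma (`Bicycle.isPWO_permSet`).
-/

namespace ConsecPerm

/-! ### Entries, windows and patterns -/

theorem entry_lt {σ : Permutation} {i : ℕ} (h : i < σ.len) : σ.entry i < σ.len := by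
  simp [Permutation.entry, h]

theorem entry_inj {σ : Permutation} {a b : ℕ} (ha : a < σ.len) (hb : b < σ.len)
    (h : σ.entry a = σ.entry b) : a = b := by
  simp only [Permutation.entry, ha, hb, dif_pos] at h
  simpa using σ.toPerm.injective (Fin.ext h)

/-- Every sequence of `n` distinct elements of a linear order is order isomorphic to a
permutation. -/
theorem exists_pattern {L : Type*} [LinearOrder L] (n : ℕ) (f : ℕ → L)
    (hf : ∀ a < n, ∀ b < n, f a = f b → a = b) :
    ∃ σ : Permutation, σ.len = n ∧
      ∀ a < n, ∀ b < n, (σ.entry a ≤ σ.entry b ↔ f a ≤ f b) := by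
  classical
  let s : Finset L := Finset.univ.image (fun a : Fin n => f a)
  have hs : s.card = n := by
    rw [Finset.card_image_of_injective, Finset.card_fin]
    intro a b hab
    exact Fin.ext (hf a a.2 b b.2 hab)
  let e := s.orderIsoOfFin hs
  have hmem : ∀ a : Fin n, f a ∈ s := fun a => Finset.mem_image_of_mem _ (Finset.mem_univ a)
  let g : Fin n → Fin n := fun a => e.symm ⟨f a, hmem a⟩
  have hg : Function.Injective g := by
    intro a b hab
    have := e.symm.injective hab
    exact Fin.ext (hf a a.2 b b.2 (congrArg Subtype.val this))
  refine ⟨⟨n, Equiv.ofBijective g (Finite.injective_iff_bijective.1 hg)⟩, rfl, ?_⟩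
  intro a ha b hb
  simp only [Permutation.entry, ha, hb, dif_pos]
  change ((g ⟨a, ha⟩ : Fin n) : ℕ) ≤ g ⟨b, hb⟩ ↔ _
  rw [Fin.val_fin_le]
  change e.symm _ ≤ e.symm _ ↔ _
  rw [OrderIso.le_iff_le]
  rfl

theorem eq_of_entry_le_iff {σ τ : Permutation} (hl : σ.len = τ.len)
    (h : ∀ a < σ.len, ∀ b < σ.len, (σ.entry a ≤ σ.entry b ↔ τ.entry a ≤ τ.entry b)) : σ = τ :=
  eq_of_isFactorAt_zero hl
    ⟨by omega, fun a b ha hb => by simpa using (h a ha b hb).symm⟩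

namespace IsFactorAt

variable {ρ σ σ' τ : Permutation} {i j : ℕ}

theorem lt_iff (h : IsFactorAt σ τ i) {a b : ℕ} (ha : a < σ.len) (hb : b < σ.len) :
    τ.entry (i + a) < τ.entry (i + b) ↔ σ.entry a < σ.entry b := by
  rw [← not_le, ← not_le, h.2 b a hb ha]

theorem trans (h : IsFactorAt ρ σ i) (h' : IsFactorAt σ τ j) : IsFactorAt ρ τ (j + i) := by
  have h1 := h.1
  have h2 := h'.1
  refine ⟨by omega, fun a b ha hb => ?_⟩
  rw [← h.2 a b ha hb, ← h'.2 (i + a) (i + b) (by omega) (by omega), add_assoc, add_assoc]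

theorem of_nested (h : IsFactorAt σ τ i) (h' : IsFactorAt σ' τ j) (hij : j ≤ i)
    (hl : i + σ.len ≤ j + σ'.len) : IsFactorAt σ σ' (i - j) := by
  refine ⟨by omega, fun a b ha hb => ?_⟩
  rw [← h.2 a b ha hb, ← h'.2 (i - j + a) (i - j + b) (by omega) (by omega)]
  rw [show j + (i - j + a) = i + a by omega, show j + (i - j + b) = i + b by omega]

theorem unique (h : IsFactorAt σ τ i) (h' : IsFactorAt σ' τ i) (hl : σ.len = σ'.len) :
    σ = σ' :=
  eq_of_entry_le_iff hl fun a ha b hb => by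
    rw [← h.2 a b ha hb, ← h'.2 a b (by omega) (by omega)]

end IsFactorAt

theorem isFactorAt_refl (σ : Permutation) : IsFactorAt σ σ 0 := ⟨by omega, by simp⟩

theorem exists_isFactorAt {σ : Permutation} {i l : ℕ} (h : i + l ≤ σ.len) :
    ∃ τ : Permutation, τ.len = l ∧ IsFactorAt τ σ i := by
  obtain ⟨τ, hl, hτ⟩ := exists_pattern l (fun a => σ.entry (i + a)) (fun a ha b hb hab => by
    have := entry_inj (by omega) (by omega) hab
    omega)
  exact ⟨τ, hl, by omega, fun a b ha hb => (hτ a (by omega) b (by omega)).symm⟩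

open Classical in
/-- The permutation order isomorphic to the `l` entries of `σ` from position `i` on
(and `σ` itself if there are fewer entries). -/
noncomputable def window (σ : Permutation) (i l : ℕ) : Permutation :=
  if h : i + l ≤ σ.len then (exists_isFactorAt h).choose else σ

theorem window_len {σ : Permutation} {i l : ℕ} (h : i + l ≤ σ.len) : (window σ i l).len = l := by
  rw [window, dif_pos h]
  exact (exists_isFactorAt h).choose_spec.1

theorem window_isFactorAt {σ : Permutation} {i l : ℕ} (h : i + l ≤ σ.len) :
    IsFactorAt (window σ i l) σ i := by
  rw [window, dif_pos h]
  exact (exists_isFactorAt h).choose_spec.2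

theorem IsFactorAt.len_le {σ τ : Permutation} {i : ℕ} (h : IsFactorAt σ τ i) :
    σ.len ≤ τ.len := by
  have := h.1
  omega

theorem finite_len (n : ℕ) : {σ : Permutation | σ.len = n}.Finite := by
  refine (Set.finite_range (fun s : Equiv.Perm (Fin n) => (⟨n, s⟩ : Permutation))).subset ?_
  rintro ⟨k, s⟩ rfl
  exact ⟨s, rfl⟩

instance (m : ℕ) (C : Set Permutation) : Finite (Level m C) :=
  ((finite_len m).subset (fun _ h => h.2 : {σ | σ ∈ C ∧ σ.len = m} ⊆ _)).to_subtype

/-! ### Amalgamation -/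

/-- Two permutations which agree on an overlap have a common extension. Every entry gets as
first key its cut in the overlap; inside a cut, the entries of `σ` come before those of `τ`. -/
theorem exists_amalgam {σ τ : Permutation} {s : ℕ} (hs : s ≤ σ.len) (hl : σ.len ≤ s + τ.len)
    (h : ∀ a b, s + a < σ.len → s + b < σ.len →
      (σ.entry (s + a) ≤ σ.entry (s + b) ↔ τ.entry a ≤ τ.entry b)) :
    ∃ ρ : Permutation, ρ.len = s + τ.len ∧ IsFactorAt σ ρ 0 ∧ IsFactorAt τ ρ s := by
  classical
  let O := Finset.range (σ.len - s)
  let cσ : ℕ → ℕ := fun a => (O.filter fun w => σ.entry (s + w) < σ.entry a).card +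
    (O.filter fun w => σ.entry (s + w) ≤ σ.entry a).card
  let cτ : ℕ → ℕ := fun a => (O.filter fun w => τ.entry w < τ.entry a).card +
    (O.filter fun w => τ.entry w ≤ τ.entry a).card
  let f : ℕ → ℕ ×ₗ ℕ ×ₗ ℕ := fun a =>
    if a < s then toLex (cσ a, toLex (0, σ.entry a))
    else if a < σ.len then toLex (cτ (a - s), toLex (0, 0))
    else toLex (cτ (a - s), toLex (1, τ.entry (a - s)))
  have hO : ∀ w, w ∈ O ↔ s + w < σ.len := by
    intro w
    simp only [O, Finset.mem_range]
    omega
  -- a strict increase across an entry of the overlap strictly increases the first key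
  have key : ∀ (g : ℕ → ℕ) (x y : ℕ), x < y → (∃ w ∈ O, g w = x ∨ g w = y) →
      (O.filter fun w => g w < x).card + (O.filter fun w => g w ≤ x).card <
      (O.filter fun w => g w < y).card + (O.filter fun w => g w ≤ y).card := by
    rintro g x y hxy ⟨w, hw, hw'⟩
    have h1 : (O.filter fun w => g w < x) ⊆ O.filter fun w => g w ≤ x :=
      Finset.monotone_filter_right _ fun w _ hw => le_of_lt hw
    have h2 : (O.filter fun w => g w ≤ x) ⊆ O.filter fun w => g w < y :=
      Finset.monotone_filter_right _ fun w _ hw => lt_of_le_of_lt hw hxy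
    have h3 : (O.filter fun w => g w < y) ⊆ O.filter fun w => g w ≤ y :=
      Finset.monotone_filter_right _ fun w _ hw => le_of_lt hw
    rcases hw' with rfl | rfl
    · have : (O.filter fun v => g v < g w).card < (O.filter fun v => g v ≤ g w).card :=
        Finset.card_lt_card ⟨h1, fun hh => by
          have := hh (Finset.mem_filter.2 ⟨hw, le_refl (g w)⟩)
          simp at this⟩
      have := Finset.card_le_card h2
      have := Finset.card_le_card h3
      omega
    · have : (O.filter fun v => g v < g w).card < (O.filter fun v => g v ≤ g w).card :=
        Finset.card_lt_card ⟨h3, fun hh => by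
          have := hh (Finset.mem_filter.2 ⟨hw, le_refl (g w)⟩)
          simp at this⟩
      have := Finset.card_le_card h2
      have := Finset.card_le_card h1
      omega
  have keyle : ∀ (g : ℕ → ℕ) (x y : ℕ), x < y →
      (O.filter fun w => g w < x).card + (O.filter fun w => g w ≤ x).card ≤
      (O.filter fun w => g w < y).card + (O.filter fun w => g w ≤ y).card := by
    intro g x y hxy
    exact Nat.add_le_add
      (Finset.card_le_card (Finset.monotone_filter_right _ fun w _ hw => lt_trans hw hxy))
      (Finset.card_le_card (Finset.monotone_filter_right _ fun w _ hw =>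
        le_of_lt (lt_of_le_of_lt hw hxy)))
  have hc : ∀ a, s + a < σ.len → cσ (s + a) = cτ a := by
    intro a ha
    simp only [cσ, cτ]
    congr 2
    · refine Finset.filter_congr fun w hw => ?_
      rw [← not_le, ← not_le, h a w ha ((hO w).1 hw)]
    · exact Finset.filter_congr fun w hw => h w a ((hO w).1 hw) ha
  have hfσ : ∀ a < σ.len, ∀ b < σ.len, σ.entry a < σ.entry b → f a < f b := by
    intro a ha b hb hab
    by_cases has : a < s <;> by_cases hbs : b < s
    · simp only [f, has, hbs, if_true, Prod.Lex.toLex_lt_toLex]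
      rcases (keyle (fun w => σ.entry (s + w)) _ _ hab).lt_or_eq with h1 | h1
      · exact Or.inl h1
      · exact Or.inr ⟨h1, Or.inr ⟨trivial, hab⟩⟩
    · simp only [f, has, hbs, hb, if_true, if_false, Prod.Lex.toLex_lt_toLex]
      left
      rw [← hc (b - s) (by omega), show s + (b - s) = b by omega]
      exact key (fun w => σ.entry (s + w)) _ _ hab
        ⟨b - s, (hO _).2 (by omega), Or.inr (congrArg σ.entry (by omega))⟩
    · simp only [f, has, hbs, ha, if_true, if_false, Prod.Lex.toLex_lt_toLex]
      left
      rw [← hc (a - s) (by omega), show s + (a - s) = a by omega]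
      exact key (fun w => σ.entry (s + w)) _ _ hab
        ⟨a - s, (hO _).2 (by omega), Or.inl (congrArg σ.entry (by omega))⟩
    · simp only [f, has, hbs, ha, hb, if_true, if_false, Prod.Lex.toLex_lt_toLex]
      left
      rw [← hc (a - s) (by omega), show s + (a - s) = a by omega,
        ← hc (b - s) (by omega), show s + (b - s) = b by omega]
      exact key (fun w => σ.entry (s + w)) _ _ hab
        ⟨a - s, (hO _).2 (by omega), Or.inl (congrArg σ.entry (by omega))⟩
  have hfτ : ∀ a < τ.len, ∀ b < τ.len, τ.entry a < τ.entry b → f (s + a) < f (s + b) := by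
    intro a ha b hb hab
    have n1 : ¬ s + a < s := by omega
    have n2 : ¬ s + b < s := by omega
    have e1 : s + a - s = a := by omega
    have e2 : s + b - s = b := by omega
    by_cases has : s + a < σ.len
    · have h1 : cτ a < cτ b := key τ.entry _ _ hab ⟨a, (hO _).2 has, Or.inl rfl⟩
      by_cases hbs : s + b < σ.len <;>
        simp [f, n1, n2, e1, e2, has, hbs, Prod.Lex.toLex_lt_toLex, h1]
    · by_cases hbs : s + b < σ.len
      · have h1 : cτ a < cτ b := key τ.entry _ _ hab ⟨b, (hO _).2 hbs, Or.inr rfl⟩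
        simp [f, n1, n2, e1, e2, has, hbs, Prod.Lex.toLex_lt_toLex, h1]
      · simp only [f, n1, n2, e1, e2, has, hbs, if_false, Prod.Lex.toLex_lt_toLex]
        rcases (keyle τ.entry _ _ hab).lt_or_eq with h1 | h1
        · exact Or.inl h1
        · exact Or.inr ⟨h1, Or.inr ⟨trivial, hab⟩⟩
  have hσ' : ∀ a < σ.len, ∀ b < σ.len, (f a ≤ f b ↔ σ.entry a ≤ σ.entry b) := by
    intro a ha b hb
    constructor
    · intro hab
      by_contra hcon
      exact absurd (hfσ b hb a ha (by omega)) (not_lt.2 hab)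
    · intro hab
      rcases hab.lt_or_eq with h1 | h1
      · exact (hfσ a ha b hb h1).le
      · rw [entry_inj ha hb h1]
  have hτ' : ∀ a < τ.len, ∀ b < τ.len, (f (s + a) ≤ f (s + b) ↔ τ.entry a ≤ τ.entry b) := by
    intro a ha b hb
    constructor
    · intro hab
      by_contra hcon
      exact absurd (hfτ b hb a ha (by omega)) (not_lt.2 hab)
    · intro hab
      rcases hab.lt_or_eq with h1 | h1
      · exact (hfτ a ha b hb h1).le
      · rw [entry_inj ha hb h1]
  have hmix : ∀ a < s, ∀ b, s ≤ b → b < s + τ.len → f a ≠ f b := by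
    intro a ha b hb hb' hab
    by_cases hbs : b < σ.len
    · have := (hσ' a (by omega) b hbs).1 hab.le
      have := (hσ' b hbs a (by omega)).1 hab.ge
      have := entry_inj (by omega) hbs (a := a) (b := b) (by omega)
      omega
    · have n2 : ¬ b < s := by omega
      simp [f, ha, n2, hbs] at hab
  have hinj : ∀ a < s + τ.len, ∀ b < s + τ.len, f a = f b → a = b := by
    intro a ha b hb hab
    by_cases has : a < s <;> by_cases hbs : b < s
    · exact entry_inj (by omega) (by omega)
        (le_antisymm ((hσ' a (by omega) b (by omega)).1 hab.le)
          ((hσ' b (by omega) a (by omega)).1 hab.ge))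
    · exact absurd hab (hmix a has b (by omega) hb)
    · exact absurd hab.symm (hmix b hbs a (by omega) ha)
    · obtain ⟨a, rfl⟩ := Nat.exists_eq_add_of_le (not_lt.1 has)
      obtain ⟨b, rfl⟩ := Nat.exists_eq_add_of_le (not_lt.1 hbs)
      rw [entry_inj (σ := τ) (a := a) (b := b) (by omega) (by omega)
        (le_antisymm ((hτ' a (by omega) b (by omega)).1 hab.le)
          ((hτ' b (by omega) a (by omega)).1 hab.ge))]
  obtain ⟨ρ, hρl, hρ⟩ := exists_pattern _ f hinj
  refine ⟨ρ, hρl, ⟨by omega, fun a b ha hb => ?_⟩, ⟨by omega, fun a b ha hb => ?_⟩⟩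
  · rw [zero_add, zero_add, hρ a (by omega) b (by omega), hσ' a ha b hb]
  · rw [hρ _ (by omega) _ (by omega), hτ' a ha b hb]

/-! ### Permutations tracing a walk -/

/-- `σ` traces the first `n` terms of the sequence `X` of permutations of length `m`: it has
length `n + m - 1`, and its window at position `i < n` is `X i`. -/
def Traces (m : ℕ) (X : ℕ → Permutation) (n : ℕ) (σ : Permutation) : Prop :=
  σ.len + 1 = n + m ∧ ∀ i < n, IsFactorAt (X i) σ i

/-- The edge relation of factor graphs, for arbitrary permutations. -/
def Overlaps (m : ℕ) (σ τ : Permutation) : Prop :=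
  ∀ a b, a + 1 < m → b + 1 < m →
    (σ.entry (a + 1) ≤ σ.entry (b + 1) ↔ τ.entry a ≤ τ.entry b)

namespace Traces

variable {m : ℕ} {X Y : ℕ → Permutation} {n k s : ℕ} {σ τ κ : Permutation}

theorem congr (h : Traces m X n σ) (hXY : ∀ i < n, X i = Y i) : Traces m Y n σ :=
  ⟨h.1, fun i hi => hXY i hi ▸ h.2 i hi⟩

theorem factor (h : Traces m X k κ) (hX : ∀ i < k, (X i).len = m)
    (hσ : IsFactorAt σ κ s) (hl : σ.len + 1 = n + m) : Traces m (fun i => X (s + i)) n σ := by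
  have h1 := h.1
  have h2 := hσ.1
  refine ⟨hl, fun i hi => ?_⟩
  have := (h.2 (s + i) (by omega)).of_nested hσ (by omega) (by
    rw [hX _ (by omega)]
    omega)
  rwa [show s + i - s = i by omega] at this

theorem window (h : Traces m X k κ) (hn : n ≠ 0) (hX : ∀ i < k, (X i).len = m)
    (hl : s + n ≤ k) : Traces m (fun i => X (s + i)) n (window κ s (n + m - 1)) := by
  have h1 := h.1
  refine h.factor hX (window_isFactorAt (by omega)) ?_
  rw [window_len (by omega)]
  omega

/-- Permutations tracing two walks, the second of which starts where the first one ends, can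
be amalgamated. -/
theorem append (hσ : Traces m X (n + 1) σ) (hτ : Traces m (fun i => X (n + i)) (k + 1) τ)
    (hX : ∀ i < n + k + 1, (X i).len = m) :
    ∃ ρ, Traces m X (n + k + 1) ρ ∧ IsFactorAt σ ρ 0 ∧ IsFactorAt τ ρ n := by
  have h1 := hσ.1
  have h2 := hτ.1
  have hn := hX n (by omega)
  obtain ⟨ρ, hρl, hρσ, hρτ⟩ := exists_amalgam (σ := σ) (τ := τ) (s := n) (by omega) (by omega)
    (fun a b ha hb => by
      rw [(hσ.2 n (by omega)).2 a b (by omega) (by omega)]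
      have := (hτ.2 0 (by omega)).2 a b (by simp; omega) (by simp; omega)
      simpa using this.symm)
  refine ⟨ρ, ⟨by omega, fun i hi => ?_⟩, hρσ, hρτ⟩
  by_cases hin : i < n + 1
  · simpa using (hσ.2 i hin).trans hρσ
  · have := (hτ.2 (i - n) (by omega)).trans hρτ
    simpa only [show n + (i - n) = i by omega] using this

end Traces

theorem exists_traces {m : ℕ} {X : ℕ → Permutation} (n : ℕ) (hX : ∀ i < n + 1, (X i).len = m)
    (hadj : ∀ i < n, Overlaps m (X i) (X (i + 1))) : ∃ σ, Traces m X (n + 1) σ := by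
  rcases Nat.eq_zero_or_pos m with rfl | hm
  · refine ⟨⟨n, Equiv.refl _⟩, by simp, fun i hi => ⟨?_, fun a b ha => ?_⟩⟩
    · rw [hX i hi]
      simp
      omega
    · rw [hX i hi] at ha
      omega
  induction n with
  | zero =>
    refine ⟨X 0, by rw [hX 0 (by omega)]; omega, fun i hi => ?_⟩
    obtain rfl : i = 0 := by omega
    exact isFactorAt_refl _
  | succ n ih =>
    obtain ⟨σ, hσ⟩ := ih (fun i hi => hX i (by omega)) (fun i hi => hadj i (by omega))
    have h1 := hσ.1
    have h2 := hX n (by omega)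
    have h3 := hX (n + 1) (by omega)
    obtain ⟨ρ, hρl, hρσ, hρτ⟩ := exists_amalgam (σ := σ) (τ := X (n + 1)) (s := n + 1)
      (by omega) (by omega) (fun a b ha hb => by
        rw [← hadj n (by omega) a b (by omega) (by omega),
          ← (hσ.2 n (by omega)).2 (a + 1) (b + 1) (by omega) (by omega)]
        rw [add_right_comm n 1 a, add_right_comm n 1 b, add_assoc, add_assoc])
    refine ⟨ρ, by omega, fun i hi => ?_⟩
    rcases Nat.lt_succ_iff_lt_or_eq.1 hi with h | rfl
    · simpa using (hσ.2 i h).trans hρσ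
    · exact hρτ

/-- A permutation tracing a part of a walk extends to one tracing the whole walk. -/
theorem Traces.extend {m : ℕ} {X : ℕ → Permutation} {n N s : ℕ} {σ : Permutation}
    (hσ : Traces m (fun i => X (s + i)) n σ) (hn : n ≠ 0)
    (hX : ∀ i < N, (X i).len = m) (hadj : ∀ i, i + 1 < N → Overlaps m (X i) (X (i + 1)))
    (hs : s + n ≤ N) : ∃ κ, Traces m X N κ ∧ IsFactorAt σ κ s := by
  obtain ⟨n, rfl⟩ := Nat.exists_eq_succ_of_ne_zero hn
  obtain ⟨d, rfl⟩ := Nat.exists_eq_add_of_le hs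
  obtain ⟨κ₁, h₁⟩ := exists_traces (m := m) (X := X) s (fun i hi => hX i (by omega))
    (fun i hi => hadj i (by omega))
  obtain ⟨ρ₁, hρ₁, -, hσρ⟩ := h₁.append hσ (fun i hi => hX i (by omega))
  obtain ⟨κ₂, h₂⟩ := exists_traces (m := m) (X := fun i => X (s + n + i)) d
    (fun i hi => hX _ (by omega)) (fun i hi => hadj (s + n + i) (by omega))
  obtain ⟨ρ, hρ, hρ₁ρ, -⟩ := hρ₁.append h₂ (fun i hi => hX i (by omega))
  refine ⟨ρ, ?_, by simpa using hσρ.trans hρ₁ρ⟩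
  rwa [show s + (n + 1) + d = s + n + d + 1 by omega]

/-! ### Membership in the class is a condition on windows -/

/-- Membership in `C` of the permutations of length at least `m` is decided by their windows of
length `m`. -/
def WindowClosed (m : ℕ) (C : Set Permutation) : Prop :=
  ∀ σ, m ≤ σ.len → (∀ τ i, τ.len = m → IsFactorAt τ σ i → τ ∈ C) → σ ∈ C

theorem len_lt_of_lt {σ τ : Permutation} (h : σ < τ) : σ.len < τ.len := by
  obtain ⟨i, hi⟩ := h.le
  refine lt_of_le_of_ne hi.len_le fun hl => h.ne (eq_of_isFactorAt_zero hl ?_)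
  have := hi.1
  obtain rfl : i = 0 := by omega
  exact hi

theorem wellFoundedLT_permutation : WellFoundedLT Permutation :=
  ⟨Subrelation.wf (fun h => len_lt_of_lt h) (InvImage.wf Permutation.len Nat.lt_wfRel.wf)⟩

theorem exists_basis_le {C : Set Permutation} {σ : Permutation} (h : σ ∉ C) :
    ∃ β ∈ basis C, β ≤ σ := by
  have := wellFoundedLT_permutation
  obtain ⟨β, hβ, hmin⟩ := exists_minimal_le_of_wellFoundedLT (· ∉ C) σ h
  exact ⟨β, hmin, hβ⟩

theorem windowClosed_of_maxBasisLen_le {C : Set Permutation} (hC : IsLowerSet C)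
    (hfin : (basis C).Finite) {M : ℕ} (hM : maxBasisLen C ≤ M) : WindowClosed M C := by
  intro σ hσ h
  by_contra hcon
  obtain ⟨β, hβ, i, hi⟩ := exists_basis_le hcon
  have hlen : β.len ≤ maxBasisLen C :=
    le_csSup (hfin.image _).bddAbove (Set.mem_image_of_mem _ hβ)
  have h1 := hi.1
  have hw : min i (σ.len - M) + M ≤ σ.len := by omega
  have hw' := h _ _ (window_len hw) (window_isFactorAt hw)
  refine hβ.1 (hC ⟨_, hi.of_nested (window_isFactorAt hw) (by omega) ?_⟩ hw')
  rw [window_len hw]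
  omega

theorem WindowClosed.mem_of_traces {m : ℕ} {C : Set Permutation} (h : WindowClosed m C)
    {X : ℕ → Permutation} {n : ℕ} {σ : Permutation} (hσ : Traces m X n σ) (hn : n ≠ 0)
    (hX : ∀ i < n, X i ∈ C ∧ (X i).len = m) : σ ∈ C := by
  have h1 := hσ.1
  refine h σ (by omega) fun τ i hτ hi => ?_
  have h2 := hi.1
  rw [hi.unique (hσ.2 i (by omega)) (by rw [hτ, (hX i (by omega)).2])]
  exact (hX i (by omega)).1

/-! ### Well quasi-order as a statement about sequences -/

/-- Permutations being well-founded, well quasi-order means that every sequence has a good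
pair. -/
theorem isWqo_iff {C : Set Permutation} :
    IsWqo C ↔ ∀ f : ℕ → Permutation, (∀ n, f n ∈ C) → ∃ k l, k < l ∧ f k ≤ f l := by
  have hwf := wellFoundedLT_permutation
  constructor
  · rintro ⟨-, h2⟩ f hf
    have hw : WellQuasiOrderedLE C := by
      rw [wellQuasiOrderedLE_iff]
      refine ⟨?_, fun s hs => ?_⟩
      · exact ⟨InvImage.wf (fun x : C => (x : Permutation)) hwf.wf⟩
      · refine Set.Finite.of_finite_image (f := Subtype.val) (h2 _ ?_ ?_)
          Subtype.val_injective.injOn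
        · rintro _ ⟨x, -, rfl⟩
          exact x.2
        · rintro _ ⟨x, hx, rfl⟩ _ ⟨y, hy, rfl⟩ hne hle
          exact hs hx hy (fun h => hne (congrArg _ h)) hle
    obtain ⟨k, l, hkl, h⟩ := wellQuasiOrdered_le (α := C) (fun n => ⟨f n, hf n⟩)
    exact ⟨k, l, hkl, h⟩
  · intro h
    refine ⟨Set.IsWF.of_wellFoundedLT C, fun A hA hanti => ?_⟩
    by_contra hinf
    have := Set.not_finite.1 hinf |>.to_subtype
    obtain ⟨g⟩ : Nonempty (ℕ ↪ A) := ⟨Infinite.natEmbedding A⟩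
    obtain ⟨k, l, hkl, hle⟩ := h (fun n => g n) (fun n => hA (g n).2)
    refine hanti (g k).2 (g l).2 (fun h => ?_) hle
    exact hkl.ne (g.injective (Subtype.ext h))

/-! ### Segments of sequences as lists -/

section Seg

variable {V : Type*}

/-- The list `x a, x (a + 1), …, x (a + n - 1)`. -/
def seg (x : ℕ → V) (a n : ℕ) : List V :=
  (List.range n).map fun i => x (a + i)

@[simp] theorem seg_length (x : ℕ → V) (a n : ℕ) : (seg x a n).length = n := by simp [seg]

@[simp] theorem seg_getElem (x : ℕ → V) (a n i : ℕ) (h : i < (seg x a n).length) :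
    (seg x a n)[i] = x (a + i) := by simp [seg]

theorem mem_seg {x : ℕ → V} {a n : ℕ} {v : V} : v ∈ seg x a n ↔ ∃ i < n, v = x (a + i) := by
  simp [seg, eq_comm]

theorem seg_add (x : ℕ → V) (a n k : ℕ) : seg x a (n + k) = seg x a n ++ seg x (a + n) k := by
  simp [seg, List.range_add, Function.comp_def, add_assoc]

theorem seg_congr {x y : ℕ → V} {a b n : ℕ} (h : ∀ i < n, x (a + i) = y (b + i)) :
    seg x a n = seg y b n := by
  refine List.ext_getElem (by simp) fun i hi _ => ?_
  simpa using h i (by simpa using hi)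

theorem seg_nodup {x : ℕ → V} {a n : ℕ} (h : ∀ i j, i < j → j < n → x (a + i) ≠ x (a + j)) :
    (seg x a n).Nodup := by
  rw [List.nodup_iff_injective_getElem]
  intro i j hij
  have hi := i.2
  have hj := j.2
  simp only [seg_length] at hi hj
  simp only [seg_getElem] at hij
  rcases lt_trichotomy i.1 j.1 with h1 | h1 | h1
  · exact absurd hij (h _ _ h1 hj)
  · exact Fin.ext h1
  · exact absurd hij.symm (h _ _ h1 hi)

theorem seg_isChain {R : V → V → Prop} {x : ℕ → V} {a n : ℕ} :
    (seg x a n).IsChain R ↔ ∀ i, i + 1 < n → R (x (a + i)) (x (a + (i + 1))) := by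
  rw [List.isChain_iff_getElem]
  simp

theorem pair_infix_seg (x : ℕ → V) (a n i : ℕ) (h : i + 1 < n) :
    [x (a + i), x (a + (i + 1))] <:+: seg x a n := by
  refine ⟨seg x a i, seg x (a + i + 2) (n - (i + 2)), ?_⟩
  have : [x (a + i), x (a + (i + 1))] = seg x (a + i) 2 := by
    simp [seg, List.range_succ, add_assoc]
  rw [this, ← seg_add, add_assoc a i 2, ← seg_add, show i + 2 + (n - (i + 2)) = n by omega]

theorem eq_seg (l : List V) (d : V) : l = seg (fun i => l.getD i d) 0 l.length := by
  refine List.ext_getElem (by simp) fun i hi _ => ?_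
  simp [hi]

theorem seg_head? {x : ℕ → V} {a n : ℕ} (h : n ≠ 0) : (seg x a n).head? = some (x a) := by
  obtain ⟨n, rfl⟩ := Nat.exists_eq_succ_of_ne_zero h
  simp [seg, List.range_succ_eq_map]

theorem seg_take (x : ℕ → V) (a n k : ℕ) (h : k ≤ n) : (seg x a n).take k = seg x a k := by
  obtain ⟨d, rfl⟩ := Nat.exists_eq_add_of_le h
  rw [seg_add, List.take_left' (by simp)]

theorem seg_append_take_one {x : ℕ → V} {a r : ℕ} (hr : 0 < r) (h : x (a + r) = x a) :
    seg x a r ++ (seg x a r).take 1 = seg x a (r + 1) := by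
  rw [seg_take _ _ _ _ hr, seg_add]
  simp [seg, h]

theorem seg_tail (x : ℕ → V) (a n : ℕ) : (seg x a n).tail = seg x (a + 1) (n - 1) := by
  cases n with
  | zero => simp [seg]
  | succ n => rw [add_comm n 1, seg_add]; simp [seg]

theorem seg_dropLast (x : ℕ → V) (a n : ℕ) : (seg x a n).dropLast = seg x a (n - 1) := by
  rw [List.dropLast_eq_take, seg_take _ _ _ _ (by simp), seg_length]

theorem seg_getLast? {x : ℕ → V} {a n : ℕ} (h : n ≠ 0) :
    (seg x a n).getLast? = some (x (a + (n - 1))) := by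
  obtain ⟨n, rfl⟩ := Nat.exists_eq_succ_of_ne_zero h
  simp [seg, List.range_succ]

end Seg

/-! ### Simple cycles with an edge entering and an edge leaving them -/

theorem Traces.eq_of_isFactorAt {m : ℕ} {X Y : ℕ → Permutation} {n k s : ℕ} {σ τ : Permutation}
    (hσ : Traces m X n σ) (hτ : Traces m Y k τ) (h : IsFactorAt σ τ s)
    (hX : ∀ i < n, (X i).len = m) (hY : ∀ i < k, (Y i).len = m) :
    s + n ≤ k ∧ ∀ i < n, X i = Y (s + i) := by
  have h1 := hσ.1
  have h2 := hτ.1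
  have h3 := h.1
  refine ⟨by omega, fun i hi => ?_⟩
  exact ((hσ.2 i hi).trans h).unique (hτ.2 (s + i) (by omega))
    (by rw [hX i hi, hY _ (by omega)])

section InOut

variable {M : ℕ} {C : Set Permutation}

/-- In the factor graph of a well quasi-ordered class, a simple cycle cannot have both an edge
entering it and an edge leaving it: walks that enter, go round `k` times and leave would yield
an antichain. -/
theorem in_closed_or_out_closed (hw : IsWqo C) (hC : WindowClosed M C) {x : ℕ → Level M C} {r : ℕ}
    (hper : Function.Periodic x r) (hr : 0 < r)
    (hadj : ∀ i, (levelGraph M C).Adj (x i) (x (i + 1)))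
    (hinj : ∀ i j, x i = x j → i % r = j % r) :
    (∀ i u, (levelGraph M C).Adj u (x (i + 1)) → u = x i) ∨
      ∀ i w, (levelGraph M C).Adj (x i) w → w = x (i + 1) := by
  by_contra! hcon
  obtain ⟨⟨j, u, hu, hune⟩, i, w, hwi, hwne⟩ := hcon
  obtain ⟨i, hij, hwi, hwne⟩ : ∃ i, j < i ∧ (levelGraph M C).Adj (x i) w ∧ w ≠ x (i + 1) := by
    refine ⟨i + (j + 1) * r, ?_, ?_, ?_⟩
    · nlinarith
    · rwa [show x (i + (j + 1) * r) = x i from by simpa using hper.nat_mul (j + 1) i]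
    · rw [add_right_comm]
      rwa [show x (i + 1 + (j + 1) * r) = x (i + 1) from by
        simpa using hper.nat_mul (j + 1) (i + 1)]
  have hmod : ∀ a k, x (a + k * r) = x a := fun a k => by simpa using hper.nat_mul k a
  let Y : ℕ → ℕ → Level M C := fun k t =>
    if t = 0 then u else if t ≤ i + k * r - j then x (j + t) else w
  let n : ℕ → ℕ := fun k => i + k * r - j + 1
  have hY : ∀ k t, t < n k → (levelGraph M C).Adj (Y k t) (Y k (t + 1)) := by
    intro k t ht
    simp only [n] at ht
    rcases Nat.eq_zero_or_pos t with rfl | h0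
    · have : 0 + 1 ≤ i + k * r - j := by omega
      simpa [Y, this] using hu
    · have h1 : t ≤ i + k * r - j := by omega
      by_cases h2 : t + 1 ≤ i + k * r - j
      · simpa [Y, h0.ne', h1, h2, add_assoc] using hadj (j + t)
      · have h3 : j + t = i + k * r := by omega
        simpa [Y, h0.ne', h1, h2, h3, hmod] using hwi
  choose σ hσ using fun k => exists_traces (m := M) (X := fun t => (Y k t).1) (n k)
    (fun t _ => (Y k t).2.2) (fun t ht => hY k t ht)
  obtain ⟨k, l, hkl, o, ho⟩ := isWqo_iff.1 hw σ fun k =>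
    hC.mem_of_traces (hσ k) (by omega) fun t _ => (Y k t).2
  obtain ⟨hol, heq⟩ := (hσ k).eq_of_isFactorAt (hσ l) ho (fun t _ => (Y k t).2.2)
    (fun t _ => (Y l t).2.2)
  have heq : ∀ t < n k + 1, Y k t = Y l (o + t) := fun t ht => Subtype.ext (heq t ht)
  have hkl' : (k + 1) * r ≤ l * r := Nat.mul_le_mul_right _ hkl
  simp only [n] at hol heq
  rw [add_mul, one_mul] at hkl'
  rcases Nat.eq_zero_or_pos o with rfl | ho0
  · have h1 := heq (i + k * r - j + 1) (by omega)
    have h2 : i + k * r - j + 1 ≤ i + l * r - j := by omega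
    have h3 : j + (i + k * r - j + 1) = i + 1 + k * r := by omega
    simp only [Y, zero_add, h2, h3, hmod, if_true] at h1
    exact hwne (by simpa using h1)
  · have h0 := heq 0 (by omega)
    have h1 := heq 1 (by omega)
    have a1 : 1 ≤ i + k * r - j := by omega
    have a2 : o ≤ i + l * r - j := by omega
    have a3 : o + 1 ≤ i + l * r - j := by omega
    simp only [Y, add_zero, if_true, ho0.ne', if_false, a2] at h0
    simp only [Y, a1, a3, if_true, one_ne_zero, if_false, Nat.succ_ne_zero] at h1
    have h2 := hinj _ _ h1
    have h3 : j % r = (j + o) % r := by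
      refine Nat.ModEq.add_right_cancel' (c := 1) ?_
      simpa [Nat.ModEq, add_assoc] using h2
    refine hune ?_
    rw [h0, ← hper.map_mod_nat (j + o), ← h3, hper.map_mod_nat]

/-- The cycle given by two equal vertices of a walk, without repetition in between, has no
entering edges or no leaving edges. -/
theorem in_closed_or_out_closed_of_walk (hw : IsWqo C) (hC : WindowClosed M C) {x : ℕ → Level M C}
    {i j : ℕ} (hij : i < j) (hx : x i = x j)
    (hinj : ∀ a b, i ≤ a → a < b → b < j → x a ≠ x b)
    (hadj : ∀ s, i ≤ s → s < j → (levelGraph M C).Adj (x s) (x (s + 1))) :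
    (∀ s, i ≤ s → s < j → ∀ u, (levelGraph M C).Adj u (x (s + 1)) → u = x s) ∨
      ∀ s, i ≤ s → s < j → ∀ w, (levelGraph M C).Adj (x s) w → w = x (s + 1) := by
  obtain ⟨r, rfl⟩ := Nat.exists_eq_add_of_lt hij
  have hr : 0 < r + 1 := by omega
  let z : ℕ → Level M C := fun t => x (i + t % (r + 1))
  have hz : ∀ t < r + 1, z t = x (i + t) := fun t ht => by simp only [z, Nat.mod_eq_of_lt ht]
  have hz' : ∀ t, z (t + 1) = x (i + t % (r + 1) + 1) := by
    intro t
    have := Nat.mod_lt t hr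
    by_cases h : t % (r + 1) + 1 = r + 1
    · have h1 : (t + 1) % (r + 1) = 0 := by
        rw [Nat.add_mod, show t % (r + 1) = r by omega]
        rcases Nat.eq_zero_or_pos r with rfl | h0
        · simp
        · rw [Nat.mod_eq_of_lt (a := 1) (by omega), Nat.mod_self]
      simp only [z, h1, add_zero, hx]
      congr 1
      omega
    · have h1 : (t + 1) % (r + 1) = t % (r + 1) + 1 := by
        rw [Nat.add_mod, Nat.mod_eq_of_lt (a := 1) (by omega), Nat.mod_eq_of_lt (by omega)]
      simp only [z, h1, add_assoc]
  rcases in_closed_or_out_closed hw hC (x := z) (r := r + 1) (fun t => by simp [z]) hr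
    (fun t => by
      rw [hz']
      have := Nat.mod_lt t hr
      exact hadj _ (by omega) (by omega))
    (fun a b hab => by
      have h1 := Nat.mod_lt a hr
      have h2 := Nat.mod_lt b hr
      rcases lt_trichotomy (a % (r + 1)) (b % (r + 1)) with h | h | h
      · exact absurd hab (hinj _ _ (by omega) (by omega) (by omega))
      · exact h
      · exact absurd hab.symm (hinj _ _ (by omega) (by omega) (by omega))) with h | h
  · left
    intro s hs hs' u hu
    obtain ⟨t, rfl⟩ := Nat.exists_eq_add_of_le hs
    have ht : t < r + 1 := by omega
    rw [← hz t ht]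
    refine h t u ?_
    rwa [hz', Nat.mod_eq_of_lt ht]
  · right
    intro s hs hs' w hw
    obtain ⟨t, rfl⟩ := Nat.exists_eq_add_of_le hs
    have ht : t < r + 1 := by omega
    have := h t w (by rwa [hz t ht])
    rwa [hz', Nat.mod_eq_of_lt ht] at this

/-! ### Well quasi-order excludes ambiguous cycles -/

theorem mem_perms_iff {m : ℕ} {π : List (Level m C)} (d : Level m C) {σ : Permutation} :
    σ ∈ perms π ↔ Traces m (fun i => (π.getD i d).1) π.length σ := by
  refine and_congr Iff.rfl (forall₂_congr fun i hi => ?_)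
  simp [hi]

theorem mem_perms_seg {m : ℕ} {x : ℕ → Level m C} {a n : ℕ} {σ : Permutation} :
    σ ∈ perms (seg x a n) ↔ Traces m (fun i => (x (a + i)).1) n σ := by
  simp [perms, Traces]

/-- Two permutations tracing the same cycle with `N` edges are joined by a walk of length `N` in
the factor graph whose dimension is their length. -/
theorem exists_walk_of_cycle {m N : ℕ} (hC : WindowClosed m C) {X : ℕ → Level m C}
    (hX : X N = X 0) {σ τ : Level (N + m) C}
    (hσ : Traces m (fun i => (X i).1) (N + 1) σ.1) (hτ : Traces m (fun i => (X i).1) (N + 1) τ.1) :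
    ∃ x : ℕ → Level (N + m) C, x 0 = σ ∧ x N = τ ∧
      ∀ i < N, (levelGraph (N + m) C).Adj (x i) (x (i + 1)) := by
  have hσl := σ.2.2
  have hτl := τ.2.2
  obtain ⟨ρ, hρl, hσρ, hτρ⟩ := exists_amalgam (σ := σ.1) (τ := τ.1) (s := N) (by omega) (by omega)
    (fun a b ha hb => by
      have hl : (X N).1.len = m := (X N).2.2
      have h0 : (X 0).1.len = m := (X 0).2.2
      have e1 := (hσ.2 N (by omega)).2 a b (by simp only []; omega) (by simp only []; omega)
      have e2 := (hτ.2 0 (by omega)).2 a b (by simp only []; omega) (by simp only []; omega)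
      simp only [hX, zero_add] at e1 e2
      rw [e1, e2])
  have hmem : ∀ i, i + (N + m) ≤ ρ.len → window ρ i (N + m) ∈ C := by
    intro i hi
    have hwl := window_len hi
    refine hC _ (by omega) fun κ j hκ hj => ?_
    have hjρ := hj.trans (window_isFactorAt hi)
    have h1 := hj.1
    by_cases h : i + j ≤ N
    · rw [((hjρ.of_nested hσρ (by omega) (by omega)).unique (hσ.2 (i + j) (by omega))
        (by rw [hκ, (X _).2.2]))]
      exact (X _).2.1
    · rw [((hjρ.of_nested hτρ (by omega) (by omega)).unique (hτ.2 (i + j - N) (by omega))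
        (by rw [hκ, (X _).2.2]))]
      exact (X _).2.1
  have hwin : ∀ i ≤ N, i + (N + m) ≤ ρ.len := fun i hi => by omega
  let x : ℕ → Level (N + m) C := fun i => if h : i ≤ N then
    ⟨window ρ i (N + m), hmem i (hwin i h), window_len (hwin i h)⟩ else σ
  have hx : ∀ i ≤ N, (x i).1 = window ρ i (N + m) := fun i hi => by simp only [x, dif_pos hi]
  refine ⟨x, Subtype.ext ?_, Subtype.ext ?_, fun i hi => ?_⟩
  · rw [hx 0 (by omega)]
    refine (window_isFactorAt (hwin 0 (by omega))).unique hσρ ?_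
    rw [window_len (by omega), hσl]
  · rw [hx N le_rfl]
    refine (window_isFactorAt (hwin N le_rfl)).unique hτρ ?_
    rw [window_len (by omega), hτl]
  · intro a b ha hb
    have h1 := hwin i hi.le
    have h2 := hwin (i + 1) hi
    rw [hx i hi.le, hx (i + 1) hi, ← (window_isFactorAt h1).2 _ _ (by rw [window_len h1]; omega)
      (by rw [window_len h1]; omega), ← (window_isFactorAt h2).2 _ _ (by rw [window_len h2]; omega)
      (by rw [window_len h2]; omega)]
    rw [show i + (a + 1) = i + 1 + a by omega, show i + (b + 1) = i + 1 + b by omega]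

/-- If a simple cycle through a vertex `σ` has no entering or no leaving edges, then closed walks
through `σ` are deterministic in one direction. -/
theorem eq_of_walks (hw : IsWqo C) (hC : WindowClosed M C) {N : ℕ} (hN : 0 < N)
    {σ τ : Level M C}
    (h : ∀ ρ ρ', (ρ = σ ∨ ρ = τ) → (ρ' = σ ∨ ρ' = τ) → ∃ x : ℕ → Level M C, x 0 = ρ ∧ x N = ρ' ∧
      ∀ i < N, (levelGraph M C).Adj (x i) (x (i + 1))) : σ = τ := by
  classical
  have hex : ∃ r, 0 < r ∧ ∃ x : ℕ → Level M C, x 0 = σ ∧ x r = σ ∧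
      ∀ i < r, (levelGraph M C).Adj (x i) (x (i + 1)) :=
    ⟨N, hN, h σ σ (Or.inl rfl) (Or.inl rfl)⟩
  obtain ⟨hr, x, hx0, hxr, hadj⟩ := Nat.find_spec hex
  have hmin : ∀ k, k < Nat.find hex → _ := fun k hk => Nat.find_min hex hk
  set r := Nat.find hex
  have hinj : ∀ a b, 0 ≤ a → a < b → b < r → x a ≠ x b := by
    intro a b _ hab hb heq
    refine hmin (r - (b - a)) (by omega)
      ⟨by omega, fun t => if t ≤ a then x t else x (t + (b - a)), by simp [hx0], ?_, ?_⟩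
    · simp only [show ¬ r - (b - a) ≤ a by omega, if_false]
      rw [show r - (b - a) + (b - a) = r by omega, hxr]
    · intro t ht
      by_cases h1 : t ≤ a
      · by_cases h2 : t + 1 ≤ a
        · simpa [h1, h2] using hadj t (by omega)
        · have : t = a := by omega
          subst this
          simp only [h1, h2, if_true, if_false]
          rw [heq, show t + 1 + (b - t) = b + 1 by omega]
          exact hadj b hb
      · simp only [h1, show ¬ t + 1 ≤ a by omega, if_false]
        rw [show t + 1 + (b - a) = t + (b - a) + 1 by omega]
        exact hadj _ (by omega)
  obtain ⟨y, hy0, hyN, hy⟩ := h σ σ (Or.inl rfl) (Or.inl rfl)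
  rcases in_closed_or_out_closed_of_walk hw hC hr (hx0.trans hxr.symm) hinj
    (fun s _ hs => hadj s hs) with hin | hout
  · obtain ⟨y', hy0', hyN', hy'⟩ := h τ σ (Or.inr rfl) (Or.inl rfl)
    -- predecessors of vertices of the cycle are unique
    have key : ∀ t ≤ N, y (N - t) = y' (N - t) ∧ ∃ s < r, y (N - t) = x (s + 1) := by
      intro t
      induction t with
      | zero => exact fun _ => ⟨by simp [hyN, hyN'], r - 1, by omega, by
          simp [hyN, show r - 1 + 1 = r by omega, hxr]⟩
      | succ t ih =>
        intro ht
        obtain ⟨h1, s, hs, h2⟩ := ih (by omega)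
        have a1 := hy (N - (t + 1)) (by omega)
        have a2 := hy' (N - (t + 1)) (by omega)
        rw [show N - (t + 1) + 1 = N - t by omega] at a1 a2
        rw [← h1, h2] at a2
        rw [h2] at a1
        have b1 := hin s (by omega) hs _ a1
        have b2 := hin s (by omega) hs _ a2
        refine ⟨b1.trans b2.symm, ?_⟩
        rcases Nat.eq_zero_or_pos s with rfl | hs0
        · exact ⟨r - 1, by omega, by rw [b1, show r - 1 + 1 = r by omega, hxr, hx0]⟩
        · exact ⟨s - 1, by omega, by rw [b1, show s - 1 + 1 = s by omega]⟩
    have := (key N le_rfl).1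
    simpa [hy0, hy0'] using this
  · obtain ⟨y', hy0', hyN', hy'⟩ := h σ τ (Or.inl rfl) (Or.inr rfl)
    have key : ∀ t ≤ N, y t = y' t ∧ ∃ s < r, y t = x s := by
      intro t
      induction t with
      | zero => exact fun _ => ⟨by simp [hy0, hy0'], 0, hr, by simp [hy0, hx0]⟩
      | succ t ih =>
        intro ht
        obtain ⟨h1, s, hs, h2⟩ := ih (by omega)
        have a1 := hy t (by omega)
        have a2 := hy' t (by omega)
        rw [← h1, h2] at a2
        rw [h2] at a1
        have b1 := hout s (by omega) hs _ a1
        have b2 := hout s (by omega) hs _ a2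
        refine ⟨b1.trans b2.symm, ?_⟩
        by_cases hs0 : s + 1 < r
        · exact ⟨s + 1, hs0, b1⟩
        · exact ⟨0, hr, by rw [b1, show s + 1 = r by omega, hxr, hx0]⟩
    have := (key N le_rfl).1
    simpa [hyN, hyN'] using this

theorem not_ambiguous_of_isWqo {m : ℕ} (hw : IsWqo C) (hC : ∀ M, m ≤ M → WindowClosed M C)
    {π : List (Level m C)} (hπ : IsCycle (levelGraph m C) π) : ¬ Ambiguous π := by
  rintro ⟨σ, hσ, τ, hτ, hne⟩
  obtain ⟨-, hlen, hends⟩ := hπ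
  obtain ⟨N, hN⟩ := Nat.exists_eq_add_of_le' hlen
  have d : Level m C := π[0]
  rw [mem_perms_iff d, hN] at hσ hτ
  have hX : π.getD (N + 1) d = π.getD 0 d := by
    rw [List.getD_eq_getElem?_getD, List.getD_eq_getElem?_getD, ← List.head?_eq_getElem?, hends,
      List.getLast?_eq_getElem?, hN]
    rfl
  have hmem : ∀ ρ, Traces m (fun i => (π.getD i d).1) (N + 1 + 1) ρ → ρ ∈ C ∧ ρ.len = N + 1 + m :=
    fun ρ hρ => ⟨(hC m le_rfl).mem_of_traces hρ (by omega) fun i _ => (π.getD i d).2, by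
      have := hρ.1
      omega⟩
  refine hne (congrArg Subtype.val (eq_of_walks hw (hC (N + 1 + m) (by omega)) (N := N + 1)
    (by omega) (σ := ⟨σ, hmem σ hσ⟩) (τ := ⟨τ, hmem τ hτ⟩) fun ρ ρ' hρ hρ' => ?_))
  refine exists_walk_of_cycle (hC m le_rfl) (X := fun i => π.getD i d) hX ?_ ?_
  · rcases hρ with rfl | rfl
    exacts [hσ, hτ]
  · rcases hρ' with rfl | rfl
    exacts [hσ, hτ]

end InOut

/-! ### Decomposition into bicycles -/

section Decomposition

variable {V : Type*} {G : Digraph V}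

theorem Bicycle.adj_of_adj {B : Bicycle G} {u v : V} (h : B.Adj u v) : G.Adj u v := by
  have key : ∀ l : List V, l.IsChain G.Adj → [u, v] <:+: l → G.Adj u v := by
    intro l hl hi
    simpa using hl.infix hi
  rcases h with h | h | h
  exacts [key _ B.init_adj h, key _ B.conn_adj h, key _ B.term_adj h]

theorem Bicycle.paths_subset (B : Bicycle G) : B.paths ⊆ ConsecPerm.paths G :=
  fun _ h => ⟨h.1, h.2.2.imp fun _ _ => Bicycle.adj_of_adj⟩

instance [Finite V] : Finite (Bicycle G) := by
  have := Fintype.ofFinite V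
  classical
  let f : Bicycle G → {l : List V // l.Nodup} × {l : List V // l.Nodup} × {l : List V // l.Nodup} :=
    fun B => (⟨B.init, B.init_nodup⟩, ⟨B.conn, B.conn_nodup⟩, ⟨B.term, B.term_nodup⟩)
  refine Finite.of_injective f fun B B' h => ?_
  simp only [f, Prod.mk.injEq, Subtype.mk.injEq] at h
  obtain ⟨h1, h2, h3⟩ := h
  cases B
  cases B'
  simp_all

/-- If every cycle formed by a first repetition along the walk `x` has no leaving edges, then the
walk follows a simple path and then possibly a simple cycle. -/
theorem exists_lasso {x : ℕ → V} {n : ℕ} (hn : n ≠ 0)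
    (hadj : ∀ i, i + 1 < n → G.Adj (x i) (x (i + 1)))
    (hout : ∀ i j, i < j → j < n → x i = x j → (∀ a b, a < b → b < j → x a ≠ x b) →
      ∀ s, i ≤ s → s < j → ∀ w, G.Adj (x s) w → w = x (s + 1)) :
    ∃ (p : ℕ) (t : List V), p ≠ 0 ∧ p ≤ n ∧ (seg x 0 p).Nodup ∧ t.Nodup ∧
      (t ≠ [] → t.head? = (seg x 0 p).getLast?) ∧ (∀ v ∈ (seg x 0 p).dropLast, v ∉ t) ∧
      (t ++ t.take 1).IsChain G.Adj ∧ (∀ v ∈ t, ∃ i, 0 < i ∧ i < n ∧ v = x i) ∧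
      (∀ i < n, i < p ∨ x i ∈ t) ∧
      (∀ i, i + 1 < n → i + 1 < p ∨ [x i, x (i + 1)] <:+: t ++ t.take 1) := by
  classical
  by_cases hrep : ∃ j, j < n ∧ ∃ i < j, x i = x j
  · obtain ⟨hjn, i, hij, hx⟩ := Nat.find_spec hrep
    have hmin : ∀ k, k < Nat.find hrep → _ := fun k hk => Nat.find_min hrep hk
    set j := Nat.find hrep
    have hinj : ∀ a b, a < b → b < j → x a ≠ x b :=
      fun a b hab hb heq => hmin b hb ⟨by omega, a, hab, heq⟩
    have hout := hout i j hij hjn hx hinj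
    obtain ⟨r, hr⟩ := Nat.exists_eq_add_of_lt hij
    have htake : seg x i (r + 1) ++ (seg x i (r + 1)).take 1 = seg x i (r + 2) :=
      seg_append_take_one (by omega) (by rw [hx, hr]; congr 1)
    have hwalk : ∀ t, i + t < n → ∃ s < r + 1, x (i + t) = x (i + s) ∧
        (i + t + 1 < n → x (i + t + 1) = x (i + s + 1)) := by
      intro t
      induction t with
      | zero => exact fun _ => ⟨0, by omega, rfl, fun _ => rfl⟩
      | succ t ih =>
        intro ht
        obtain ⟨s, hs, -, h2⟩ := ih (by omega)
        have h2 := h2 (by omega)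
        rw [add_assoc] at h2
        by_cases hs' : s + 1 < r + 1
        · refine ⟨s + 1, hs', h2, fun hn' => ?_⟩
          have := hadj (i + (t + 1)) hn'
          rw [h2] at this
          exact hout (i + s + 1) (by omega) (by omega) _ this
        · have h3 : x (i + (t + 1)) = x (i + 0) := by
            rw [h2, add_zero, hx]
            congr 1
            omega
          refine ⟨0, by omega, h3, fun hn' => ?_⟩
          have := hadj (i + (t + 1)) hn'
          rw [h3] at this
          exact hout (i + 0) (by omega) (by omega) _ this
    refine ⟨i + 1, seg x i (r + 1), by omega, by omega, ?_, ?_, ?_, ?_, ?_, ?_, ?_, ?_⟩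
    · refine seg_nodup fun a b hab hb => ?_
      simpa using hinj a b hab (by omega)
    · exact seg_nodup fun a b hab hb => hinj _ _ (by omega) (by omega)
    · intro _
      rw [seg_head? (by omega), seg_getLast? (by omega)]
      simp
    · intro v hv hv'
      rw [seg_dropLast, mem_seg] at hv
      rw [mem_seg] at hv'
      obtain ⟨a, ha, rfl⟩ := hv
      obtain ⟨b, hb, hab⟩ := hv'
      exact hinj _ _ (by omega) (by omega) hab
    · rw [htake, seg_isChain]
      intro a ha
      exact hadj _ (by omega)
    · intro v hv
      rw [mem_seg] at hv
      obtain ⟨a, ha, rfl⟩ := hv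
      by_cases h0 : i + a = 0
      · refine ⟨j, by omega, hjn, ?_⟩
        rw [← hx]
        congr 1
        omega
      · exact ⟨i + a, by omega, by omega, rfl⟩
    · intro a ha
      by_cases hai : a < i + 1
      · exact Or.inl hai
      · obtain ⟨t, rfl⟩ := Nat.exists_eq_add_of_le (show i ≤ a by omega)
        obtain ⟨s, hs, h1, -⟩ := hwalk t ha
        exact Or.inr (mem_seg.2 ⟨s, hs, h1⟩)
    · intro a ha
      by_cases hai : a < i
      · exact Or.inl (by omega)
      · obtain ⟨t, rfl⟩ := Nat.exists_eq_add_of_le (show i ≤ a by omega)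
        obtain ⟨s, hs, h1, h2⟩ := hwalk t (by omega)
        right
        rw [h1, h2 ha, htake]
        exact pair_infix_seg x i (r + 2) s (by omega)
  · push Not at hrep
    refine ⟨n, [], hn, le_rfl, ?_, by simp, by simp, by simp, by simp, by simp,
      fun i hi => Or.inl hi, fun i hi => Or.inl hi⟩
    refine seg_nodup fun a b hab hb => ?_
    simpa using hrep b hb a hab

/-- If every simple cycle has no entering or no leaving edges, then every path is contained in
a bicycle. -/
theorem exists_bicycle
    (hG : ∀ (x : ℕ → V) (i j : ℕ), i < j → x i = x j →
      (∀ a b, i ≤ a → a < b → b < j → x a ≠ x b) →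
      (∀ s, i ≤ s → s < j → G.Adj (x s) (x (s + 1))) →
      (∀ s, i ≤ s → s < j → ∀ u, G.Adj u (x (s + 1)) → u = x s) ∨
        ∀ s, i ≤ s → s < j → ∀ w, G.Adj (x s) w → w = x (s + 1))
    {π : List V} (hπ : π ∈ paths G) : ∃ B : Bicycle G, π ∈ B.paths := by
  classical
  obtain ⟨hne, hchain⟩ := hπ
  have d : V := π.head hne
  obtain ⟨x, n, rfl⟩ : ∃ x n, π = seg x 0 n := ⟨_, _, eq_seg π d⟩
  have hn : n ≠ 0 := by
    rintro rfl
    exact hne rfl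
  rw [seg_isChain] at hchain
  simp only [zero_add] at hchain
  by_cases hout : ∀ i j, i < j → j < n → x i = x j → (∀ a b, a < b → b < j → x a ≠ x b) →
      ∀ s, i ≤ s → s < j → ∀ w, G.Adj (x s) w → w = x (s + 1)
  · obtain ⟨p, t, hp, hpn, h1, h2, h3, h4, h5, h6, h7, h8⟩ := exists_lasso hn hchain hout
    obtain ⟨B, hBc, hBt⟩ : ∃ B : Bicycle G, B.conn = seg x 0 p ∧ B.term = t := by
      refine ⟨{ init := [], conn := seg x 0 p, term := t
                conn_ne_nil := by
                  intro h
                  exact hp (by simpa using congrArg List.length h)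
                init_nodup := by simp
                conn_nodup := h1
                term_nodup := h2
                init_head := by simp
                term_head := h3
                init_disjoint_term := by simp
                conn_tail_init := by simp
                conn_dropLast_term := h4
                init_adj := by simp
                conn_adj := by
                  rw [seg_isChain]
                  intro i hi
                  simpa using hchain i (by omega)
                term_adj := h5 }, rfl, rfl⟩
    refine ⟨B, hne, ?_, ?_⟩
    · intro v hv
      obtain ⟨i, hi, rfl⟩ := mem_seg.1 hv
      rcases h7 i hi with h | h
      · exact Or.inr (Or.inl (hBc ▸ mem_seg.2 ⟨i, h, rfl⟩))
      · exact Or.inr (Or.inr (by simpa [hBt] using h))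
    · rw [seg_isChain]
      intro i hi
      rcases h8 i hi with h | h
      · exact Or.inr (Or.inl (hBc ▸ pair_infix_seg x 0 p i h))
      · exact Or.inr (Or.inr (by simpa [hBt] using h))
  · push Not at hout
    obtain ⟨i, j, hij, hjn, hx, hinj, s₀, hs₀, hs₀', w₀, hw₀, hw₀'⟩ := hout
    have hin : ∀ s, i ≤ s → s < j → ∀ u, G.Adj u (x (s + 1)) → u = x s :=
      (hG x i j hij hx (fun a b _ => hinj a b) (fun s _ hs => hchain s (by omega))).resolve_right
        (fun h => hw₀' (h s₀ hs₀ hs₀' w₀ hw₀))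
    obtain rfl : i = 0 := by
      by_contra h0
      have h1 := hchain (i - 1) (by omega)
      rw [show i - 1 + 1 = i by omega, hx] at h1
      have h2 := hin (j - 1) (by omega) (by omega) (x (i - 1))
        (by rwa [show j - 1 + 1 = j by omega])
      exact hinj (i - 1) (j - 1) (by omega) (by omega) h2
    let z : ℕ → V := fun t => x (t % j)
    have hzj : ∀ t, z (t + j) = z t := fun t => by simp [z]
    have hzs : ∀ t, z (t + 1) = x (t % j + 1) := by
      intro t
      have := Nat.mod_lt t hij
      rcases Nat.lt_or_ge (t % j + 1) j with h | h
      · simp only [z]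
        congr 1
        rw [Nat.add_mod, Nat.mod_eq_of_lt (a := 1) (by omega), Nat.mod_eq_of_lt h]
      · have h' : t % j + 1 = j := by omega
        rw [h', ← hx]
        simp only [z]
        congr 1
        rw [← Nat.mod_add_mod, h', Nat.mod_self]
    have hzadj : ∀ t, G.Adj (z t) (z (t + 1)) := fun t => by
      rw [hzs]
      exact hchain _ (by have := Nat.mod_lt t hij; omega)
    have hzin : ∀ t u, G.Adj u (z (t + 1)) → u = z t := fun t u hu => by
      rw [hzs] at hu
      exact hin _ (Nat.zero_le _) (Nat.mod_lt t hij) u hu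
    have hzinj : ∀ a b, z a = z b → a % j = b % j := by
      intro a b hab
      have h1 := Nat.mod_lt a hij
      have h2 := Nat.mod_lt b hij
      rcases lt_trichotomy (a % j) (b % j) with h | h | h
      · exact absurd hab (hinj _ _ h h2)
      · exact h
      · exact absurd hab.symm (hinj _ _ h h1)
    have hzmod : ∀ a b, a % j = b % j → z a = z b := fun a b h => by simp only [z, h]
    -- `e` is the last index up to which the walk stays on the cycle
    obtain ⟨e, hen, hez, hee⟩ : ∃ e < n, (∀ t ≤ e, x t = z t) ∧
        (e + 1 < n → x (e + 1) ≠ z (e + 1)) := by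
      by_cases hall : ∃ t, t < n ∧ x t ≠ z t
      · obtain ⟨h1, h2⟩ := Nat.find_spec hall
        have h3 : ∀ k, k < Nat.find hall → _ := fun k hk => Nat.find_min hall hk
        set f := Nat.find hall
        have hf : f ≠ 0 := by
          intro h
          rw [h] at h2
          exact h2 (by simp [z])
        refine ⟨f - 1, by omega, fun t ht => ?_, fun _ => ?_⟩
        · by_contra hcon
          exact h3 t (by omega) ⟨by omega, hcon⟩
        · rwa [show f - 1 + 1 = f by omega]
      · push Not at hall
        exact ⟨n - 1, by omega, fun t ht => hall t (by omega), fun h => by omega⟩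
    have hoff : ∀ t, e + (t + 1) < n → ∀ s, x (e + (t + 1)) ≠ z s := by
      intro t
      induction t with
      | zero =>
        intro ht s hs
        have h1 := hchain e ht
        rw [zero_add] at hs
        rw [hs, ← hzj, show s + j = s + j - 1 + 1 by omega] at h1
        have h2 := hzin _ _ h1
        rw [hez e le_rfl] at h2
        refine hee ht ?_
        rw [hs, ← hzj s]
        refine hzmod _ _ ?_
        have := hzinj _ _ h2
        rw [show s + j = s + j - 1 + 1 by omega]
        exact (Nat.ModEq.add_right 1 this).symm
      | succ t ih =>
        intro ht s hs
        have h1 := hchain (e + (t + 1)) ht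
        rw [show e + (t + 1) + 1 = e + (t + 1 + 1) by omega, hs, ← hzj,
          show s + j = s + j - 1 + 1 by omega] at h1
        exact ih (by omega) _ (hzin _ _ h1)
    have hyout : ∀ i' j', i' < j' → j' < n - e → x (e + i') = x (e + j') →
        (∀ a b, a < b → b < j' → x (e + a) ≠ x (e + b)) →
        ∀ s, i' ≤ s → s < j' → ∀ w, G.Adj (x (e + s)) w → w = x (e + (s + 1)) := by
      intro i' j' hij' hjn' hx' hinj'
      refine (hG (fun t => x (e + t)) i' j' hij' hx' (fun a b _ => hinj' a b)
        (fun s _ hs => hchain (e + s) (by omega))).resolve_left fun hin' => ?_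
      have h0 : i' ≠ 0 := by
        rintro rfl
        refine hoff (j' - 1) (by omega) e ?_
        rw [show j' - 1 + 1 = j' by omega, ← hx']
        exact hez e le_rfl
      have h1 := hchain (e + (i' - 1)) (by omega)
      rw [show e + (i' - 1) + 1 = e + i' by omega, hx'] at h1
      have h2 := hin' (j' - 1) (by omega) (by omega) (x (e + (i' - 1)))
        (by simpa only [show j' - 1 + 1 = j' by omega] using h1)
      exact hinj' (i' - 1) (j' - 1) (by omega) (by omega) h2
    obtain ⟨p, t, hp, hpn, h1, h2, h3, h4, h5, h6, h7, h8⟩ :=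
      exists_lasso (G := G) (x := fun t => x (e + t)) (n := n - e) (by omega)
        (fun i hi => hchain (e + i) (by omega)) hyout
    have htake : seg z e j ++ (seg z e j).take 1 = seg z e (j + 1) :=
      seg_append_take_one hij (hzj e)
    obtain ⟨B, hBi, hBc, hBt⟩ : ∃ B : Bicycle G, B.init = seg z e j ∧
        B.conn = seg (fun t => x (e + t)) 0 p ∧ B.term = t := by
      refine ⟨{ init := seg z e j, conn := seg (fun t => x (e + t)) 0 p, term := t
                conn_ne_nil := by
                  intro h
                  exact hp (by simpa using congrArg List.length h)
                init_nodup := by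
                  refine seg_nodup fun a b hab hb heq => ?_
                  have := Nat.ModEq.add_left_cancel' e (hzinj _ _ heq)
                  rw [Nat.ModEq, Nat.mod_eq_of_lt (by omega), Nat.mod_eq_of_lt (by omega)] at this
                  omega
                conn_nodup := h1
                term_nodup := h2
                init_head := by
                  intro _
                  rw [seg_head? (by omega), seg_head? hp]
                  exact congrArg some (hez e le_rfl).symm
                term_head := h3
                init_disjoint_term := by
                  intro v hv hv'
                  obtain ⟨a, _, rfl⟩ := mem_seg.1 hv
                  obtain ⟨b, hb0, hb, hab⟩ := h6 _ hv'
                  obtain ⟨b, rfl⟩ := Nat.exists_eq_add_of_lt hb0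
                  exact hoff b (by omega) _ (by simpa [add_assoc] using hab.symm)
                conn_tail_init := by
                  intro v hv hv'
                  rw [seg_tail] at hv
                  obtain ⟨b, hb, rfl⟩ := mem_seg.1 hv
                  obtain ⟨a, _, hab⟩ := mem_seg.1 hv'
                  exact hoff b (by omega) (e + a) (by
                    rw [← hab]
                    congr 2
                    omega)
                conn_dropLast_term := h4
                init_adj := by
                  rw [htake, seg_isChain]
                  exact fun a _ => hzadj _
                conn_adj := by
                  rw [seg_isChain]
                  intro a ha
                  simpa [add_assoc] using hchain (e + a) (by omega)
                term_adj := h5 }, rfl, rfl, rfl⟩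
    refine ⟨B, hne, ?_, ?_⟩
    · intro v hv
      obtain ⟨a, ha, rfl⟩ := mem_seg.1 hv
      rw [zero_add]
      by_cases hae : a < e
      · left
        obtain ⟨b, hb⟩ : ∃ b < j, (e + b) % j = a % j :=
          ⟨(a + e * (j - 1)) % j, Nat.mod_lt _ hij, by
            rw [Nat.add_mod_mod, show e + (a + e * (j - 1)) = a + j * e by
              obtain ⟨j, rfl⟩ := Nat.exists_eq_add_of_lt hij
              simp
              ring, Nat.add_mul_mod_self_left]⟩
        exact hBi ▸ mem_seg.2 ⟨b, hb.1, by rw [hez a hae.le]; exact hzmod _ _ hb.2.symm⟩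
      · right
        obtain ⟨b, rfl⟩ := Nat.exists_eq_add_of_le (not_lt.1 hae)
        rcases h7 b (by omega) with h | h
        · exact Or.inl (hBc ▸ mem_seg.2 ⟨b, h, by simp⟩)
        · exact Or.inr (hBt ▸ h)
    · rw [seg_isChain]
      intro a ha
      rw [zero_add, zero_add]
      by_cases hae : a < e
      · left
        obtain ⟨b, hb, hb'⟩ : ∃ b < j, (e + b) % j = a % j :=
          ⟨(a + e * (j - 1)) % j, Nat.mod_lt _ hij, by
            rw [Nat.add_mod_mod, show e + (a + e * (j - 1)) = a + j * e by
              obtain ⟨j, rfl⟩ := Nat.exists_eq_add_of_lt hij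
              simp
              ring, Nat.add_mul_mod_self_left]⟩
        have e1 : x a = z (e + b) := by rw [hez a hae.le]; exact hzmod _ _ hb'.symm
        have e2 : x (a + 1) = z (e + (b + 1)) := by
          rw [hez (a + 1) hae]
          exact hzmod _ _ (Nat.ModEq.add_right 1 hb').symm
        rw [e1, e2]
        rw [hBi, htake]
        exact pair_infix_seg z e (j + 1) b (by omega)
      · right
        obtain ⟨b, rfl⟩ := Nat.exists_eq_add_of_le (not_lt.1 hae)
        rcases h8 b (by omega) with h | h
        · left
          have := pair_infix_seg (fun t => x (e + t)) 0 p b h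
          simpa [add_assoc, hBc] using this
        · exact Or.inr (by simpa [add_assoc, hBt] using h)

end Decomposition

/-- The factor graph of a well quasi-ordered class has a path-complete decomposition: the family
of all its bicycles. -/
theorem exists_isPathComplete {m : ℕ} {C : Set Permutation} (hw : IsWqo C)
    (hC : WindowClosed m C) :
    ∃ (n : ℕ) (B : Fin n → Bicycle (levelGraph m C)), IsPathComplete B := by
  obtain ⟨n, ⟨f⟩⟩ := Finite.exists_equiv_fin (Bicycle (levelGraph m C))
  refine ⟨n, f.symm, Set.Subset.antisymm (fun π hπ => ?_)
    (Set.iUnion_subset fun i => (f.symm i).paths_subset)⟩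
  obtain ⟨B, hB⟩ := exists_bicycle
    (fun x i j hij hx hinj hadj => in_closed_or_out_closed_of_walk hw hC hij hx hinj hadj) hπ
  exact Set.mem_iUnion.2 ⟨f B, by simpa using hB⟩

/-! ### Unambiguous walks -/

/-- All permutations tracing the first `n` terms of `X` are equal. -/
def Unambiguous (m : ℕ) (X : ℕ → Permutation) (n : ℕ) : Prop :=
  ∀ σ τ, Traces m X n σ → Traces m X n τ → σ = τ

/-- In the unique permutation tracing a walk, entries of consecutive values lie in a common
window: otherwise exchanging these values would give another such permutation. -/
theorem Unambiguous.exists_between {m : ℕ} {X : ℕ → Permutation} {n : ℕ} {σ : Permutation}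
    (hX : Unambiguous m X n) (hσ : Traces m X n σ) (hlen : ∀ i < n, (X i).len = m)
    {a b : ℕ} (ha : a < σ.len) (hb : b < σ.len) (hab : σ.entry a < σ.entry b)
    (hd : a + m ≤ b ∨ b + m ≤ a) :
    ∃ c < σ.len, σ.entry a < σ.entry c ∧ σ.entry c < σ.entry b := by
  by_contra! hcon
  have hne : a ≠ b := by
    rintro rfl
    exact lt_irrefl _ hab
  have hinj := fun {a b : ℕ} => entry_inj (σ := σ) (a := a) (b := b)
  -- the entry at `a` is moved to just above the entry at `b`
  obtain ⟨τ, hτl, hτ⟩ := exists_pattern σ.len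
    (fun c => if c = a then 2 * σ.entry b + 1 else 2 * σ.entry c) (fun c hc d hd hcd => by
      by_cases h1 : c = a <;> by_cases h2 : d = a <;> simp only [h1, h2, if_true, if_false] at hcd
      · rw [h1, h2]
      · omega
      · omega
      · exact hinj hc hd (by omega))
  have hτX : Traces m X n τ := by
    refine ⟨by rw [hτl]; exact hσ.1, fun i hi => ⟨by rw [hτl]; exact (hσ.2 i hi).1, ?_⟩⟩
    intro c d hc hd'
    have h1 := (hσ.2 i hi).1
    have h2 := hlen i hi
    rw [← (hσ.2 i hi).2 c d hc hd', hτ _ (by omega) _ (by omega)]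
    by_cases hca : i + c = a <;> by_cases hda : i + d = a <;>
      simp only [hca, hda, if_true, if_false, le_refl]
    · have h3 : σ.entry a ≠ σ.entry (i + d) := fun h => by
        have := hinj ha (by omega) h
        omega
      have h4 : σ.entry b ≠ σ.entry (i + d) := fun h => by
        have := hinj hb (by omega) h
        omega
      have h5 := hcon (i + d) (by omega)
      omega
    · have h3 : σ.entry a ≠ σ.entry (i + c) := fun h => by
        have := hinj ha (by omega) h
        omega
      have h4 : σ.entry b ≠ σ.entry (i + c) := fun h => by
        have := hinj hb (by omega) h
        omega
      have h5 := hcon (i + c) (by omega)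
      omega
    · omega
  have := hX σ τ hσ hτX
  subst this
  have h := (hτ a ha b hb).1 hab.le
  simp only [if_true, hne.symm, if_false] at h
  omega

/-- A permutation that traces an unambiguous periodic walk from position `δ` on is invariant
under the shift by the period, from this position on. -/
theorem Traces.shift_le_iff {m : ℕ} {X : ℕ → Permutation} {N δ g : ℕ} {κ : Permutation}
    (hκ : Traces m X N κ) (hlen : ∀ i < N, (X i).len = m) (hN : δ + g < N)
    (hper : ∀ i, δ ≤ i → i + g < N → X (i + g) = X i)
    (hX : ∀ n ≠ 0, δ + n ≤ N → Unambiguous m (fun i => X (δ + i)) n) {a b : ℕ}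
    (ha : δ ≤ a) (hb : δ ≤ b) (ha' : a + g < κ.len) (hb' : b + g < κ.len) :
    κ.entry (a + g) ≤ κ.entry (b + g) ↔ κ.entry a ≤ κ.entry b := by
  obtain ⟨n, rfl⟩ := Nat.exists_eq_add_of_lt hN
  have hl := hκ.1
  have hw1 : δ + (n + 1 + m - 1) ≤ κ.len := by omega
  have hw2 : δ + g + (n + 1 + m - 1) ≤ κ.len := by omega
  have h1 := hκ.window (s := δ) (n := n + 1) (by omega) hlen (by omega)
  have h2 := (hκ.window (s := δ + g) (n := n + 1) (by omega) hlen (by omega)).congr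
    (Y := fun i => X (δ + i)) (fun i hi => by
      rw [show δ + g + i = δ + i + g by omega]
      exact hper _ (by omega) (by omega))
  have heq := hX (n + 1) (by omega) (by omega) _ _ h1 h2
  obtain ⟨a, rfl⟩ := Nat.exists_eq_add_of_le ha
  obtain ⟨b, rfl⟩ := Nat.exists_eq_add_of_le hb
  have e1 := (window_isFactorAt hw1).2 a b (by rw [window_len hw1]; omega)
    (by rw [window_len hw1]; omega)
  have e2 := (window_isFactorAt hw2).2 a b (by rw [window_len hw2]; omega)
    (by rw [window_len hw2]; omega)
  rw [e1, heq, ← e2, add_right_comm δ a g, add_right_comm δ b g]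

/-! ### Sequences of blocks and their gaps -/

section Blocks

/-- Abstract form of the iterates of an unambiguous cycle: `P t i` is the `i`-th entry of the
`t`-th block. The order is invariant under passing to the next blocks, and entries of consecutive
values lie in the same or in neighbouring blocks. -/
structure BlockSeq {L : Type*} [LinearOrder L] (P : ℕ → ℕ → L) (g k : ℕ) : Prop where
  inj : ∀ t < k, ∀ i < g, ∀ t' < k, ∀ i' < g, P t i = P t' i' → t = t' ∧ i = i'
  shift : ∀ t i t' i', t + 1 < k → t' + 1 < k → i < g → i' < g →
    (P (t + 1) i ≤ P (t' + 1) i' ↔ P t i ≤ P t' i')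
  exists_between : ∀ t < k, ∀ i < g, ∀ t' < k, ∀ i' < g, P t i < P t' i' →
    t + 2 ≤ t' ∨ t' + 2 ≤ t → ∃ t'' < k, ∃ i'' < g, P t i < P t'' i'' ∧ P t'' i'' < P t' i'

namespace BlockSeq

variable {L : Type*} [LinearOrder L] {P : ℕ → ℕ → L} {g k : ℕ}

theorem dual (h : BlockSeq P g k) : BlockSeq (fun t i => OrderDual.toDual (P t i)) g k where
  inj t ht i hi t' ht' i' hi' heq := h.inj t ht i hi t' ht' i' hi' heq
  shift t i t' i' ht ht' hi hi' := h.shift t' i' t i ht' ht hi' hi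
  exists_between t ht i hi t' ht' i' hi' hlt hd := by
    obtain ⟨s, hs, j, hj, h1, h2⟩ := h.exists_between t' ht' i' hi' t ht i hi hlt hd.symm
    exact ⟨s, hs, j, hj, h2, h1⟩

theorem shift_add (h : BlockSeq P g k) {t t' i i' : ℕ} (d : ℕ) (ht : t + d < k) (ht' : t' + d < k)
    (hi : i < g) (hi' : i' < g) : P (t + d) i ≤ P (t' + d) i' ↔ P t i ≤ P t' i' := by
  induction d with
  | zero => rfl
  | succ d ih =>
    rw [← add_assoc, ← add_assoc, h.shift _ _ _ _ (by omega) (by omega) hi hi',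
      ih (by omega) (by omega)]

theorem mono_of_lt (h : BlockSeq P g k) {i : ℕ} (hi : i < g) (hup : P 0 i ≤ P 1 i) {s t : ℕ}
    (hst : s ≤ t) (ht : t < k) : P s i ≤ P t i := by
  induction t with
  | zero =>
    obtain rfl : s = 0 := by omega
    exact le_rfl
  | succ t ih =>
    rcases Nat.lt_or_ge s (t + 1) with h1 | h1
    · refine (ih (by omega) (by omega)).trans ?_
      have := h.shift_add (t := 0) (t' := 1) (i := i) (i' := i) t (by omega) (by omega) hi hi
      rw [zero_add, add_comm 1 t] at this
      exact this.2 hup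
    · obtain rfl : s = t + 1 := by omega
      exact le_rfl

theorem anti_of_lt (h : BlockSeq P g k) {i : ℕ} (hi : i < g) (hdown : P 1 i ≤ P 0 i) {s t : ℕ}
    (hst : s ≤ t) (ht : t < k) : P t i ≤ P s i :=
  h.dual.mono_of_lt hi hdown hst ht

/-- The entry of the first block that is next above an entry of a late block decreases from the
first block to the second. The chain of consecutive values between the two passes through all
the blocks in between, so it contains two entries at the same place of their blocks. -/
theorem lt_of_next_above (h : BlockSeq P g k) {s r j : ℕ} (hs : g ≤ s) (hsk : s < k) (hr : r < g)
    (hj : j < g) (hlt : P s r < P 0 j) (hnext : ∀ i < g, P s r < P 0 i → P 0 j ≤ P 0 i) :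
    P 1 j < P 0 j := by
  classical
  -- the chain descends to the preceding block
  have hstep : ∀ t i, t + 1 < k → i < g → P (t + 1) i < P 0 j →
      ∃ i' < g, P (t + 1) i < P t i' ∧ P t i' ≤ P 0 j := by
    intro t i ht hi hij
    let S := ((Finset.Ico (t + 1) k) ×ˢ (Finset.range g)).filter fun z => P z.1 z.2 < P 0 j
    have hS : (t + 1, i) ∈ S := by
      simp only [S, Finset.mem_filter, Finset.mem_product, Finset.mem_Ico, Finset.mem_range]
      exact ⟨⟨⟨le_rfl, ht⟩, hi⟩, hij⟩
    obtain ⟨⟨u, a⟩, huS, hmax⟩ := S.exists_max_image (fun z => P z.1 z.2) ⟨_, hS⟩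
    simp only [S, Finset.mem_filter, Finset.mem_product, Finset.mem_Ico, Finset.mem_range]
      at huS hmax
    obtain ⟨⟨⟨hu1, hu2⟩, ha⟩, haj⟩ := huS
    let T := ((Finset.range k) ×ˢ (Finset.range g)).filter fun z => P u a < P z.1 z.2
    have hT : (0, j) ∈ T := by
      simp only [T, Finset.mem_filter, Finset.mem_product, Finset.mem_range]
      exact ⟨⟨by omega, hj⟩, haj⟩
    obtain ⟨⟨v, b⟩, hvT, hmin⟩ := T.exists_min_image (fun z => P z.1 z.2) ⟨_, hT⟩
    simp only [T, Finset.mem_filter, Finset.mem_product, Finset.mem_range] at hvT hmin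
    obtain ⟨⟨hv, hb⟩, hab⟩ := hvT
    have hbj : P v b ≤ P 0 j := hmin (0, j) ⟨⟨by omega, hj⟩, haj⟩
    have hvt : v < t + 1 := by
      by_contra hcon
      rcases hbj.lt_or_eq with h1 | h1
      · exact absurd (hmax (v, b) ⟨⟨⟨by omega, hv⟩, hb⟩, h1⟩) (not_le.2 hab)
      · have := h.inj _ hv _ hb _ (by omega) _ hj h1
        omega
    have hclose : ¬ (u + 2 ≤ v ∨ v + 2 ≤ u) := by
      intro hcon
      obtain ⟨w, hw, c, hc, h1, h2⟩ := h.exists_between u hu2 a ha v hv b hb hab hcon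
      exact absurd (hmin (w, c) ⟨⟨hw, hc⟩, h1⟩) (not_le.2 h2)
    obtain rfl : v = t := by omega
    exact ⟨b, hb, (hmax (v + 1, i) ⟨⟨⟨le_rfl, ht⟩, hi⟩, hij⟩).trans_lt hab, hbj⟩
  have hchain : ∀ d ≤ s, ∃ e : ℕ → ℕ, (∀ t, s - d ≤ t → t ≤ s → e t < g ∧ P t (e t) ≤ P 0 j) ∧
      e s = r ∧ ∀ t, s - d ≤ t → t < s → P (t + 1) (e (t + 1)) < P t (e t) := by
    intro d
    induction d with
    | zero =>
      refine fun _ => ⟨fun _ => r, fun t ht ht' => ?_, rfl, fun t ht ht' => by omega⟩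
      obtain rfl : t = s := by omega
      exact ⟨hr, hlt.le⟩
    | succ d ih =>
      intro hd
      obtain ⟨e, he1, he2, he3⟩ := ih (by omega)
      obtain ⟨h1, h2⟩ := he1 (s - d) le_rfl (by omega)
      have h3 : P (s - (d + 1) + 1) (e (s - d)) < P 0 j := by
        rw [show s - (d + 1) + 1 = s - d by omega]
        refine lt_of_le_of_ne h2 fun heq => ?_
        have := h.inj _ (by omega) _ h1 _ (by omega) _ hj heq
        omega
      obtain ⟨i', hi', h4, h5⟩ := hstep _ _ (by omega) h1 h3
      refine ⟨Function.update e (s - (d + 1)) i', fun t ht ht' => ?_, ?_, fun t ht ht' => ?_⟩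
      · by_cases hte : t = s - (d + 1)
        · subst hte
          rw [Function.update_self]
          exact ⟨hi', h5⟩
        · rw [Function.update_of_ne hte]
          exact he1 t (by omega) ht'
      · rw [Function.update_of_ne (by omega), he2]
      · by_cases hte : t = s - (d + 1)
        · subst hte
          rw [Function.update_self, Function.update_of_ne (by omega)]
          rw [show s - (d + 1) + 1 = s - d by omega] at h4 ⊢
          exact h4
        · rw [Function.update_of_ne hte, Function.update_of_ne (by omega)]
          exact he3 t (by omega) ht'
  obtain ⟨e, he1, he2, he3⟩ := hchain s le_rfl
  have hanti : ∀ t u, t ≤ u → u ≤ s → P u (e u) ≤ P t (e t) := by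
    intro t u htu
    induction u, htu using Nat.le_induction with
    | base => exact fun _ => le_rfl
    | succ u hu ih => exact fun hus => (he3 u (by omega) (by omega)).le.trans (ih (by omega))
  obtain ⟨t, ht, u, hu, htu, heq⟩ : ∃ t ∈ Finset.range (s + 1), ∃ u ∈ Finset.range (s + 1),
      t ≠ u ∧ e t = e u := by
    refine Finset.exists_ne_map_eq_of_card_lt_of_maps_to (t := Finset.range g)
      (by simpa using by omega) fun t ht => ?_
    simp only [Finset.coe_range, Set.mem_Iio] at ht ⊢
    exact (he1 t (by omega) (by omega)).1
  simp only [Finset.mem_range] at ht hu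
  wlog hlt' : t < u generalizing t u
  · exact this u t htu.symm heq.symm hu ht (by omega)
  have hy := (he1 t (by omega) (by omega)).1
  have hyj := (he1 t (by omega) (by omega)).2
  have hru : P s r ≤ P u (e t) := by
    rw [heq, ← he2]
    exact hanti u s (by omega) le_rfl
  have hut : P u (e t) < P t (e t) := by
    have h1 := hanti (t + 1) u (by omega) (by omega)
    rw [← heq] at h1
    exact h1.trans_lt (he3 t (by omega) (by omega))
  have hdown : P 1 (e t) ≤ P 0 (e t) := by
    by_contra hcon
    exact absurd (h.mono_of_lt hy (not_le.1 hcon).le hlt'.le (by omega)) (not_le.2 hut)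
  have h0 : P t (e t) ≤ P 0 (e t) := h.anti_of_lt hy hdown (Nat.zero_le _) (by omega)
  have hj0 : P 0 j ≤ P 0 (e t) := hnext _ hy (hru.trans_lt (hut.trans_le h0))
  have h1 : P u j ≤ P u (e t) := by
    have := h.shift_add (t := 0) (t' := 0) (i := j) (i' := e t) u (by omega) (by omega) hj hy
    rw [zero_add] at this
    exact this.2 hj0
  by_contra hcon
  have h2 := h.mono_of_lt hj (not_lt.1 hcon) (Nat.zero_le u) (by omega)
  exact absurd (h2.trans h1) (not_le.2 (hut.trans_le hyj))

end BlockSeq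

/-- The pair is a shrinking pair of consecutive values of the first block. -/
structure IsGap (P : ℕ → ℕ → ℕ) (g : ℕ) (lo hi : Option ℕ) : Prop where
  lo_lt : ∀ i ∈ lo, i < g ∧ P 0 i < P 1 i
  hi_lt : ∀ j ∈ hi, j < g ∧ P 1 j < P 0 j
  ne_none : lo ≠ none ∨ hi ≠ none
  lt : ∀ i ∈ lo, ∀ j ∈ hi, P 0 i < P 0 j
  not_between : ∀ r < g, ¬ IsBetween (P 0) lo hi (P 0 r)

variable {P Q : ℕ → ℕ → ℕ} {g h k c : ℕ}

/-- Every entry of a late block lies in a gap of the first block. -/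
theorem BlockSeq.exists_isGap (hP : BlockSeq P g k) {s r : ℕ} (hs : g ≤ s) (hsk : s < k)
    (hr : r < g) : ∃ lo hi, IsGap P g lo hi ∧ IsBetween (P 0) lo hi (P s r) := by
  classical
  have hne : ∀ i < g, P 0 i ≠ P s r := fun i hi heq => by
    have := hP.inj 0 (by omega) i hi s hsk r hr heq
    omega
  have hlo : ∃ lo : Option ℕ, (∀ i ∈ lo, i < g ∧ P 0 i < P s r) ∧
      ∀ r' < g, P 0 r' < P s r → ∃ i ∈ lo, P 0 r' ≤ P 0 i := by
    by_cases hex : ((Finset.range g).filter fun i => P 0 i < P s r).Nonempty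
    · obtain ⟨i, hi, hmax⟩ := Finset.exists_max_image _ (P 0) hex
      simp only [Finset.mem_filter, Finset.mem_range] at hi hmax
      exact ⟨some i, by simpa using hi, fun r' hr' hlt => ⟨i, rfl, hmax r' ⟨hr', hlt⟩⟩⟩
    · rw [Finset.not_nonempty_iff_eq_empty, Finset.filter_eq_empty_iff] at hex
      exact ⟨none, by simp, fun r' hr' hlt => absurd hlt (hex (Finset.mem_range.2 hr'))⟩
  have hhi : ∃ hi : Option ℕ, (∀ j ∈ hi, j < g ∧ P s r < P 0 j) ∧
      ∀ r' < g, P s r < P 0 r' → ∃ j ∈ hi, P 0 j ≤ P 0 r' := by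
    by_cases hex : ((Finset.range g).filter fun i => P s r < P 0 i).Nonempty
    · obtain ⟨i, hi, hmin⟩ := Finset.exists_min_image _ (P 0) hex
      simp only [Finset.mem_filter, Finset.mem_range] at hi hmin
      exact ⟨some i, by simpa using hi, fun r' hr' hlt => ⟨i, rfl, hmin r' ⟨hr', hlt⟩⟩⟩
    · rw [Finset.not_nonempty_iff_eq_empty, Finset.filter_eq_empty_iff] at hex
      exact ⟨none, by simp, fun r' hr' hlt => absurd hlt (hex (Finset.mem_range.2 hr'))⟩
  obtain ⟨lo, hlo1, hlo2⟩ := hlo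
  obtain ⟨hi, hhi1, hhi2⟩ := hhi
  refine ⟨lo, hi,
    ⟨fun i hil => ⟨(hlo1 i hil).1, ?_⟩, fun j hjh => ⟨(hhi1 j hjh).1, ?_⟩, ?_, ?_, ?_⟩,
    fun i hil => (hlo1 i hil).2, fun j hjh => (hhi1 j hjh).2⟩
  · refine hP.dual.lt_of_next_above hs hsk hr (hlo1 i hil).1 (hlo1 i hil).2 fun i' hi' hlt => ?_
    obtain ⟨j, hj, hle⟩ := hlo2 i' hi' hlt
    rwa [Option.mem_unique hil hj]
  · refine hP.lt_of_next_above hs hsk hr (hhi1 j hjh).1 (hhi1 j hjh).2 fun j' hj' hlt => ?_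
    obtain ⟨j'', hj'', hle⟩ := hhi2 j' hj' hlt
    rwa [Option.mem_unique hjh hj'']
  · rcases (hne r hr).lt_or_gt with h1 | h1
    · obtain ⟨i, hi, -⟩ := hlo2 r hr h1
      left
      rintro rfl
      simp at hi
    · obtain ⟨i, hi, -⟩ := hhi2 r hr h1
      right
      rintro rfl
      simp at hi
  · exact fun i hil j hjh => (hlo1 i hil).2.trans (hhi1 j hjh).2
  · rintro r' hr' ⟨h1, h2⟩
    rcases (hne r' hr').lt_or_gt with h3 | h3
    · obtain ⟨i, hi, hle⟩ := hlo2 r' hr' h3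
      exact absurd (h1 i hi) (not_lt.2 hle)
    · obtain ⟨i, hi, hle⟩ := hhi2 r' hr' h3
      exact absurd (h2 i hi) (not_lt.2 hle)

/-- If the first `c` blocks of two sequences of blocks do not split each other's gaps, then no
block of the second sequence splits a gap of the first: an entry of a late block of `Q` in a gap
of `P` lies in a gap of `Q` as well, and of two gaps that meet, one has its bounds inside the
other or beyond it. -/
theorem not_between_of_core (hQ : BlockSeq Q h k)
    (hh : h ≤ c) (hc : 0 < c) (hne : ∀ i < g, ∀ j < h, P 0 i ≠ Q 0 j)
    (hPQ : ∀ lo hi, IsGap P g lo hi → ∀ t < c, ∀ r < h, ¬ IsBetween (P 0) lo hi (Q t r))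
    (hQP : ∀ lo hi, IsGap Q h lo hi → ∀ t < c, ∀ r < g, ¬ IsBetween (Q 0) lo hi (P t r))
    {lo hi : Option ℕ} (hgap : IsGap P g lo hi) {t r : ℕ} (ht : t < k) (hr : r < h) :
    ¬ IsBetween (P 0) lo hi (Q t r) := by
  by_cases htc : t < c
  · exact hPQ lo hi hgap t htc r hr
  rintro ⟨h1, h2⟩
  obtain ⟨lo', hi', hgap', h3, h4⟩ := hQ.exists_isGap (s := t) (by omega) ht hr
  rcases hgap.ne_none with hlo | hhi
  · obtain ⟨i, rfl⟩ := Option.ne_none_iff_exists'.1 hlo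
    have hi1 := hgap.lo_lt i rfl
    have hip := h1 i rfl
    refine hQP lo' hi' hgap' 0 hc i hi1.1 ⟨fun i' hi' => ?_, fun j' hj' => hip.trans (h4 j' hj')⟩
    by_contra hcon
    have hi'h := (hgap'.lo_lt i' hi').1
    refine hPQ _ _ hgap 0 hc i' hi'h ⟨fun a ha => ?_, fun b hb => (h3 i' hi').trans (h2 b hb)⟩
    obtain rfl : i = a := by simpa using ha
    have := hne i hi1.1 i' hi'h
    omega
  · obtain ⟨j, rfl⟩ := Option.ne_none_iff_exists'.1 hhi
    have hj1 := hgap.hi_lt j rfl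
    have hjp := h2 j rfl
    refine hQP lo' hi' hgap' 0 hc j hj1.1 ⟨fun i' hi' => (h3 i' hi').trans hjp, fun j' hj' => ?_⟩
    by_contra hcon
    have hj'h := (hgap'.hi_lt j' hj').1
    refine hPQ _ _ hgap 0 hc j' hj'h ⟨fun a ha => (h1 a ha).trans (h4 j' hj'), fun b hb => ?_⟩
    obtain rfl : j = b := by simpa using hb
    have := hne j hj1.1 j' hj'h
    omega

end Blocks

/-! ### An entry in a gap yields an antichain -/

/-- The entries of a permutation that traces a walk which from `δ` on goes round an unambiguous
cycle of length `g`, from the first position on whose window is disjoint from the window at `δ`: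
no earlier entry lies in a gap. Otherwise the last such entry can be moved further and further
into the gap. -/
theorem not_between_of_isWqo {C : Set Permutation} {m : ℕ} (hw : IsWqo C) (hC : WindowClosed m C)
    {X : ℕ → Permutation} (hXC : ∀ i, X i ∈ C ∧ (X i).len = m)
    (hadj : ∀ i, Overlaps m (X i) (X (i + 1))) {δ g : ℕ} (hm : 0 < m) (hg : m ≤ g)
    (hper : ∀ i, δ ≤ i → X (i + g) = X i) (hoff : ∀ i < δ, ∀ j, δ ≤ j → X i ≠ X j)
    (hX : ∀ n ≠ 0, Unambiguous m (fun i => X (δ + i)) n) {N : ℕ} {κ : Permutation}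
    (hκ : Traces m X N κ) (hN : δ + m + 2 * g ≤ κ.len) {lo hi : Option ℕ}
    (hgap : IsGap (fun t i => κ.entry (δ + m + t * g + i)) g lo hi) {q : ℕ} (hq : q < δ + m) :
    ¬ IsBetween (fun i => κ.entry (δ + m + i)) lo hi (κ.entry q) := by
  intro hqb
  have hlen : ∀ i, (X i).len = m := fun i => (hXC i).2
  have hκl := hκ.1
  -- entries whose windows lie on the cycle do not split gaps, by periodicity
  have hqδ : ∀ q, q < δ + m → IsBetween (fun i => κ.entry (δ + m + i)) lo hi (κ.entry q) →
      q < δ := by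
    intro q hq hqb
    by_contra hcon
    have hsh := fun {a b : ℕ} => hκ.shift_le_iff (a := a) (b := b) (fun i _ => hlen i)
      (δ := δ) (g := g) (by omega) (fun i hi _ => hper i hi) (fun n hn _ => hX n hn)
    refine hgap.not_between (q + g - (δ + m)) (by omega) ⟨fun i hi => ?_, fun j hj => ?_⟩
    · have h1 := hgap.lo_lt i hi
      have h2 := hqb.1 i hi
      have h3 := @hsh q (δ + m + i) (by omega) (by omega) (by omega) (by omega)
      simp only [zero_mul, add_zero, one_mul] at h1 ⊢
      rw [show δ + m + (q + g - (δ + m)) = q + g by omega]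
      rw [add_right_comm (δ + m) g i] at h1
      simp only [] at h2
      omega
    · have h1 := hgap.hi_lt j hj
      have h2 := hqb.2 j hj
      have h3 := @hsh (δ + m + j) q (by omega) (by omega) (by omega) (by omega)
      simp only [zero_mul, add_zero, one_mul] at h1 ⊢
      rw [show δ + m + (q + g - (δ + m)) = q + g by omega]
      rw [add_right_comm (δ + m) g j] at h1
      simp only [] at h2
      omega
  -- `q` is the last entry in the gap
  obtain ⟨q, hqδ', hqb, hqlast⟩ : ∃ q < δ,
      IsBetween (fun i => κ.entry (δ + m + i)) lo hi (κ.entry q) ∧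
      ∀ a, q < a → a < δ + m →
        ¬ IsBetween (fun i => κ.entry (δ + m + i)) lo hi (κ.entry a) := by
    classical
    let S := (Finset.range (δ + m)).filter fun a =>
      IsBetween (fun i => κ.entry (δ + m + i)) lo hi (κ.entry a)
    obtain ⟨a, ha, hmax⟩ := S.exists_max_image id
      ⟨q, Finset.mem_filter.2 ⟨Finset.mem_range.2 hq, hqb⟩⟩
    simp only [S, Finset.mem_filter, Finset.mem_range, id] at ha hmax
    refine ⟨a, hqδ a ha.1 ha.2, ha.2, fun b hab hb hbb => ?_⟩
    have := hmax b ⟨hb, hbb⟩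
    omega
  -- `K d` continues `κ` by `d + 2` further rounds
  have hext : ∀ d, ∃ K, Traces m X (N + (d + 2) * g) K ∧ IsFactorAt κ K 0 := by
    intro d
    exact (hκ.congr (Y := fun i => X (0 + i)) (fun i _ => by rw [zero_add])).extend
      (by omega) (fun i _ => hlen i) (fun i _ => hadj i) (by omega)
  choose K hK hκK using hext
  have hKl : ∀ d, (K d).len = κ.len + (d + 2) * g := fun d => by
    have := (hK d).1
    omega
  have hKκ : ∀ d a b, a < κ.len → b < κ.len →
      ((K d).entry a < (K d).entry b ↔ κ.entry a < κ.entry b) := by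
    intro d a b ha hb
    simpa using (hκK d).lt_iff ha hb
  have hKsh : ∀ d s a b, δ ≤ a → δ ≤ b → a + s * g < (K d).len → b + s * g < (K d).len →
      ((K d).entry (a + s * g) ≤ (K d).entry (b + s * g) ↔ (K d).entry a ≤ (K d).entry b) := by
    intro d s
    induction s with
    | zero => simp
    | succ s ih =>
      intro a b ha hb ha' hb'
      rw [add_one_mul, ← add_assoc] at ha' hb'
      rw [add_one_mul, ← add_assoc, ← add_assoc, ← ih a b ha hb (by omega) (by omega)]
      exact (hK d).shift_le_iff (fun i _ => hlen i) (by rw [add_mul]; omega)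
        (fun i hi _ => hper i hi) (fun n hn _ => hX n hn) (by omega) (by omega) ha' hb'
  have hbound : ∀ d t i, t ≤ d + 2 → i < g → δ + m + i + t * g < (K d).len := by
    intro d t i ht hi
    have := hKl d
    have : t * g ≤ (d + 2) * g := Nat.mul_le_mul_right _ ht
    omega
  have hup : ∀ d, ∀ i ∈ lo, ∀ t s, t < s → s ≤ d + 2 →
      (K d).entry (δ + m + i + t * g) < (K d).entry (δ + m + i + s * g) := by
    intro d i hi t s hts
    have h1 := hgap.lo_lt i hi
    simp only [zero_mul, add_zero, one_mul] at h1
    have h2 : (K d).entry (δ + m + i) < (K d).entry (δ + m + i + g) := by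
      rw [hKκ d _ _ (by omega) (by omega), add_right_comm _ i g]
      exact h1.2
    have h3 : ∀ t, t + 1 ≤ d + 2 →
        (K d).entry (δ + m + i + t * g) < (K d).entry (δ + m + i + (t + 1) * g) := by
      intro t ht
      have h4 := hbound d (t + 1) i ht h1.1
      have h5 := hKsh d t (δ + m + i + g) (δ + m + i) (by omega) (by omega)
        (by rw [add_one_mul] at h4; omega) (by rw [add_one_mul] at h4; omega)
      rw [show δ + m + i + (t + 1) * g = δ + m + i + g + t * g by ring]
      omega
    induction s, hts using Nat.le_induction with
    | base => exact h3 t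
    | succ s hs ih => exact fun hs' => (ih (by omega)).trans (h3 s hs')
  have hdown : ∀ d, ∀ j ∈ hi, ∀ t s, t < s → s ≤ d + 2 →
      (K d).entry (δ + m + j + s * g) < (K d).entry (δ + m + j + t * g) := by
    intro d j hj t s hts
    have h1 := hgap.hi_lt j hj
    simp only [zero_mul, add_zero, one_mul] at h1
    have h2 : (K d).entry (δ + m + j + g) < (K d).entry (δ + m + j) := by
      rw [hKκ d _ _ (by omega) (by omega), add_right_comm _ j g]
      exact h1.2
    have h3 : ∀ t, t + 1 ≤ d + 2 →
        (K d).entry (δ + m + j + (t + 1) * g) < (K d).entry (δ + m + j + t * g) := by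
      intro t ht
      have h4 := hbound d (t + 1) j ht h1.1
      have h5 := hKsh d t (δ + m + j) (δ + m + j + g) (by omega) (by omega)
        (by rw [add_one_mul] at h4; omega) (by rw [add_one_mul] at h4; omega)
      rw [show δ + m + j + (t + 1) * g = δ + m + j + g + t * g by ring]
      omega
    induction s, hts using Nat.le_induction with
    | base => exact h3 t
    | succ s hs ih => exact fun hs' => (h3 s hs').trans (ih (by omega))
  have hlohi : ∀ d t, t ≤ d + 2 → ∀ i ∈ lo, ∀ j ∈ hi,
      (K d).entry (δ + m + i + t * g) < (K d).entry (δ + m + j + t * g) := by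
    intro d t ht i hi j hj
    have h1 := hgap.lt i hi j hj
    have hi' := (hgap.lo_lt i hi).1
    have hj' := (hgap.hi_lt j hj).1
    simp only [zero_mul, add_zero] at h1
    rw [← hKκ d _ _ (by omega) (by omega)] at h1
    have := hKsh d t (δ + m + j) (δ + m + i) (by omega) (by omega) (hbound d t j ht hj')
      (hbound d t i ht hi')
    omega
  have hside : ∀ a, q < a → a < δ + m → (∃ i ∈ lo, κ.entry a < κ.entry (δ + m + i)) ∨
      ∃ j ∈ hi, κ.entry (δ + m + j) < κ.entry a := by
    intro a ha ha'
    have h1 := hqlast a ha ha'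
    rw [IsBetween, not_and_or] at h1
    rcases h1 with h1 | h1
    · push Not at h1
      obtain ⟨i, hi, hle⟩ := h1
      have hi' := (hgap.lo_lt i hi).1
      refine Or.inl ⟨i, hi, lt_of_le_of_ne hle fun heq => ?_⟩
      have := entry_inj (by omega) (by omega) heq
      omega
    · push Not at h1
      obtain ⟨j, hj, hle⟩ := h1
      have hj' := (hgap.hi_lt j hj).1
      refine Or.inr ⟨j, hj, lt_of_le_of_ne hle fun heq => ?_⟩
      have := entry_inj (by omega) (by omega) heq
      omega
  -- with all values `y` replaced by `2 * y + 1`, the entry at `q` is moved to the even value `v`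
  have hmove : ∀ d v, v % 2 = 0 → (∀ i ∈ lo, 2 * (K d).entry (δ + m + i) + 1 < v) →
      (∀ j ∈ hi, v < 2 * (K d).entry (δ + m + j) + 1) →
      ∃ ρ, Traces m (fun i => X (q + i)) (N + (d + 2) * g - q) ρ ∧
        ∀ y, 0 < y → q + y < (K d).len →
          (ρ.entry 0 ≤ ρ.entry y ↔ v ≤ 2 * (K d).entry (q + y) + 1) := by
    intro d v hv hvlo hvhi
    have hKd := (hK d).1
    obtain ⟨ρ, hρl, hρ⟩ := exists_pattern ((K d).len - q)
      (fun a => if a = 0 then v else 2 * (K d).entry (q + a) + 1) (fun a ha b hb hab => by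
        by_cases h1 : a = 0 <;> by_cases h2 : b = 0 <;> simp only [h1, h2, if_true, if_false] at hab
        · omega
        · omega
        · omega
        · have := entry_inj (σ := K d) (a := q + a) (b := q + b) (by omega) (by omega) (by omega)
          omega)
    have hqcmp : ∀ a, 0 < a → q + a < δ + m → (v ≤ 2 * (K d).entry (q + a) + 1 ↔
        (K d).entry q ≤ (K d).entry (q + a)) := by
      intro a ha ha'
      rcases hside (q + a) (by omega) ha' with ⟨i, hi, h1⟩ | ⟨j, hj, h1⟩
      · have hi' := (hgap.lo_lt i hi).1
        have h2 := hqb.1 i hi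
        simp only [] at h2
        rw [← hKκ d _ _ (by omega) (by omega)] at h1 h2
        have := hvlo i hi
        omega
      · have hj' := (hgap.hi_lt j hj).1
        have h2 := hqb.2 j hj
        simp only [] at h2
        rw [← hKκ d _ _ (by omega) (by omega)] at h1 h2
        have := hvhi j hj
        omega
    refine ⟨ρ, ⟨by omega, fun i hi => ⟨by rw [hlen]; omega, fun a b ha hb => ?_⟩⟩,
      fun y hy hy' => ?_⟩
    · rw [hlen] at ha hb
      rw [hρ _ (by omega) _ (by omega), ← ((hK d).2 (q + i) (by omega)).2 a b
        (by rw [hlen]; exact ha) (by rw [hlen]; exact hb)]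
      simp only [add_assoc]
      by_cases h1 : i + a = 0 <;> by_cases h2 : i + b = 0 <;>
        simp only [h1, h2, if_true, if_false, le_refl, add_zero]
      · exact hqcmp (i + b) (by omega) (by omega)
      · have h3 := hqcmp (i + a) (by omega) (by omega)
        have h4 : (K d).entry (q + (i + a)) ≠ (K d).entry q := fun heq => by
          have := entry_inj (by omega) (by omega) heq
          omega
        omega
      · omega
    · rw [hρ _ (by omega) _ (by omega)]
      simp [hy.ne']
  -- an embedding among the resulting permutations has offset `0`
  have hanti : ∀ (v : ℕ → ℕ) (z : ℕ), z < g → (∀ d, v d % 2 = 0) →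
      (∀ d, ∀ i ∈ lo, 2 * (K d).entry (δ + m + i) + 1 < v d) →
      (∀ d, ∀ j ∈ hi, v d < 2 * (K d).entry (δ + m + j) + 1) →
      ∃ d e, d < e ∧ (v d ≤ 2 * (K d).entry (δ + m + z + (d + 1) * g) + 1 ↔
        v e ≤ 2 * (K e).entry (δ + m + z + (d + 1) * g) + 1) := by
    intro v z hz h0 h1 h2
    choose ρ hρX hρ using fun d => hmove d (v d) (h0 d) (h1 d) (h2 d)
    obtain ⟨d, e, hde, o, ho⟩ := isWqo_iff.1 hw ρ fun d =>
      hC.mem_of_traces (hρX d) (by omega) fun i _ => hXC _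
    refine ⟨d, e, hde, ?_⟩
    have hX' := ((hρX d).eq_of_isFactorAt (hρX e) ho (fun i _ => hlen _) fun i _ => hlen _).2
    have ho0 : o = 0 := by
      by_contra hcon
      refine hoff (δ - 1) (by omega) (δ - 1 + o) (by omega) ?_
      have := hX' (δ - 1 - q) (by omega)
      rwa [show q + (δ - 1 - q) = δ - 1 by omega,
        show q + (o + (δ - 1 - q)) = δ - 1 + o by omega] at this
    subst ho0
    have hb := hbound d (d + 1) z (by omega) hz
    have hb' := hbound e (d + 1) z (by omega) hz
    obtain ⟨y, hy⟩ := Nat.exists_eq_add_of_le (show q ≤ δ + m + z + (d + 1) * g by omega)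
    have hρl := (hρX d).1
    have hKd := (hK d).1
    rw [hy] at hb hb' ⊢
    rw [← hρ d y (by omega) hb, ← hρ e y (by omega) hb']
    have := ho.2 0 y (by omega) (by omega)
    simpa using this.symm
  rcases hgap.ne_none with hlo | hhi
  · obtain ⟨i, hi'⟩ := Option.ne_none_iff_exists'.1 hlo
    obtain ⟨d, e, hde, hiff⟩ := hanti (fun d => 2 * (K d).entry (δ + m + i + d * g) + 2) i
      (hgap.lo_lt i hi').1 (fun d => by omega)
      (fun d i₂ hi₂ => by
        obtain rfl := Option.mem_unique hi' hi₂
        rcases Nat.eq_zero_or_pos d with rfl | hd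
        · simp
        · have := hup d i hi' 0 d hd (by omega)
          simp only [zero_mul, add_zero] at this
          omega)
      (fun d j hj => by
        have h1 := hlohi d d (by omega) i hi' j hj
        rcases Nat.eq_zero_or_pos d with rfl | hd
        · simp only [zero_mul, add_zero] at h1 ⊢
          omega
        · have := hdown d j hj 0 d hd (by omega)
          simp only [zero_mul, add_zero] at this
          omega)
    have h1 := hup d i hi' d (d + 1) (by omega) (by omega)
    have h2 : (K e).entry (δ + m + i + (d + 1) * g) ≤ (K e).entry (δ + m + i + e * g) := by
      rcases Nat.eq_or_lt_of_le (show d + 1 ≤ e from hde) with h | h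
      · rw [h]
      · exact (hup e i hi' _ _ h (by omega)).le
    omega
  · obtain ⟨j, hj'⟩ := Option.ne_none_iff_exists'.1 hhi
    obtain ⟨d, e, hde, hiff⟩ := hanti (fun d => 2 * (K d).entry (δ + m + j + d * g)) j
      (hgap.hi_lt j hj').1 (fun d => by omega)
      (fun d i hi => by
        have h1 := hlohi d d (by omega) i hi j hj'
        rcases Nat.eq_zero_or_pos d with rfl | hd
        · simp only [zero_mul, add_zero] at h1 ⊢
          omega
        · have := hup d i hi 0 d hd (by omega)
          simp only [zero_mul, add_zero] at this
          omega)
      (fun d j₂ hj₂ => by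
        obtain rfl := Option.mem_unique hj' hj₂
        rcases Nat.eq_zero_or_pos d with rfl | hd
        · simp
        · have := hdown d j hj' 0 d hd (by omega)
          simp only [zero_mul, add_zero] at this
          omega)
    have h1 := hdown d j hj' d (d + 1) (by omega) (by omega)
    have h2 : (K e).entry (δ + m + j + e * g) ≤ (K e).entry (δ + m + j + (d + 1) * g) := by
      rcases Nat.eq_or_lt_of_le (show d + 1 ≤ e from hde) with h | h
      · rw [h]
      · exact (hdown e j hj' _ _ h (by omega)).le
    omega

/-! ### Reversal -/

/-- The reverse of a permutation. -/
def reverse (σ : Permutation) : Permutation := ⟨σ.len, Fin.revPerm.trans σ.toPerm⟩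

@[simp] theorem reverse_len (σ : Permutation) : (reverse σ).len = σ.len := rfl

theorem reverse_entry {σ : Permutation} {i : ℕ} (h : i < σ.len) :
    (reverse σ).entry i = σ.entry (σ.len - 1 - i) := by
  have h1 : σ.len - 1 - i < σ.len := by omega
  have h2 : (⟨σ.len - 1 - i, h1⟩ : Fin σ.len) = Fin.rev ⟨i, h⟩ := by
    ext
    simp only [Fin.val_rev]
    omega
  simp only [Permutation.entry, h1, dif_pos, h2]
  exact dif_pos h

@[simp] theorem reverse_reverse (σ : Permutation) : reverse (reverse σ) = σ :=
  eq_of_entry_le_iff rfl fun a ha b hb => by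
    simp only [reverse_len] at ha hb
    have h : ∀ c < σ.len, (reverse (reverse σ)).entry c = σ.entry c := fun c hc => by
      rw [reverse_entry (by simpa using hc), reverse_entry (by simp only [reverse_len]; omega)]
      congr 1
      simp only [reverse_len]
      omega
    rw [h a ha, h b hb]

theorem IsFactorAt.reverse {σ τ : Permutation} {i j : ℕ} (h : IsFactorAt σ τ i)
    (hj : i + j + σ.len = τ.len) : IsFactorAt (reverse σ) (reverse τ) j := by
  refine ⟨by simp only [reverse_len]; omega, fun a b ha hb => ?_⟩
  simp only [reverse_len] at ha hb
  rw [reverse_entry (by omega), reverse_entry (by omega), reverse_entry ha, reverse_entry hb,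
    ← h.2 _ _ (by omega) (by omega)]
  rw [show τ.len - 1 - (j + a) = i + (σ.len - 1 - a) by omega,
    show τ.len - 1 - (j + b) = i + (σ.len - 1 - b) by omega]

theorem reverse_le_reverse {σ τ : Permutation} (h : σ ≤ τ) : reverse σ ≤ reverse τ := by
  obtain ⟨i, hi⟩ := h
  have := hi.1
  exact ⟨τ.len - σ.len - i, hi.reverse (by omega)⟩

theorem IsWqo.reverse {C : Set Permutation} (h : IsWqo C) :
    IsWqo {σ | ConsecPerm.reverse σ ∈ C} := by
  rw [isWqo_iff] at h ⊢
  intro f hf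
  obtain ⟨k, l, hkl, hle⟩ := h (fun n => ConsecPerm.reverse (f n)) hf
  exact ⟨k, l, hkl, by simpa using reverse_le_reverse hle⟩

theorem WindowClosed.reverse {m : ℕ} {C : Set Permutation} (h : WindowClosed m C) :
    WindowClosed m {σ | ConsecPerm.reverse σ ∈ C} := by
  intro σ hσ hwin
  refine h _ (by simpa using hσ) fun τ i hτ hi => ?_
  have h1 := hi.1
  simp only [reverse_len] at h1
  have := hwin (ConsecPerm.reverse τ) (σ.len - τ.len - i) (by simpa using hτ)
    (by simpa using hi.reverse (j := σ.len - τ.len - i) (by simp only [reverse_len]; omega))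
  simpa using this

theorem Overlaps.reverse {m : ℕ} {σ τ : Permutation} (h : Overlaps m σ τ) (hσ : σ.len = m)
    (hτ : τ.len = m) : Overlaps m (ConsecPerm.reverse τ) (ConsecPerm.reverse σ) := by
  intro a b ha hb
  rw [reverse_entry (by omega), reverse_entry (by omega), reverse_entry (by omega),
    reverse_entry (by omega), hσ, hτ]
  rw [show m - 1 - a = m - 1 - (a + 1) + 1 by omega, show m - 1 - b = m - 1 - (b + 1) + 1 by omega]
  exact (h _ _ (by omega) (by omega)).symm

theorem Traces.reverse {m : ℕ} {X : ℕ → Permutation} {n : ℕ} {σ : Permutation}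
    (h : Traces m X n σ) (hX : ∀ i < n, (X i).len = m) :
    Traces m (fun i => ConsecPerm.reverse (X (n - 1 - i))) n (ConsecPerm.reverse σ) := by
  have h1 := h.1
  refine ⟨h.1, fun i hi => (h.2 (n - 1 - i) (by omega)).reverse ?_⟩
  rw [hX _ (by omega)]
  omega

theorem IsGap.reverse {P : ℕ → ℕ → ℕ} {g : ℕ} {lo hi : Option ℕ} (h : IsGap P g lo hi) :
    IsGap (fun t i => P t (g - 1 - i)) g (lo.map (g - 1 - ·)) (hi.map (g - 1 - ·)) := by
  have hr : ∀ i < g, g - 1 - (g - 1 - i) = i := fun i hi => by omega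
  refine ⟨?_, ?_, by simpa using h.ne_none, ?_, ?_⟩
  · intro i hi
    obtain ⟨i, hi₀, rfl⟩ := Option.mem_map.1 hi
    have := h.lo_lt i hi₀
    simp only [hr i this.1]
    exact ⟨by omega, this.2⟩
  · intro j hj
    obtain ⟨j, hj₀, rfl⟩ := Option.mem_map.1 hj
    have := h.hi_lt j hj₀
    simp only [hr j this.1]
    exact ⟨by omega, this.2⟩
  · intro i hi j hj
    obtain ⟨i, hi₀, rfl⟩ := Option.mem_map.1 hi
    obtain ⟨j, hj₀, rfl⟩ := Option.mem_map.1 hj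
    simp only [hr i (h.lo_lt i hi₀).1, hr j (h.hi_lt j hj₀).1]
    exact h.lt i hi₀ j hj₀
  · rintro r hrg ⟨h1, h2⟩
    refine h.not_between (g - 1 - r) (by omega) ⟨fun i hi => ?_, fun j hj => ?_⟩
    · have := h1 _ (Option.mem_map_of_mem _ hi)
      simpa only [hr i (h.lo_lt i hi).1] using this
    · have := h2 _ (Option.mem_map_of_mem _ hj)
      simpa only [hr j (h.hi_lt j hj).1] using this

/-- The mirror image of `not_between_of_isWqo`, for walks that come from an unambiguous cycle. The
vertices of the walk are numbered from its end. -/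
theorem not_between_of_isWqo_left {C : Set Permutation} {m : ℕ} (hw : IsWqo C)
    (hC : WindowClosed m C) {Y : ℕ → Permutation} (hYC : ∀ i, Y i ∈ C ∧ (Y i).len = m)
    (hadj : ∀ i, Overlaps m (Y (i + 1)) (Y i)) {δ g : ℕ} (hm : 0 < m) (hg : m ≤ g)
    (hper : ∀ i, δ ≤ i → Y (i + g) = Y i) (hoff : ∀ i < δ, ∀ j, δ ≤ j → Y i ≠ Y j)
    (hY : ∀ n ≠ 0, Unambiguous m (fun i => Y (δ + (n - 1 - i))) n) {N : ℕ} {κ : Permutation}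
    (hκ : Traces m (fun i => Y (N - 1 - i)) N κ) (hN : δ + m + 2 * g ≤ κ.len) {lo hi : Option ℕ}
    (hgap : IsGap (fun t i => κ.entry (κ.len - (δ + m) - (t + 1) * g + i)) g lo hi) {q : ℕ}
    (hq : κ.len - (δ + m) ≤ q) (hqκ : q < κ.len) :
    ¬ IsBetween (fun i => κ.entry (κ.len - (δ + m) - g + i)) lo hi (κ.entry q) := by
  have hlen : ∀ i, (Y i).len = m := fun i => (hYC i).2
  have hl := hκ.1
  have hent : ∀ t i, t < 2 → i < g → (reverse κ).entry (δ + m + t * g + i) =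
      κ.entry (κ.len - (δ + m) - (t + 1) * g + (g - 1 - i)) := by
    intro t i ht hi
    have : t * g ≤ 1 * g := Nat.mul_le_mul_right _ (by omega)
    rw [reverse_entry (by omega), add_one_mul]
    congr 1
    omega
  have hX : ∀ n ≠ 0, Unambiguous m (fun i => reverse (Y (δ + i))) n := by
    intro n hn σ τ hσ hτ
    have h1 := (hσ.reverse (fun i _ => hlen _)).congr (Y := fun i => Y (δ + (n - 1 - i)))
      (fun i _ => by simp)
    have h2 := (hτ.reverse (fun i _ => hlen _)).congr (Y := fun i => Y (δ + (n - 1 - i)))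
      (fun i _ => by simp)
    rw [← reverse_reverse σ, hY n hn _ _ h1 h2, reverse_reverse]
  have hκ' : Traces m (fun i => reverse (Y i)) N (reverse κ) :=
    (hκ.reverse (fun i _ => hlen _)).congr (fun i hi => by
      rw [show N - 1 - (N - 1 - i) = i by omega])
  have hgap' := hgap.reverse
  have hgap'' : IsGap (fun t i => (reverse κ).entry (δ + m + t * g + i)) g
      (lo.map (g - 1 - ·)) (hi.map (g - 1 - ·)) := by
    have e0 : ∀ i, i < g → _ := fun i hi => hent 0 i (by omega) hi
    have e1 : ∀ i, i < g → _ := fun i hi => hent 1 i (by omega) hi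
    refine ⟨fun i hi => ?_, fun j hj => ?_, hgap'.ne_none, fun i hi j hj => ?_, fun r hr hb => ?_⟩
    · have h1 := hgap'.lo_lt i hi
      simp only [e0 i h1.1, e1 i h1.1]
      exact h1
    · have h1 := hgap'.hi_lt j hj
      simp only [e0 j h1.1, e1 j h1.1]
      exact h1
    · have h1 := (hgap'.lo_lt i hi).1
      have h2 := (hgap'.hi_lt j hj).1
      simp only [e0 i h1, e0 j h2]
      exact hgap'.lt i hi j hj
    · refine hgap'.not_between r hr ⟨fun i hi => ?_, fun j hj => ?_⟩
      · have h1 := (hgap'.lo_lt i hi).1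
        have := hb.1 i hi
        simpa only [e0 i h1, e0 r hr] using this
      · have h1 := (hgap'.hi_lt j hj).1
        have := hb.2 j hj
        simpa only [e0 j h1, e0 r hr] using this
  have hmain := not_between_of_isWqo hw.reverse hC.reverse (X := fun i => reverse (Y i))
    (fun i => ⟨by simpa using (hYC i).1, by simpa using hlen i⟩)
    (fun i => (hadj i).reverse (hlen _) (hlen _)) hm hg (fun i hi => congrArg _ (hper i hi))
    (fun i hi j hj heq => hoff i hi j hj (by simpa using congrArg reverse heq)) hX hκ'
    (by simpa using hN) hgap'' (q := κ.len - 1 - q) (by omega)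
  rintro ⟨h1, h2⟩
  rw [reverse_entry (by omega), show κ.len - 1 - (κ.len - 1 - q) = q by omega] at hmain
  have e0 : ∀ i < g, (reverse κ).entry (δ + m + (g - 1 - i)) =
      κ.entry (κ.len - (δ + m) - g + i) := by
    intro i hi
    rw [reverse_entry (by omega)]
    congr 1
    omega
  refine hmain ⟨fun i hi => ?_, fun j hj => ?_⟩
  · obtain ⟨i, hi₀, rfl⟩ := Option.mem_map.1 hi
    simp only [e0 i (hgap.lo_lt i hi₀).1]
    exact h1 i hi₀
  · obtain ⟨j, hj₀, rfl⟩ := Option.mem_map.1 hj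
    simp only [e0 j (hgap.hi_lt j hj₀).1]
    exact h2 j hj₀

/-! ### Periodic sequences and repetitions of lists -/

section Cyc

variable {V : Type*} (d : V)

/-- The periodic sequence that runs through a nonempty list again and again. -/
def cyc (l : List V) (i : ℕ) : V := l.getD (i % l.length) d

variable {d} {l : List V}

theorem cyc_of_lt {i : ℕ} (h : i < l.length) : cyc d l i = l[i] := by
  simp [cyc, Nat.mod_eq_of_lt h, h]

theorem cyc_congr {i j : ℕ} (h : i % l.length = j % l.length) : cyc d l i = cyc d l j := by
  rw [cyc, cyc, h]

theorem cyc_mem (h : l ≠ []) (i : ℕ) : cyc d l i ∈ l := by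
  have : i % l.length < l.length := Nat.mod_lt _ (List.length_pos_iff.2 h)
  simp [cyc, this]

theorem cyc_inj (h : l ≠ []) (hl : l.Nodup) {i j : ℕ} (hij : cyc d l i = cyc d l j) :
    i % l.length = j % l.length := by
  have hi : i % l.length < l.length := Nat.mod_lt _ (List.length_pos_iff.2 h)
  have hj : j % l.length < l.length := Nat.mod_lt _ (List.length_pos_iff.2 h)
  have : l[i % l.length] = l[j % l.length] := by simpa [cyc, hi, hj] using hij
  exact (hl.getElem_inj_iff).1 this

theorem exists_cyc_eq {v : V} (hv : v ∈ l) : ∃ i < l.length, v = cyc d l i := by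
  obtain ⟨i, hi, rfl⟩ := List.mem_iff_getElem.1 hv
  exact ⟨i, hi, (cyc_of_lt hi).symm⟩

theorem eq_seg_cyc : l = seg (cyc d l) 0 l.length := by
  refine List.ext_getElem (by simp) fun i hi _ => ?_
  simp [cyc_of_lt hi]

theorem append_take_one_eq_seg (h : l ≠ []) : l ++ l.take 1 = seg (cyc d l) 0 (l.length + 1) := by
  have := seg_append_take_one (x := cyc d l) (a := 0) (r := l.length) (List.length_pos_iff.2 h)
    (cyc_congr (by simp))
  rwa [← eq_seg_cyc] at this

theorem cyc_adj {R : V → V → Prop} (h : l ≠ []) (hl : (l ++ l.take 1).IsChain R) (i : ℕ) :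
    R (cyc d l i) (cyc d l (i + 1)) := by
  rw [append_take_one_eq_seg (d := d) h, seg_isChain] at hl
  have := hl (i % l.length) (by have := Nat.mod_lt i (List.length_pos_iff.2 h); omega)
  rw [zero_add, zero_add] at this
  rwa [cyc_congr (j := i) (by simp), cyc_congr (i := i % l.length + 1) (j := i + 1) (by simp)]
    at this

theorem iter_add (a b : ℕ) (l : List V) : iter (a + b) l = iter a l ++ iter b l := by
  rw [iter, iter, iter, List.replicate_add, List.flatten_append]

theorem iter_one (l : List V) : iter 1 l = l := by simp [iter]

theorem iter_iter (a b : ℕ) (l : List V) : iter a (iter b l) = iter (a * b) l := by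
  induction a with
  | zero => simp [iter]
  | succ a ih => rw [iter_add, ih, iter_one, add_one_mul, iter_add]

theorem iter_length (a : ℕ) (l : List V) : (iter a l).length = a * l.length := by
  simp [iter]

theorem iter_eq_seg (k : ℕ) : iter k l = seg (cyc d l) 0 (k * l.length) := by
  induction k with
  | zero => simp [iter, seg]
  | succ k ih =>
    rw [iter_add, iter_one, ih, add_one_mul, seg_add]
    congr 1
    nth_rw 1 [eq_seg_cyc (d := d) (l := l)]
    exact seg_congr fun i _ => cyc_congr (by simp)

theorem iter_rotate_eq_seg (k : ℕ) : iter k (l.rotate 1) = seg (cyc d l) 1 (k * l.length) := by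
  rw [iter_eq_seg (d := d), List.length_rotate]
  refine seg_congr fun i hi => ?_
  have hl : 0 < l.length := by
    by_contra hcon
    rw [show l.length = 0 by omega, mul_zero] at hi
    omega
  have h1 : i % l.length < (l.rotate 1).length := by
    rw [List.length_rotate]
    exact Nat.mod_lt _ hl
  have h2 : (1 + i) % l.length < l.length := Nat.mod_lt _ hl
  simp only [cyc, List.length_rotate, zero_add]
  rw [List.getD_eq_getElem _ _ h1, List.getD_eq_getElem _ _ h2, List.getElem_rotate]
  congr 1
  rw [Nat.mod_add_mod, add_comm]

theorem seg_drop (x : ℕ → V) (a n k : ℕ) : (seg x a n).drop k = seg x (a + k) (n - k) := by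
  refine List.ext_getElem (by simp) fun i hi _ => ?_
  simp [add_assoc]

theorem cons_seg (x : ℕ → V) (a n : ℕ) : x a :: seg x (a + 1) n = seg x a (n + 1) := by
  rw [add_comm n 1, seg_add]
  simp [seg]

theorem exists_of_pair_infix_seg {x : ℕ → V} {a n : ℕ} {u v : V} (h : [u, v] <:+: seg x a n) :
    ∃ i, i + 1 < n ∧ u = x (a + i) ∧ v = x (a + (i + 1)) := by
  obtain ⟨s, t, hst⟩ := h
  have hl := congrArg List.length hst
  simp at hl
  have h1 : (s ++ [u, v] ++ t)[s.length]? = some u := by simp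
  have h2 : (s ++ [u, v] ++ t)[s.length + 1]? = some v := by simp
  rw [hst, List.getElem?_eq_getElem (by simp; omega)] at h1 h2
  simp only [seg_getElem, Option.some.injEq] at h1 h2
  exact ⟨s.length, by omega, h1.symm, h2.symm⟩

end Cyc

theorem le_mul_numRep {m r : ℕ} (hr : 0 < r) : m ≤ r * numRep m r :=
  Nat.sInf_mem (s := {s : ℕ | m ≤ r * s}) ⟨m, Nat.le_mul_of_pos_left m hr⟩

/-! ### The walk of a balanced permutation -/

namespace Bicycle

variable {m : ℕ} {C : Set Permutation} (B : Bicycle (levelGraph m C))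

/-- A vertex of the bicycle, used as a default value. -/
def vert : Level m C := B.conn.head B.conn_ne_nil

/-- The initial cycle as a periodic sequence, from the exit vertex on. -/
def initCyc : ℕ → Level m C := cyc B.vert B.init

/-- The terminal cycle as a periodic sequence, from the entry vertex on. -/
def termCyc : ℕ → Level m C := cyc B.vert B.term

/-- The vertices of the connecting path as a sequence. -/
def connSeq (i : ℕ) : Level m C := B.conn.getD i B.vert

/-- The vertices of the path traced by the balanced permutations of cycle length `k`. -/
noncomputable def walk (k i : ℕ) : Level m C := (B.balancedPath k).getD i B.vert

/-- The number of vertices of the path traced by the balanced permutations of cycle length `k`. -/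
noncomputable def walkLen (k : ℕ) : ℕ := k * B.initLen + B.conn.length + k * B.termLen

theorem conn_length_pos : 0 < B.conn.length := List.length_pos_iff.2 B.conn_ne_nil

theorem conn_eq_seg : B.conn = seg B.connSeq 0 B.conn.length := eq_seg _ _

theorem initLen_eq : B.initLen = numRep m B.init.length * B.init.length := iter_length _ _

theorem termLen_eq : B.termLen = numRep m B.term.length * B.term.length := by
  rw [termLen, augTerm, iter_length, List.length_rotate]

theorem le_initLen (h : B.init ≠ []) : m ≤ B.initLen := by
  rw [initLen_eq, mul_comm]
  exact le_mul_numRep (List.length_pos_iff.2 h)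

theorem le_termLen (h : B.term ≠ []) : m ≤ B.termLen := by
  rw [termLen_eq, mul_comm]
  exact le_mul_numRep (List.length_pos_iff.2 h)

theorem init_ne_nil (h : B.initLen ≠ 0) : B.init ≠ [] := by
  intro h'
  simp [initLen_eq, h'] at h

theorem term_ne_nil (h : B.termLen ≠ 0) : B.term ≠ [] := by
  intro h'
  simp [termLen_eq, h'] at h

theorem iter_augInit (k : ℕ) : iter k B.augInit = seg B.initCyc 0 (k * B.initLen) := by
  rw [augInit, iter_iter, iter_eq_seg (d := B.vert), initLen_eq, mul_assoc]
  rfl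

theorem iter_augTerm (k : ℕ) : iter k B.augTerm = seg B.termCyc 1 (k * B.termLen) := by
  rw [augTerm, iter_iter, iter_rotate_eq_seg (d := B.vert), termLen_eq, mul_assoc]
  rfl

theorem balancedPath_length (k : ℕ) : (B.balancedPath k).length = B.walkLen k := by
  simp [balancedPath, iter_augInit, iter_augTerm, walkLen]
  ring

theorem balancedPath_eq_seg (k : ℕ) : B.balancedPath k = seg (B.walk k) 0 (B.walkLen k) := by
  rw [← balancedPath_length]
  exact eq_seg _ _

theorem initCyc_congr {i j : ℕ} (h : i % B.init.length = j % B.init.length) :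
    B.initCyc i = B.initCyc j := cyc_congr h

theorem termCyc_congr {i j : ℕ} (h : i % B.term.length = j % B.term.length) :
    B.termCyc i = B.termCyc j := cyc_congr h

theorem mul_initLen_mod (k : ℕ) : k * B.initLen % B.init.length = 0 := by
  rw [initLen_eq, ← mul_assoc, Nat.mul_mod_left]

theorem mul_termLen_mod (k : ℕ) : k * B.termLen % B.term.length = 0 := by
  rw [termLen_eq, ← mul_assoc, Nat.mul_mod_left]

theorem initCyc_add_mul (i k : ℕ) : B.initCyc (i + k * B.initLen) = B.initCyc i :=
  B.initCyc_congr (by rw [Nat.add_mod, mul_initLen_mod, add_zero, Nat.mod_mod])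

theorem termCyc_add_mul (i k : ℕ) : B.termCyc (i + k * B.termLen) = B.termCyc i :=
  B.termCyc_congr (by rw [Nat.add_mod, mul_termLen_mod, add_zero, Nat.mod_mod])

theorem initCyc_zero (h : B.init ≠ []) : B.initCyc 0 = B.connSeq 0 := by
  have h1 := B.init_head h
  have h2 : 0 < B.init.length := List.length_pos_iff.2 h
  rw [List.head?_eq_getElem?, List.head?_eq_getElem?, List.getElem?_eq_getElem h2,
    List.getElem?_eq_getElem B.conn_length_pos] at h1
  rw [initCyc, cyc_of_lt h2, connSeq, List.getD_eq_getElem _ _ B.conn_length_pos]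
  exact Option.some.inj h1

theorem termCyc_zero (h : B.term ≠ []) : B.termCyc 0 = B.connSeq (B.conn.length - 1) := by
  have h1 := B.term_head h
  have h2 : 0 < B.term.length := List.length_pos_iff.2 h
  have h3 : B.conn.length - 1 < B.conn.length := by have := B.conn_length_pos; omega
  rw [List.head?_eq_getElem?, List.getLast?_eq_getElem?, List.getElem?_eq_getElem h2,
    List.getElem?_eq_getElem h3] at h1
  rw [termCyc, cyc_of_lt h2, connSeq, List.getD_eq_getElem _ _ h3]
  exact Option.some.inj h1

theorem walk_init (h : B.init ≠ []) {k i : ℕ} (hi : i ≤ k * B.initLen) :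
    B.walk k i = B.initCyc i := by
  rcases hi.lt_or_eq with hi | rfl
  · rw [walk, balancedPath, iter_augInit, List.append_assoc, List.getD_append _ _ _ _ (by simpa),
      List.getD_eq_getElem _ _ (by simpa), seg_getElem, zero_add]
  · rw [walk, balancedPath, iter_augInit, List.append_assoc, List.getD_append_right _ _ _ _
      (by simp), List.getD_append _ _ _ _ (by simpa using B.conn_length_pos)]
    have := B.initCyc_add_mul 0 k
    rw [zero_add] at this
    rw [this, initCyc_zero B h]
    simp [connSeq]

theorem walk_conn {k i : ℕ} (hi : i < B.conn.length) :
    B.walk k (k * B.initLen + i) = B.connSeq i := by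
  rw [walk, balancedPath, iter_augInit, List.append_assoc, List.getD_append_right _ _ _ _
    (by simp), List.getD_append _ _ _ _ (by simpa using hi)]
  simp [connSeq]

theorem walk_term (h : B.term ≠ []) {k i : ℕ} (hi : i ≤ k * B.termLen) :
    B.walk k (k * B.initLen + (B.conn.length - 1) + i) = B.termCyc i := by
  have hp := B.conn_length_pos
  rcases Nat.eq_zero_or_pos i with rfl | hi0
  · rw [termCyc_zero B h, add_zero, walk_conn B (by omega)]
  · rw [walk, balancedPath, iter_augInit, iter_augTerm, List.getD_append_right _ _ _ _
      (by simp; omega), List.getD_eq_getElem _ _ (by simp; omega), seg_getElem]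
    congr 1
    simp
    omega

/-- The balanced path of cycle length `k` is the middle part of the longer ones. -/
theorem walk_add {j k i : ℕ} (hi : i < B.walkLen k) :
    B.walk (j + k) (j * B.initLen + i) = B.walk k i := by
  have h : B.balancedPath (j + k) = iter j B.augInit ++ B.balancedPath k ++ iter j B.augTerm := by
    rw [balancedPath, balancedPath, iter_add, add_comm j k, iter_add k j B.augTerm]
    simp [List.append_assoc]
  rw [← balancedPath_length] at hi
  rw [walk, h, List.append_assoc, List.getD_append_right _ _ _ _ (by simp [iter_augInit]),
    List.getD_append _ _ _ _ (by simpa [iter_augInit] using hi), walk]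
  simp [iter_augInit]

theorem initCyc_adj (h : B.init ≠ []) (i : ℕ) :
    (levelGraph m C).Adj (B.initCyc i) (B.initCyc (i + 1)) := cyc_adj h B.init_adj i

theorem termCyc_adj (h : B.term ≠ []) (i : ℕ) :
    (levelGraph m C).Adj (B.termCyc i) (B.termCyc (i + 1)) := cyc_adj h B.term_adj i

theorem walk_adj {k i : ℕ} (hi : i + 1 < B.walkLen k) :
    (levelGraph m C).Adj (B.walk k i) (B.walk k (i + 1)) := by
  rw [walkLen] at hi
  by_cases h1 : i + 1 ≤ k * B.initLen
  · have h0 : B.init ≠ [] := B.init_ne_nil (by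
      rintro h
      rw [h] at h1
      omega)
    rw [walk_init B h0 (by omega), walk_init B h0 h1]
    exact B.initCyc_adj h0 i
  · obtain ⟨i, rfl⟩ := Nat.exists_eq_add_of_le (show k * B.initLen ≤ i by omega)
    by_cases h2 : i + 1 < B.conn.length
    · rw [walk_conn B (by omega), add_assoc, walk_conn B h2]
      have := B.conn_adj
      rw [conn_eq_seg, seg_isChain] at this
      simpa using this i h2
    · obtain ⟨i, rfl⟩ := Nat.exists_eq_add_of_le (show B.conn.length - 1 ≤ i by omega)
      have h0 : B.term ≠ [] := B.term_ne_nil (by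
        rintro h
        rw [h] at hi
        omega)
      rw [← add_assoc, walk_term B h0 (by omega), add_assoc _ i 1, walk_term B h0 (by omega)]
      exact B.termCyc_adj h0 i

theorem mem_perms_balancedPath {k : ℕ} {κ : Permutation} :
    κ ∈ perms (B.balancedPath k) ↔ Traces m (fun i => (B.walk k i).1) (B.walkLen k) κ := by
  rw [balancedPath_eq_seg, mem_perms_seg]
  simp

theorem mem_initIterates {k : ℕ} {U : Permutation} (hm : 0 < m) :
    U ∈ B.initIterates k ↔ Traces m (fun i => (B.initCyc i).1) (k * B.initLen + 1 - m) U := by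
  rw [initIterates, iter_augInit, seg_take _ _ _ _ (by omega), mem_perms_seg]
  simp

theorem mem_termIterates {k : ℕ} {U : Permutation} (hm : 0 < m) :
    U ∈ B.termIterates k ↔ Traces m (fun i => (B.termCyc (m + i)).1) (k * B.termLen + 1 - m) U := by
  rw [termIterates, iter_augTerm, seg_drop, mem_perms_seg, show 1 + (m - 1) = m by omega,
    show k * B.termLen - (m - 1) = k * B.termLen + 1 - m by omega]

end Bicycle

/-! ### Cycles without ambiguity -/

/-- No cycle of the graph is ambiguous. -/
def NoAmbiguousCycle (m : ℕ) (C : Set Permutation) : Prop :=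
  ∀ π, IsCycle (levelGraph m C) π → ¬ Ambiguous π

theorem NoAmbiguousCycle.unambiguous {m : ℕ} {C : Set Permutation} (hamb : NoAmbiguousCycle m C)
    {d : Level m C} {l : List (Level m C)} (hl : l ≠ [])
    (hadj : (l ++ l.take 1).IsChain (levelGraph m C).Adj) (s n : ℕ) (hn : n ≠ 0) :
    Unambiguous m (fun i => (cyc d l (s + i)).1) n := by
  have hr : 0 < l.length := List.length_pos_iff.2 hl
  have hsn : s + n ≤ (s + n) * l.length := Nat.le_mul_of_pos_right _ hr
  set N := (s + n) * l.length + 1 with hN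
  have hcyc : IsCycle (levelGraph m C) (seg (cyc d l) 0 N) := by
    refine ⟨⟨?_, ?_⟩, by rw [seg_length]; omega, ?_⟩
    · intro h
      have := congrArg List.length h
      simp [hN] at this
    · rw [seg_isChain]
      intro i _
      rw [zero_add, zero_add]
      exact cyc_adj hl hadj i
    · rw [seg_head? (by omega), seg_getLast? (by omega)]
      exact congrArg some (cyc_congr (by simp [hN]))
  intro σ τ hσ hτ
  have hext : ∀ ρ, Traces m (fun i => (cyc d l (s + i)).1) n ρ →
      ∃ κ ∈ perms (seg (cyc d l) 0 N), IsFactorAt ρ κ s := by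
    intro ρ hρ
    obtain ⟨κ, hκ, hρκ⟩ := Traces.extend (X := fun i => (cyc d l i).1) (N := N) hρ hn
      (fun i _ => (cyc d l i).2.2) (fun i _ => cyc_adj hl hadj i) (by omega)
    refine ⟨κ, ?_, hρκ⟩
    rw [mem_perms_seg]
    simpa using hκ
  obtain ⟨κ, hκ, hσκ⟩ := hext σ hσ
  obtain ⟨κ', hκ', hτκ⟩ := hext τ hτ
  have := Set.not_nontrivial_iff.1 (hamb _ hcyc) hκ hκ'
  subst this
  have h1 := hσ.1
  have h2 := hτ.1
  exact hσκ.unique hτκ (by omega)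

/-- The empty permutation forms a cycle `v → v → v` of the `0`-dimensional factor graph, which is
traced by both permutations of length `2`. -/
theorem NoAmbiguousCycle.isEmpty_level_zero {C : Set Permutation}
    (hamb : NoAmbiguousCycle 0 C) : IsEmpty (Level 0 C) := by
  refine ⟨fun v => ?_⟩
  have hv : ∀ σ i, i ≤ σ.len → IsFactorAt v.1 σ i := fun σ i hi =>
    ⟨by rw [v.2.2]; omega, fun a b ha => by rw [v.2.2] at ha; omega⟩
  refine hamb [v, v, v] ⟨⟨by simp, ?_⟩, by simp, by simp⟩
    ⟨⟨2, Equiv.refl _⟩, ⟨by simp, fun i hi => ?_⟩,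
      ⟨2, Equiv.swap 0 1⟩, ⟨by simp, fun i hi => ?_⟩, ?_⟩
  · have : (levelGraph 0 C).Adj v v := fun a b ha => by omega
    simp [this]
  · have : ([v, v, v] : List (Level 0 C))[i] = v := by
      simp only [List.length_cons, List.length_nil] at hi
      interval_cases i <;> rfl
    rw [this]
    simp only [List.length_cons, List.length_nil] at hi
    exact hv _ _ (by simp only []; omega)
  · have : ([v, v, v] : List (Level 0 C))[i] = v := by
      simp only [List.length_cons, List.length_nil] at hi
      interval_cases i <;> rfl
    rw [this]
    simp only [List.length_cons, List.length_nil] at hi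
    exact hv _ _ (by simp only []; omega)
  · intro h
    have h1 : (⟨2, Equiv.refl _⟩ : Permutation).entry 0 =
        (⟨2, Equiv.swap 0 1⟩ : Permutation).entry 0 :=
      congrArg (fun σ : Permutation => σ.entry 0) h
    simp [Permutation.entry] at h1

/-! ### The iterates of a cycle as sequences of blocks -/

/-- The blocks of length `g` of the permutation that traces an unambiguous cycle of length `g`
form a `BlockSeq`: the blocks have length at least `m`, so entries of a common window lie in the
same or in neighbouring blocks. -/
theorem BlockSeq.of_traces {m g K : ℕ} {Z : ℕ → Permutation} {U : Permutation}
    (hg : m ≤ g) (hZ : ∀ i, (Z i).len = m) (hper : ∀ i, Z (i + g) = Z i)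
    (hamb : ∀ n ≠ 0, Unambiguous m Z n) (hU : Traces m Z (K * g + 1 - m) U) :
    BlockSeq (fun t i => U.entry (t * g + i)) g K := by
  rcases Nat.eq_zero_or_pos K with rfl | hK
  · exact ⟨fun t ht => by omega, fun t i t' i' ht => by omega, fun t ht => by omega⟩
  have hKg : g ≤ K * g := Nat.le_mul_of_pos_left g hK
  have hl : U.len = K * g := by
    have := hU.1
    omega
  have hlt : ∀ t < K, ∀ i < g, t * g + i < K * g := by
    intro t ht i hi
    have : (t + 1) * g ≤ K * g := Nat.mul_le_mul_right _ ht
    rw [add_one_mul] at this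
    omega
  refine ⟨?_, ?_, ?_⟩
  · intro t ht i hi t' ht' i' hi' heq
    have h1 := entry_inj (by rw [hl]; exact hlt t ht i hi) (by rw [hl]; exact hlt t' ht' i' hi') heq
    have h2 : t = t' := by
      have h3 := congrArg (· / g) h1
      rwa [mul_comm t, mul_comm t', Nat.mul_add_div (by omega), Nat.mul_add_div (by omega),
        Nat.div_eq_of_lt hi, Nat.div_eq_of_lt hi', add_zero, add_zero] at h3
    subst h2
    exact ⟨rfl, by omega⟩
  · intro t i t' i' ht ht' hi hi'
    have h1 := hlt (t + 1) ht i hi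
    have h2 := hlt (t' + 1) ht' i' hi'
    rw [add_one_mul] at h1 h2
    simp only [add_one_mul]
    have hK2 : 2 * g ≤ K * g := Nat.mul_le_mul_right _ (by omega)
    rw [add_right_comm _ g i, add_right_comm _ g i']
    refine hU.shift_le_iff (δ := 0) (fun i _ => hZ i) (by omega) (fun i _ _ => hper i)
      (fun n hn _ => ?_) (Nat.zero_le _) (Nat.zero_le _) (by omega) (by omega)
    simpa using hamb n hn
  · intro t ht i hi t' ht' i' hi' hlt' hd
    obtain ⟨c, hc, h1, h2⟩ := (hamb _ (by omega)).exists_between hU (fun i _ => hZ i)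
      (by rw [hl]; exact hlt t ht i hi) (by rw [hl]; exact hlt t' ht' i' hi') hlt' (by
        rcases hd with hd | hd
        · have := Nat.mul_le_mul_right g hd
          rw [add_mul] at this
          omega
        · have := Nat.mul_le_mul_right g hd
          rw [add_mul] at this
          omega)
    refine ⟨c / g, Nat.div_lt_of_lt_mul (by rw [mul_comm]; omega), c % g,
      Nat.mod_lt _ (by omega), ?_⟩
    simp only [Nat.div_add_mod' c g]
    exact ⟨h1, h2⟩

theorem BlockSeq.congr {P P' : ℕ → ℕ → ℕ} {g k : ℕ} (h : BlockSeq P g k)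
    (hPP' : ∀ t < k, ∀ i < g, ∀ t' < k, ∀ i' < g, (P t i ≤ P t' i' ↔ P' t i ≤ P' t' i')) :
    BlockSeq P' g k := by
  refine ⟨?_, ?_, ?_⟩
  · intro t ht i hi t' ht' i' hi' heq
    exact h.inj t ht i hi t' ht' i' hi' (le_antisymm ((hPP' _ ht _ hi _ ht' _ hi').2 heq.le)
      ((hPP' _ ht' _ hi' _ ht _ hi).2 heq.ge))
  · intro t i t' i' ht ht' hi hi'
    rw [← hPP' _ ht _ hi _ ht' _ hi', ← hPP' _ (by omega) _ hi _ (by omega) _ hi']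
    exact h.shift t i t' i' ht ht' hi hi'
  · intro t ht i hi t' ht' i' hi' hlt hd
    rw [← not_le, ← hPP' _ ht' _ hi' _ ht _ hi, not_le] at hlt
    obtain ⟨s, hs, j, hj, h1, h2⟩ := h.exists_between t ht i hi t' ht' i' hi' hlt hd
    refine ⟨s, hs, j, hj, ?_, ?_⟩
    · rwa [← not_le, ← hPP' _ hs _ hj _ ht _ hi, not_le]
    · rwa [← not_le, ← hPP' _ ht' _ hi' _ hs _ hj, not_le]

/-- The blocks in reverse order, as needed for `α_k ⋯ α_1`. -/
theorem BlockSeq.rev {P : ℕ → ℕ → ℕ} {g k : ℕ} (h : BlockSeq P g k) :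
    BlockSeq (fun t i => P (k - 1 - t) i) g k := by
  refine ⟨?_, ?_, ?_⟩
  · intro t ht i hi t' ht' i' hi' heq
    have := h.inj (k - 1 - t) (by omega) i hi (k - 1 - t') (by omega) i' hi' heq
    exact ⟨by omega, this.2⟩
  · intro t i t' i' ht ht' hi hi'
    have := h.shift (k - 1 - (t + 1)) i (k - 1 - (t' + 1)) i' (by omega) (by omega) hi hi'
    rw [show k - 1 - (t + 1) + 1 = k - 1 - t by omega,
      show k - 1 - (t' + 1) + 1 = k - 1 - t' by omega] at this
    exact this.symm
  · intro t ht i hi t' ht' i' hi' hlt hd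
    obtain ⟨s, hs, j, hj, h1, h2⟩ := h.exists_between (k - 1 - t) (by omega) i hi (k - 1 - t')
      (by omega) i' hi' hlt (by omega)
    refine ⟨k - 1 - s, by omega, j, hj, ?_⟩
    simp only [show k - 1 - (k - 1 - s) = s by omega]
    exact ⟨h1, h2⟩

theorem IsGap.congr {P P' : ℕ → ℕ → ℕ} {g k : ℕ} {lo hi : Option ℕ} (h : IsGap P g lo hi)
    (hk : 2 ≤ k)
    (hPP' : ∀ t < k, ∀ i < g, ∀ t' < k, ∀ i' < g, (P t i ≤ P t' i' ↔ P' t i ≤ P' t' i')) :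
    IsGap P' g lo hi := by
  have hlt : ∀ t < 2, ∀ i < g, ∀ t' < 2, ∀ i' < g, (P t i < P t' i' ↔ P' t i < P' t' i') := by
    intro t ht i hi t' ht' i' hi'
    rw [← not_le, ← not_le, hPP' t' (by omega) i' hi' t (by omega) i hi]
  refine ⟨fun i hi => ?_, fun j hj => ?_, h.ne_none, fun i hi j hj => ?_, fun r hr hb => ?_⟩
  · have := h.lo_lt i hi
    exact ⟨this.1, (hlt 0 (by omega) i this.1 1 (by omega) i this.1).1 this.2⟩
  · have := h.hi_lt j hj
    exact ⟨this.1, (hlt 1 (by omega) j this.1 0 (by omega) j this.1).1 this.2⟩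
  · exact (hlt 0 (by omega) i (h.lo_lt i hi).1 0 (by omega) j (h.hi_lt j hj).1).1 (h.lt i hi j hj)
  · refine h.not_between r hr ⟨fun i hi => ?_, fun j hj => ?_⟩
    · exact (hlt 0 (by omega) i (h.lo_lt i hi).1 0 (by omega) r hr).2 (hb.1 i hi)
    · exact (hlt 0 (by omega) r hr 0 (by omega) j (h.hi_lt j hj).1).2 (hb.2 j hj)

theorem exists_entry_eq {σ : Permutation} {v : ℕ} (hv : v < σ.len) :
    ∃ i < σ.len, σ.entry i = v := by
  refine ⟨σ.toPerm.symm ⟨v, hv⟩, Fin.is_lt _, ?_⟩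
  simp [Permutation.entry]

/-- Gaps are the shrinking pairs of consecutive values, in terms of the iterator `γ` and of the
comparisons between the first two blocks. -/
theorem isConsecutivePair_and_isShrinkingPair_iff {P : ℕ → ℕ → ℕ} {g k : ℕ} (hP : BlockSeq P g k)
    (hk : 2 ≤ k) {γ : Permutation} (hγl : γ.len = g)
    (hγ : ∀ i < g, ∀ j < g, (γ.entry i ≤ γ.entry j ↔ P 0 i ≤ P 0 j)) {s t : ℕ → ℕ}
    (hst : ∀ i < g, (s i < t i ↔ P 0 i < P 1 i) ∧ (t i < s i ↔ P 1 i < P 0 i))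
    (htt : ∀ i < g, ∀ j < g, (t i < t j ↔ P 1 i < P 1 j)) (lo hi : Option ℕ) :
    IsConsecutivePair γ lo hi ∧ IsShrinkingPair s t lo hi ↔ IsGap P g lo hi := by
  have hγ' : ∀ i < g, ∀ j < g, (P 0 i < P 0 j ↔ γ.entry i < γ.entry j) := by
    intro i hi j hj
    rw [← not_le, ← not_le, hγ j hj i hi]
  have hsh : ∀ i < g, ∀ j < g, (P 1 i < P 1 j ↔ P 0 i < P 0 j) := by
    intro i hi j hj
    rw [← not_le, ← not_le]
    exact not_congr (hP.shift 0 j 0 i (by omega) (by omega) hj hi)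
  subst hγl
  constructor
  · rintro ⟨hc, hs⟩
    match lo, hi with
    | none, none => exact hc.elim
    | none, some j =>
      obtain ⟨hj, hj0⟩ := hc
      refine ⟨by simp, ?_, by simp, by simp, ?_⟩
      · rintro _ ⟨⟩
        exact ⟨hj, ((hst j hj).2).1 hs⟩
      · rintro r hr ⟨-, h2⟩
        have := (hγ' r hr j hj).1 (h2 j rfl)
        omega
    | some i, none =>
      obtain ⟨hi, hi0⟩ := hc
      refine ⟨?_, by simp, by simp, by simp, ?_⟩
      · rintro _ ⟨⟩
        exact ⟨hi, ((hst i hi).1).1 hs⟩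
      · rintro r hr ⟨h1, -⟩
        have := (hγ' i hi r hr).1 (h1 i rfl)
        have := entry_lt hr
        omega
    | some i, some j =>
      obtain ⟨hi, hj, hij⟩ := hc
      obtain ⟨h1, -, h3⟩ := hs
      refine ⟨?_, ?_, by simp, ?_, ?_⟩
      · rintro _ ⟨⟩
        exact ⟨hi, ((hst i hi).1).1 h1⟩
      · rintro _ ⟨⟩
        exact ⟨hj, ((hst j hj).2).1 h3⟩
      · rintro _ ⟨⟩ _ ⟨⟩
        rw [hγ' i hi j hj]
        omega
      · rintro r hr ⟨h1, h2⟩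
        have := (hγ' i hi r hr).1 (h1 i rfl)
        have := (hγ' r hr j hj).1 (h2 j rfl)
        omega
  · intro h
    match lo, hi with
    | none, none => exact absurd h.ne_none (by simp)
    | none, some j =>
      obtain ⟨hj, hj1⟩ := h.hi_lt j rfl
      refine ⟨⟨hj, ?_⟩, ((hst j hj).2).2 hj1⟩
      by_contra hcon
      obtain ⟨r, hr, hr0⟩ := exists_entry_eq (show 0 < γ.len by omega)
      refine h.not_between r hr ⟨by simp, ?_⟩
      rintro _ ⟨⟩
      rw [hγ' r hr j hj]
      omega
    | some i, none =>
      obtain ⟨hi, hi1⟩ := h.lo_lt i rfl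
      refine ⟨⟨hi, ?_⟩, ((hst i hi).1).2 hi1⟩
      by_contra hcon
      have := entry_lt hi
      obtain ⟨r, hr, hr0⟩ := exists_entry_eq (show γ.entry i + 1 < γ.len by omega)
      refine h.not_between r hr ⟨?_, by simp⟩
      rintro _ ⟨⟩
      rw [hγ' i hi r hr]
      omega
    | some i, some j =>
      obtain ⟨hi, hi1⟩ := h.lo_lt i rfl
      obtain ⟨hj, hj1⟩ := h.hi_lt j rfl
      have hij := h.lt i rfl j rfl
      refine ⟨⟨hi, hj, ?_⟩, ((hst i hi).1).2 hi1, ?_, ((hst j hj).2).2 hj1⟩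
      · have h1 := (hγ' i hi j hj).1 hij
        by_contra hcon
        have := entry_lt hj
        obtain ⟨r, hr, hr0⟩ := exists_entry_eq (show γ.entry i + 1 < γ.len by omega)
        refine h.not_between r hr ⟨?_, ?_⟩
        · rintro _ ⟨⟩
          rw [hγ' i hi r hr]
          omega
        · rintro _ ⟨⟩
          rw [hγ' r hr j hj]
          omega
      · rw [htt i hi j hj, hsh i hi j hj]
        exact hij

namespace Bicycle

variable {m : ℕ} {C : Set Permutation} (B : Bicycle (levelGraph m C))

/-- Entry `i` of the block `α_{t+1}` of a balanced permutation of cycle length `k`. -/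
noncomputable def initBlock (k : ℕ) (κ : Permutation) (t i : ℕ) : ℕ :=
  κ.entry (k * B.initLen - (t + 1) * B.initLen + i)

/-- Entry `i` of the block `γ_{t+1}` of a balanced permutation of cycle length `k`. -/
noncomputable def termBlock (k : ℕ) (κ : Permutation) (t i : ℕ) : ℕ :=
  κ.entry (k * B.initLen + B.midLen + t * B.termLen + i)

variable {B} {k : ℕ} {κ κ' : Permutation}

theorem len_eq (hκ : κ ∈ perms (B.balancedPath k)) :
    κ.len = k * B.initLen + B.midLen + k * B.termLen := by
  have h1 := ((B.mem_perms_balancedPath).1 hκ).1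
  have := B.conn_length_pos
  rw [walkLen] at h1
  rw [midLen]
  omega

theorem initCyc_unambiguous (hamb : NoAmbiguousCycle m C) (h : B.init ≠ []) (s n : ℕ)
    (hn : n ≠ 0) : Unambiguous m (fun i => (B.initCyc (s + i)).1) n :=
  hamb.unambiguous h B.init_adj s n hn

theorem termCyc_unambiguous (hamb : NoAmbiguousCycle m C) (h : B.term ≠ []) (s n : ℕ)
    (hn : n ≠ 0) : Unambiguous m (fun i => (B.termCyc (s + i)).1) n :=
  hamb.unambiguous h B.term_adj s n hn

/-- The blocks `α_k ⋯ α_1` of a balanced permutation. -/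
theorem window_init (hm : 0 < m) (hκ : κ ∈ perms (B.balancedPath k)) (hk : 0 < k)
    (h : B.init ≠ []) {j : ℕ} (hj : j < k) :
    window κ (j * B.initLen) ((k - j) * B.initLen) ∈ B.initIterates (k - j) := by
  have hg := B.le_initLen h
  have hp := B.conn_length_pos
  obtain ⟨d, rfl⟩ := Nat.exists_eq_add_of_lt hj
  have e1 : j + d + 1 - j = d + 1 := by omega
  have hd : B.initLen ≤ (d + 1) * B.initLen := Nat.le_mul_of_pos_left _ (by omega)
  have e2 : (j + d + 1) * B.initLen = j * B.initLen + (d + 1) * B.initLen := by ring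
  rw [e1, B.mem_initIterates hm]
  have hκ' := (B.mem_perms_balancedPath).1 hκ
  have hl := len_eq hκ
  have hmid : B.midLen = B.conn.length - 1 + m := rfl
  refine (hκ'.factor (fun i _ => (B.walk _ i).2.2) (window_isFactorAt (by omega)) ?_
    (n := (d + 1) * B.initLen + 1 - m) (s := j * B.initLen)).congr fun i hi => ?_
  · rw [window_len (by omega)]
    omega
  · rw [walk_init B h (by omega), add_comm, initCyc_add_mul]

theorem window_term (hm : 0 < m) (hκ : κ ∈ perms (B.balancedPath k))
    (h : B.term ≠ []) {j : ℕ} (hj : j ≤ k) (hj0 : 0 < j) :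
    window κ (k * B.initLen + B.midLen) (j * B.termLen) ∈ B.termIterates j := by
  have hg := B.le_termLen h
  have hp := B.conn_length_pos
  have hd : B.termLen ≤ j * B.termLen := Nat.le_mul_of_pos_left _ hj0
  have hd' : j * B.termLen ≤ k * B.termLen := Nat.mul_le_mul_right _ hj
  rw [B.mem_termIterates hm]
  have hκ' := (B.mem_perms_balancedPath).1 hκ
  have hl := len_eq hκ
  have hmid : B.midLen = B.conn.length - 1 + m := rfl
  refine (hκ'.factor (fun i _ => (B.walk _ i).2.2) (window_isFactorAt (by omega)) ?_
    (n := j * B.termLen + 1 - m) (s := k * B.initLen + B.midLen)).congr fun i hi => ?_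
  · rw [window_len (by omega)]
    omega
  · rw [hmid, ← add_assoc, add_assoc _ m i, walk_term B h (by omega)]

theorem initIterates_eq (hm : 0 < m) (hamb : NoAmbiguousCycle m C) (h : B.init ≠ []) (hk : 0 < k)
    {U U' : Permutation} (hU : U ∈ B.initIterates k) (hU' : U' ∈ B.initIterates k) : U = U' := by
  have hg := B.le_initLen h
  have hd : B.initLen ≤ k * B.initLen := Nat.le_mul_of_pos_left _ hk
  rw [B.mem_initIterates hm] at hU hU'
  have := initCyc_unambiguous (B := B) hamb h 0 (k * B.initLen + 1 - m) (by omega)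
  simp only [zero_add] at this
  exact this U U' hU hU'

theorem termIterates_eq (hm : 0 < m) (hamb : NoAmbiguousCycle m C) (h : B.term ≠ []) (hk : 0 < k)
    {U U' : Permutation} (hU : U ∈ B.termIterates k) (hU' : U' ∈ B.termIterates k) : U = U' := by
  have hg := B.le_termLen h
  have hd : B.termLen ≤ k * B.termLen := Nat.le_mul_of_pos_left _ hk
  rw [B.mem_termIterates hm] at hU hU'
  exact termCyc_unambiguous (B := B) hamb h m (k * B.termLen + 1 - m) (by omega) U U' hU hU'

theorem initIterates_entry_le_iff (hm : 0 < m) (hamb : NoAmbiguousCycle m C)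
    (hκ : κ ∈ perms (B.balancedPath k)) (h : B.init ≠ []) {j : ℕ} (hj : j < k)
    {U : Permutation} (hU : U ∈ B.initIterates (k - j)) {a b : ℕ}
    (ha : a < (k - j) * B.initLen) (hb : b < (k - j) * B.initLen) :
    U.entry a ≤ U.entry b ↔
      κ.entry (j * B.initLen + a) ≤ κ.entry (j * B.initLen + b) := by
  have hl := len_eq hκ
  have e : j * B.initLen + (k - j) * B.initLen = k * B.initLen := by
    rw [← add_mul]
    congr 1
    omega
  rw [initIterates_eq hm hamb h (by omega) hU (window_init hm hκ (by omega) h hj)]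
  exact ((window_isFactorAt (by omega)).2 a b (by rw [window_len (by omega)]; omega)
    (by rw [window_len (by omega)]; omega)).symm

theorem termIterates_entry_le_iff (hm : 0 < m) (hamb : NoAmbiguousCycle m C)
    (hκ : κ ∈ perms (B.balancedPath k)) (h : B.term ≠ []) {j : ℕ} (hj : j ≤ k) (hj0 : 0 < j)
    {U : Permutation} (hU : U ∈ B.termIterates j) {a b : ℕ}
    (ha : a < j * B.termLen) (hb : b < j * B.termLen) :
    U.entry a ≤ U.entry b ↔ κ.entry (k * B.initLen + B.midLen + a) ≤
      κ.entry (k * B.initLen + B.midLen + b) := by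
  have hl := len_eq hκ
  have hd' : j * B.termLen ≤ k * B.termLen := Nat.mul_le_mul_right _ hj
  rw [termIterates_eq hm hamb h hj0 hU (window_term hm hκ h hj hj0)]
  exact ((window_isFactorAt (by omega)).2 a b (by rw [window_len (by omega)]; omega)
    (by rw [window_len (by omega)]; omega)).symm

theorem mul_add_lt {t k g i : ℕ} (ht : t < k) (hi : i < g) : t * g + i < k * g := by
  have : (t + 1) * g ≤ k * g := Nat.mul_le_mul_right _ ht
  rw [add_one_mul] at this
  omega

theorem termBlock_blockSeq (hm : 0 < m) (hamb : NoAmbiguousCycle m C)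
    (hκ : κ ∈ perms (B.balancedPath k)) (hk : 0 < k) (h : B.term ≠ []) :
    BlockSeq (B.termBlock k κ) B.termLen k := by
  have hU := window_term hm hκ h le_rfl hk
  refine (BlockSeq.of_traces (B.le_termLen h) (Z := fun i => (B.termCyc (m + i)).1)
    (fun i => (B.termCyc _).2.2) (fun i => ?_) (fun n hn => termCyc_unambiguous hamb h m n hn)
    ((B.mem_termIterates hm).1 hU)).congr fun t ht i hi t' ht' i' hi' => ?_
  · have := B.termCyc_add_mul (m + i) 1
    rw [one_mul, add_assoc] at this
    simp only [this]
  · rw [termIterates_entry_le_iff hm hamb hκ h le_rfl hk hU (mul_add_lt ht hi)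
      (mul_add_lt ht' hi'), termBlock, termBlock, add_assoc _ (t * _) i, add_assoc _ (t' * _) i']

theorem initBlock_blockSeq (hm : 0 < m) (hamb : NoAmbiguousCycle m C)
    (hκ : κ ∈ perms (B.balancedPath k)) (hk : 0 < k) (h : B.init ≠ []) :
    BlockSeq (B.initBlock k κ) B.initLen k := by
  have hU := window_init hm hκ hk h hk
  refine (BlockSeq.of_traces (B.le_initLen h) (Z := fun i => (B.initCyc i).1)
    (fun i => (B.initCyc _).2.2) (fun i => ?_) (fun n hn => ?_)
    ((B.mem_initIterates hm).1 hU)).rev.congr fun t ht i hi t' ht' i' hi' => ?_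
  · have := B.initCyc_add_mul i 1
    rw [one_mul] at this
    simp only [this]
  · have := initCyc_unambiguous (B := B) hamb h 0 n hn
    simpa using this
  · have e : ∀ t, (k - (t + 1)) * B.initLen = k * B.initLen - (t + 1) * B.initLen :=
      fun t => Nat.sub_mul _ _ _
    rw [Nat.sub_zero] at hU ⊢
    rw [initIterates_entry_le_iff hm hamb hκ h hk (by rw [Nat.sub_zero]; exact hU)
      (mul_add_lt (by omega) hi) (mul_add_lt (by omega) hi'), initBlock, initBlock, zero_mul,
      zero_add, zero_add, ← e, ← e]
    rw [show k - 1 - t = k - (t + 1) by omega, show k - 1 - t' = k - (t' + 1) by omega]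

end Bicycle

/-! ### Values in a gap -/

/-- Comparing with a value in a gap amounts to comparing with a bound of the gap. -/
theorem IsBetween.lt_iff {s : ℕ → ℕ} {lo hi : Option ℕ} {y v : ℕ}
    (hy : IsBetween s lo hi y) (hv : ¬ IsBetween s lo hi v) {i : ℕ} (hi' : i ∈ lo ∨ i ∈ hi)
    (hne : v ≠ s i) : v < y ↔ v < s i := by
  rcases hi' with hi' | hi'
  · have h1 := hy.1 i hi'
    refine ⟨fun h => ?_, fun h => by omega⟩
    by_contra hcon
    refine hv ⟨fun a ha => ?_, fun b hb => h.trans (hy.2 b hb)⟩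
    obtain rfl := Option.mem_unique hi' ha
    omega
  · have h1 := hy.2 i hi'
    refine ⟨fun h => by omega, fun h => ?_⟩
    by_contra hcon
    have h2 : y ≤ v := not_lt.1 hcon
    refine hv ⟨fun a ha => (hy.1 a ha).trans_le h2, fun b hb => ?_⟩
    obtain rfl := Option.mem_unique hi' hb
    omega

theorem IsGap.exists_mem {P : ℕ → ℕ → ℕ} {g : ℕ} {lo hi : Option ℕ}
    (h : IsGap P g lo hi) : ∃ i < g, i ∈ lo ∨ i ∈ hi := by
  rcases h.ne_none with h1 | h1
  · obtain ⟨i, hi⟩ := Option.ne_none_iff_exists'.1 h1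
    exact ⟨i, (h.lo_lt i hi).1, Or.inl hi⟩
  · obtain ⟨i, hi⟩ := Option.ne_none_iff_exists'.1 h1
    exact ⟨i, (h.hi_lt i hi).1, Or.inr hi⟩

theorem IsGap.isBetween_congr {P P' : ℕ → ℕ → ℕ} {g k : ℕ} {lo hi : Option ℕ}
    (h : IsGap P g lo hi) {t r : ℕ} (ht : t < k) (hr : r < g)
    (hPP' : ∀ t < k, ∀ i < g, ∀ t' < k, ∀ i' < g, (P t i ≤ P t' i' ↔ P' t i ≤ P' t' i'))
    (hb : IsBetween (P 0) lo hi (P t r)) : IsBetween (P' 0) lo hi (P' t r) := by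
  refine ⟨fun i hi => ?_, fun j hj => ?_⟩
  · rw [← not_le, ← hPP' t ht r hr 0 (by omega) i (h.lo_lt i hi).1, not_le]
    exact hb.1 i hi
  · rw [← not_le, ← hPP' 0 (by omega) j (h.hi_lt j hj).1 t ht r hr, not_le]
    exact hb.2 j hj

namespace Bicycle

variable {m : ℕ} {C : Set Permutation} {B : Bicycle (levelGraph m C)} {k : ℕ} {κ κ' : Permutation}

/-! ### Splittable pairs in terms of blocks -/

/-- The middle part of a balanced permutation is a balanced permutation of smaller cycle
length. -/
theorem window_balanced {j : ℕ} (hκ : κ ∈ perms (B.balancedPath (j + k))) :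
    window κ (j * B.initLen) (k * B.initLen + B.midLen + k * B.termLen) ∈
        perms (B.balancedPath k) ∧
      IsFactorAt (window κ (j * B.initLen) (k * B.initLen + B.midLen + k * B.termLen)) κ
        (j * B.initLen) ∧
      (window κ (j * B.initLen) (k * B.initLen + B.midLen + k * B.termLen)).len =
        k * B.initLen + B.midLen + k * B.termLen := by
  have hl := len_eq hκ
  rw [add_mul, add_mul] at hl
  have h : j * B.initLen + (k * B.initLen + B.midLen + k * B.termLen) ≤ κ.len := by omega
  refine ⟨?_, window_isFactorAt h, window_len h⟩
  rw [mem_perms_balancedPath] at hκ ⊢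
  have hp := B.conn_length_pos
  refine (hκ.factor (n := B.walkLen k) (fun i _ => (B.walk _ i).2.2) (window_isFactorAt h)
    ?_).congr fun i hi => ?_
  · rw [window_len h, walkLen, midLen]
    omega
  · rw [walk_add B hi]

theorem exists_extend_balanced {j : ℕ} (hκ : κ ∈ perms (B.balancedPath k)) :
    ∃ κ' ∈ perms (B.balancedPath (j + k)), IsFactorAt κ κ' (j * B.initLen) := by
  have hp := B.conn_length_pos
  rw [mem_perms_balancedPath] at hκ
  obtain ⟨κ', hκ', h⟩ := Traces.extend (X := fun i => (B.walk (j + k) i).1)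
    (N := B.walkLen (j + k)) (s := j * B.initLen) (n := B.walkLen k)
    (hκ.congr fun i hi => by rw [walk_add B hi]) (by rw [walkLen]; omega)
    (fun i _ => (B.walk _ i).2.2) (fun i hi => B.walk_adj hi) (by
      rw [walkLen, walkLen, add_mul, add_mul]
      omega)
  exact ⟨κ', (B.mem_perms_balancedPath).2 hκ', h⟩

/-- A pair is a shrinking pair of the terminal iterator if and only if it is a gap of the blocks
`γ_1, γ_2, …` of any balanced permutation; this is where unambiguity of the cycle enters. -/
theorem term_isGap_iff (hm : 0 < m) (hamb : NoAmbiguousCycle m C)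
    (hκ : κ ∈ perms (B.balancedPath k)) (hk : 2 ≤ k) (h : B.term ≠ []) {γ ρ : Permutation}
    (hγ : γ ∈ B.termIterates 1) (hρ : ρ ∈ B.termIterates 2) (lo hi : Option ℕ) :
    IsConsecutivePair γ lo hi ∧
        IsShrinkingPair ρ.entry (fun i => ρ.entry (B.termLen + i)) lo hi ↔
      IsGap (B.termBlock k κ) B.termLen lo hi := by
  have hg := B.le_termLen h
  have hγl := ((B.mem_termIterates hm).1 hγ).1
  have hρ' : ∀ a b, a < 2 * B.termLen → b < 2 * B.termLen → _ := fun a b ha hb =>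
    not_congr (termIterates_entry_le_iff hm hamb hκ h hk (by omega) hρ hb ha)
  simp only [not_le] at hρ'
  refine isConsecutivePair_and_isShrinkingPair_iff (termBlock_blockSeq hm hamb hκ (by omega) h) hk
    (by omega) (fun i hi j hj => ?_) (fun i hi => ⟨?_, ?_⟩) (fun i hi j hj => ?_) lo hi
  · rw [termIterates_entry_le_iff hm hamb hκ h (by omega) one_pos hγ (by omega) (by omega)]
    simp [termBlock]
  · rw [hρ' _ _ (by omega) (by omega)]
    simp [termBlock, add_assoc]
  · rw [hρ' _ _ (by omega) (by omega)]
    simp [termBlock, add_assoc]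
  · rw [hρ' _ _ (by omega) (by omega)]
    simp [termBlock, add_assoc]

theorem init_isGap_iff (hm : 0 < m) (hamb : NoAmbiguousCycle m C)
    (hκ : κ ∈ perms (B.balancedPath k)) (hk : 2 ≤ k) (h : B.init ≠ []) {α ρ : Permutation}
    (hα : α ∈ B.initIterates 1) (hρ : ρ ∈ B.initIterates 2) (lo hi : Option ℕ) :
    IsConsecutivePair α lo hi ∧
        IsShrinkingPair (fun i => ρ.entry (B.initLen + i)) ρ.entry lo hi ↔
      IsGap (B.initBlock k κ) B.initLen lo hi := by
  have hg := B.le_initLen h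
  have hαl := ((B.mem_initIterates hm).1 hα).1
  obtain ⟨n, rfl⟩ := Nat.exists_eq_add_of_le' hk
  have e0 : ∀ i, B.initBlock (n + 2) κ 0 i = κ.entry ((n + 1) * B.initLen + i) := fun i => by
    rw [initBlock, ← Nat.sub_mul]
    congr 2
  have e0' : ∀ i, B.initBlock (n + 2) κ 0 i = κ.entry (n * B.initLen + (B.initLen + i)) :=
    fun i => by rw [e0, add_one_mul, add_assoc]
  have e1 : ∀ i, B.initBlock (n + 2) κ 1 i = κ.entry (n * B.initLen + i) := fun i => by
    rw [initBlock, ← Nat.sub_mul]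
    congr 2
  have hρ' : ∀ a b, a < 2 * B.initLen → b < 2 * B.initLen →
      (ρ.entry a < ρ.entry b ↔
        κ.entry (n * B.initLen + a) < κ.entry (n * B.initLen + b)) := by
    intro a b ha hb
    have e : n + 2 - n = 2 := by omega
    have := initIterates_entry_le_iff (j := n) (U := ρ) (a := b) (b := a) hm hamb hκ h (by omega)
      (by rwa [e]) (by rwa [e]) (by rwa [e])
    rw [← not_le, ← not_le, this]
  refine isConsecutivePair_and_isShrinkingPair_iff (initBlock_blockSeq hm hamb hκ (by omega) h) hk
    (by omega) (fun i hi j hj => ?_) (fun i hi => ⟨?_, ?_⟩) (fun i hi j hj => ?_) lo hi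
  · have e : n + 2 - (n + 1) = 1 := by omega
    rw [initIterates_entry_le_iff (j := n + 1) hm hamb hκ h (by omega) (by rwa [e])
      (by rw [e]; omega) (by rw [e]; omega), e0, e0]
  · rw [hρ' _ _ (by omega) (by omega), e0', e1]
  · rw [hρ' _ _ (by omega) (by omega), e0', e1]
  · rw [hρ' _ _ (by omega) (by omega), e1, e1]

theorem initLen_le_coreLen : B.initLen ≤ B.coreLen := le_max_left _ _

theorem termLen_le_coreLen : B.termLen ≤ B.coreLen := le_max_right _ _

theorem isTermSplittable_of_isGap (hm : 0 < m) (hamb : NoAmbiguousCycle m C) {j : ℕ} (hj : 0 < j)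
    (hκ : κ ∈ perms (B.balancedPath (j + B.coreLen))) (h : B.term ≠ []) {lo hi : Option ℕ}
    (hgap : IsGap (B.termBlock (j + B.coreLen) κ) B.termLen lo hi) {q : ℕ}
    (hq : j * B.initLen ≤ q) (hq' : q < (j + B.coreLen) * B.initLen + B.midLen)
    (hb : IsBetween (B.termBlock (j + B.coreLen) κ 0) lo hi (κ.entry q)) :
    B.IsTermSplittable lo hi := by
  have hg := B.le_termLen h
  have hc := B.termLen_le_coreLen
  have h12 := (term_isGap_iff hm hamb hκ (by omega) h
    (window_term hm hκ h (j := 1) (by omega) one_pos)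
    (window_term hm hκ h (j := 2) (by omega) two_pos) lo hi).2 hgap
  obtain ⟨hmem, hfac, hwl⟩ := window_balanced hκ
  have hcb : B.termLen ≤ B.coreLen * B.termLen := Nat.le_mul_of_pos_left _ (by omega)
  rw [add_mul] at hq'
  obtain ⟨q, rfl⟩ := Nat.exists_eq_add_of_le hq
  have e : ∀ i, B.termBlock (j + B.coreLen) κ 0 i =
      κ.entry (j * B.initLen + (B.coreLen * B.initLen + B.midLen + i)) := fun i => by
    rw [termBlock, add_mul, zero_mul]
    congr 1
    omega
  refine ⟨h, ⟨_, window_term hm hκ h (j := 1) (by omega) one_pos, h12.1⟩,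
    ⟨_, window_term hm hκ h (j := 2) (by omega) two_pos, h12.2⟩, _, hmem, q, by omega,
    fun i hi => ?_, fun i hi => ?_⟩
  · have h1 := (hgap.lo_lt i hi).1
    rw [← hfac.lt_iff (by omega) (by omega), ← e]
    exact hb.1 i hi
  · have h1 := (hgap.hi_lt i hi).1
    rw [← hfac.lt_iff (by omega) (by omega), ← e]
    exact hb.2 i hi

theorem isInitSplittable_of_isGap (hm : 0 < m) (hamb : NoAmbiguousCycle m C) {j : ℕ} (hj : 0 < j)
    (hκ : κ ∈ perms (B.balancedPath (j + B.coreLen))) (h : B.init ≠ []) {lo hi : Option ℕ}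
    (hgap : IsGap (B.initBlock (j + B.coreLen) κ) B.initLen lo hi) {q : ℕ}
    (hq : (j + B.coreLen) * B.initLen ≤ q)
    (hq' : q < (j + B.coreLen) * B.initLen + B.midLen + B.coreLen * B.termLen)
    (hb : IsBetween (B.initBlock (j + B.coreLen) κ 0) lo hi (κ.entry q)) :
    B.IsInitSplittable lo hi := by
  have hg := B.le_initLen h
  have hc := B.initLen_le_coreLen
  obtain ⟨c, hcc⟩ : ∃ c, B.coreLen = c + 1 := ⟨B.coreLen - 1, by omega⟩
  have hk : 2 ≤ j + B.coreLen := by omega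
  have hα := window_init hm hκ (by omega) h (j := j + B.coreLen - 1) (by omega)
  have hρ := window_init hm hκ (by omega) h (j := j + B.coreLen - 2) (by omega)
  rw [show j + B.coreLen - (j + B.coreLen - 1) = 1 by omega] at hα
  rw [show j + B.coreLen - (j + B.coreLen - 2) = 2 by omega] at hρ
  have h12 := (init_isGap_iff hm hamb hκ hk h hα hρ lo hi).2 hgap
  obtain ⟨hmem, hfac, hwl⟩ := window_balanced hκ
  rw [add_mul] at hq hq'
  have hca : B.coreLen * B.initLen = c * B.initLen + B.initLen := by rw [hcc, add_one_mul]
  obtain ⟨q, rfl⟩ := Nat.exists_eq_add_of_le (show j * B.initLen ≤ q by omega)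
  have e : ∀ i, B.initBlock (j + B.coreLen) κ 0 i =
      κ.entry (j * B.initLen + ((B.coreLen - 1) * B.initLen + i)) := fun i => by
    rw [initBlock, add_mul, hca, hcc, zero_add, one_mul, Nat.add_sub_cancel]
    congr 1
    omega
  have hc1 : (B.coreLen - 1) * B.initLen = c * B.initLen := by rw [hcc, Nat.add_sub_cancel]
  refine ⟨h, ⟨_, hα, h12.1⟩, ⟨_, hρ, h12.2⟩, _, hmem, q, by omega, by omega,
    fun i hi => ?_, fun i hi => ?_⟩
  · have h1 := (hgap.lo_lt i hi).1
    rw [← hfac.lt_iff (by omega) (by omega), ← e]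
    exact hb.1 i hi
  · have h1 := (hgap.hi_lt i hi).1
    rw [← hfac.lt_iff (by omega) (by omega), ← e]
    exact hb.2 i hi

/-! ### Well quasi-order excludes splittable pairs -/

theorem not_isTermSplittable_of_isWqo (hw : IsWqo C) (hC : WindowClosed m C) (hm : 0 < m)
    (hamb : NoAmbiguousCycle m C) (lo hi : Option ℕ) : ¬ B.IsTermSplittable lo hi := by
  rintro ⟨h, ⟨γ, hγ, hcons⟩, ⟨ρ, hρ, hshr⟩, κ₀, hκ₀, q, hq, hb⟩
  have hg := B.le_termLen h
  have hc := B.termLen_le_coreLen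
  have hp := B.conn_length_pos
  obtain ⟨κ, hκ, hfac⟩ := exists_extend_balanced (j := 1) hκ₀
  have hgap := (term_isGap_iff hm hamb hκ (by omega) h hγ hρ lo hi).1 ⟨hcons, hshr⟩
  have hl := len_eq hκ
  have hl₀ := len_eq hκ₀
  set k := 1 + B.coreLen with hk
  have hka : k * B.initLen = 1 * B.initLen + B.coreLen * B.initLen := add_mul _ _ _
  have hkb : 2 * B.termLen ≤ k * B.termLen := Nat.mul_le_mul_right _ (by omega)
  have hcb : B.termLen ≤ B.coreLen * B.termLen := Nat.le_mul_of_pos_left _ (by omega)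
  let δ := k * B.initLen + (B.conn.length - 1)
  have hδm : δ + m = k * B.initLen + B.midLen := by
    simp only [δ, midLen]
    omega
  let X : ℕ → Level m C := fun i => if i < δ then B.walk k i else B.termCyc (i - δ)
  have hXδ : ∀ i, X (δ + i) = B.termCyc i := fun i => by simp [X]
  have hXw : ∀ i < B.walkLen k, X i = B.walk k i := by
    intro i hi
    by_cases h1 : i < δ
    · simp [X, h1]
    · obtain ⟨i, rfl⟩ := Nat.exists_eq_add_of_le (not_lt.1 h1)
      rw [hXδ, walk_term B h]
      simp only [walkLen, δ] at hi
      omega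
  have hδlen : δ < B.walkLen k := by
    simp only [walkLen, δ]
    omega
  refine not_between_of_isWqo hw hC (X := fun i => (X i).1) (fun i => (X i).2)
    (fun i => ?_) hm hg (fun i hi => ?_) (fun i hi j hj heq => ?_) (fun n hn => ?_)
    (((B.mem_perms_balancedPath).1 hκ).congr fun i hi => by rw [hXw i hi])
    (δ := δ) (lo := lo) (hi := hi) ?_ ?_ (q := 1 * B.initLen + q) ?_ ?_
  · change (levelGraph m C).Adj (X i) (X (i + 1))
    by_cases h1 : i < δ
    · rw [hXw i (by omega), hXw (i + 1) (by omega)]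
      exact B.walk_adj (by omega)
    · obtain ⟨i, rfl⟩ := Nat.exists_eq_add_of_le (not_lt.1 h1)
      rw [Nat.add_assoc δ i 1, hXδ, hXδ]
      exact B.termCyc_adj h i
  · obtain ⟨i, rfl⟩ := Nat.exists_eq_add_of_le hi
    rw [Nat.add_assoc δ i, hXδ, hXδ]
    have := B.termCyc_add_mul i 1
    rw [one_mul] at this
    rw [this]
  · have heq : X i = X j := Subtype.ext heq
    obtain ⟨j, rfl⟩ := Nat.exists_eq_add_of_le hj
    have hmem : X (δ + j) ∈ B.term := by
      rw [hXδ]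
      exact cyc_mem h _
    rw [← heq, hXw i (by omega)] at hmem
    by_cases h1 : i < k * B.initLen
    · have hi0 : B.init ≠ [] := B.init_ne_nil (by
        intro h0
        rw [h0] at h1
        omega)
      rw [walk_init B hi0 h1.le] at hmem
      exact B.init_disjoint_term _ (cyc_mem hi0 _) hmem
    · obtain ⟨i, rfl⟩ := Nat.exists_eq_add_of_le (not_lt.1 h1)
      simp only [δ] at hi
      rw [walk_conn B (by omega)] at hmem
      refine B.conn_dropLast_term _ ?_ hmem
      rw [conn_eq_seg, seg_dropLast, mem_seg]
      exact ⟨i, by omega, by rw [zero_add]⟩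
  · have := termCyc_unambiguous (B := B) hamb h 0 n hn
    simp only [zero_add] at this
    simpa only [hXδ] using this
  · rw [hδm]
    omega
  · rw [hδm]
    exact hgap
  · omega
  · rw [hδm]
    refine ⟨fun i hi => ?_, fun i hi => ?_⟩
    · have h1 := (hgap.lo_lt i hi).1
      have := (hfac.lt_iff (by omega) (by omega)).2 (hb.1 i hi)
      rwa [show 1 * B.initLen + (B.coreLen * B.initLen + B.midLen + i) =
        k * B.initLen + B.midLen + i by omega] at this
    · have h1 := (hgap.hi_lt i hi).1
      have := (hfac.lt_iff (by omega) (by omega)).2 (hb.2 i hi)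
      rwa [show 1 * B.initLen + (B.coreLen * B.initLen + B.midLen + i) =
        k * B.initLen + B.midLen + i by omega] at this

theorem not_isInitSplittable_of_isWqo (hw : IsWqo C) (hC : WindowClosed m C) (hm : 0 < m)
    (hamb : NoAmbiguousCycle m C) (lo hi : Option ℕ) : ¬ B.IsInitSplittable lo hi := by
  rintro ⟨h, ⟨α, hα, hcons⟩, ⟨ρ, hρ, hshr⟩, κ₀, hκ₀, q, hq, hq', hb⟩
  have hg := B.le_initLen h
  have hc := B.initLen_le_coreLen
  have hp := B.conn_length_pos
  have hr : 0 < B.init.length := List.length_pos_iff.2 h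
  obtain ⟨κ, hκ, hfac⟩ := exists_extend_balanced (j := 1) hκ₀
  have hgap := (init_isGap_iff hm hamb hκ (by omega) h hα hρ lo hi).1 ⟨hcons, hshr⟩
  have hl := len_eq hκ
  have hl₀ := len_eq hκ₀
  obtain ⟨c, hcc⟩ : ∃ c, B.coreLen = c + 1 := ⟨B.coreLen - 1, by omega⟩
  set k := 1 + B.coreLen with hk
  have hka : k * B.initLen = 1 * B.initLen + B.coreLen * B.initLen := add_mul _ _ _
  have hca : B.coreLen * B.initLen = c * B.initLen + B.initLen := by rw [hcc, add_one_mul]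
  have hka2 : 2 * B.initLen ≤ k * B.initLen := Nat.mul_le_mul_right _ (by omega)
  have hkb : k * B.termLen = 1 * B.termLen + B.coreLen * B.termLen := add_mul _ _ _
  let δ := k * B.termLen + (B.conn.length - 1)
  have hδN : B.walkLen k = k * B.initLen + 1 + δ := by
    simp only [walkLen, δ]
    omega
  have hδm : κ.len - (δ + m) = k * B.initLen := by
    simp only [δ]
    rw [hl, midLen]
    omega
  have hδl : δ + m ≤ κ.len := by
    simp only [δ]
    rw [hl, midLen]
    omega
  -- `j * (r - 1)` is congruent to `- j` modulo the length `r` of the cycle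
  let Y : ℕ → Level m C := fun i => if i < δ then B.walk k (B.walkLen k - 1 - i) else
    B.initCyc ((i - δ) * (B.init.length - 1))
  have hYδ : ∀ i, Y (δ + i) = B.initCyc (i * (B.init.length - 1)) := fun i => by simp [Y]
  have hmod : ∀ a b c, a + c * B.init.length = b → B.initCyc a = B.initCyc b := by
    rintro a b c rfl
    exact B.initCyc_congr (by simp)
  have hYw : ∀ i < B.walkLen k, Y i = B.walk k (B.walkLen k - 1 - i) := by
    intro i hi
    by_cases h1 : i < δ
    · simp [Y, h1]
    · obtain ⟨i, rfl⟩ := Nat.exists_eq_add_of_le (not_lt.1 h1)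
      rw [hYδ, show B.walkLen k - 1 - (δ + i) = k * B.initLen - i by omega,
        walk_init B h (by omega)]
      obtain ⟨d, hd⟩ := Nat.exists_eq_add_of_le (show i ≤ k * B.initLen by omega)
      rw [← B.initCyc_add_mul (i * (B.init.length - 1)) k]
      refine (hmod _ _ i ?_).symm
      obtain ⟨r, hr'⟩ := Nat.exists_eq_add_of_lt hr
      rw [hr', hd, zero_add, Nat.add_sub_cancel, Nat.add_sub_cancel_left]
      ring
  refine not_between_of_isWqo_left hw hC (Y := fun i => (Y i).1) (fun i => (Y i).2)
    (fun i => ?_) hm hg (fun i hi => ?_) (fun i hi j hj heq => ?_) (fun n hn => ?_)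
    (N := B.walkLen k) (((B.mem_perms_balancedPath).1 hκ).congr fun i hi => ?_)
    (δ := δ) (lo := lo) (hi := hi) ?_ ?_ (q := 1 * B.initLen + q) ?_ ?_ ?_
  · change (levelGraph m C).Adj (Y (i + 1)) (Y i)
    by_cases h1 : i < δ
    · rw [hYw i (by omega), hYw (i + 1) (by omega),
        show B.walkLen k - 1 - i = B.walkLen k - 1 - (i + 1) + 1 by omega]
      exact B.walk_adj (by omega)
    · obtain ⟨i, rfl⟩ := Nat.exists_eq_add_of_le (not_lt.1 h1)
      rw [Nat.add_assoc δ i 1, hYδ, hYδ, hmod (i * (B.init.length - 1))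
        ((i + 1) * (B.init.length - 1) + 1) 1 (by rw [add_one_mul]; omega)]
      exact B.initCyc_adj h _
  · obtain ⟨i, rfl⟩ := Nat.exists_eq_add_of_le hi
    rw [Nat.add_assoc δ i, hYδ, hYδ, add_mul, mul_comm B.initLen, initCyc_add_mul]
  · have heq : Y i = Y j := Subtype.ext heq
    obtain ⟨j, rfl⟩ := Nat.exists_eq_add_of_le hj
    have hmem : Y (δ + j) ∈ B.init := by
      rw [hYδ]
      exact cyc_mem h _
    rw [← heq, hYw i (by omega)] at hmem
    obtain ⟨d, hd⟩ := Nat.exists_eq_add_of_le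
      (show k * B.initLen + 1 ≤ B.walkLen k - 1 - i by omega)
    rw [hd] at hmem
    by_cases h1 : d + 1 < B.conn.length
    · rw [add_assoc, walk_conn B (by omega)] at hmem
      refine B.conn_tail_init _ ?_ hmem
      rw [conn_eq_seg, seg_tail, mem_seg]
      exact ⟨d, by omega, by rw [zero_add]⟩
    · obtain ⟨d, rfl⟩ := Nat.exists_eq_add_of_le (show B.conn.length - 1 ≤ d by omega)
      have ht0 : B.term ≠ [] := B.term_ne_nil (by
        intro h0
        simp only [δ, h0] at hi hδN
        omega)
      rw [show k * B.initLen + 1 + (B.conn.length - 1 + d) =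
        k * B.initLen + (B.conn.length - 1) + (d + 1) by omega, walk_term B ht0 (by
          simp only [δ] at hδN
          omega)] at hmem
      exact B.init_disjoint_term _ hmem (cyc_mem ht0 _)
  · intro σ τ hσ hτ
    refine initCyc_unambiguous (B := B) hamb h ((n - 1) * (B.init.length - 1)) n hn σ τ
      (hσ.congr fun i hi => ?_) (hτ.congr fun i hi => ?_) <;>
    · simp only [hYδ]
      refine congrArg Subtype.val (hmod _ _ i ?_)
      obtain ⟨r, hr'⟩ := Nat.exists_eq_add_of_lt hr
      obtain ⟨e, he⟩ := Nat.exists_eq_add_of_le (show i ≤ n - 1 by omega)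
      rw [hr', he, zero_add, Nat.add_sub_cancel, Nat.add_sub_cancel_left]
      ring
  · rw [hYw _ (by omega)]
    rw [show B.walkLen k - 1 - (B.walkLen k - 1 - i) = i by omega]
  · omega
  · rw [hδm]
    exact hgap
  · rw [hδm]
    omega
  · omega
  · rw [hδm]
    have hc1 : (B.coreLen - 1) * B.initLen = c * B.initLen := by rw [hcc, Nat.add_sub_cancel]
    refine ⟨fun i hi => ?_, fun i hi => ?_⟩
    · have h1 := (hgap.lo_lt i hi).1
      have := (hfac.lt_iff (by omega) (by omega)).2 (hb.1 i hi)
      rwa [show 1 * B.initLen + ((B.coreLen - 1) * B.initLen + i) =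
        k * B.initLen - B.initLen + i by omega] at this
    · have h1 := (hgap.hi_lt i hi).1
      have := (hfac.lt_iff (by omega) (by omega)).2 (hb.2 i hi)
      rwa [show 1 * B.initLen + ((B.coreLen - 1) * B.initLen + i) =
        k * B.initLen - B.initLen + i by omega] at this

/-! ### A balanced permutation is determined by its core -/

theorem exists_initBlock_eq {q : ℕ} (hq : q < k * B.initLen) :
    ∃ t < k, ∃ i < B.initLen, k * B.initLen - (t + 1) * B.initLen + i = q := by
  have ha : 0 < B.initLen := by
    by_contra hcon
    rw [show B.initLen = 0 by omega, mul_zero] at hq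
    omega
  have h1 := Nat.div_add_mod' (k * B.initLen - 1 - q) B.initLen
  have h2 := Nat.mod_lt (k * B.initLen - 1 - q) ha
  refine ⟨(k * B.initLen - 1 - q) / B.initLen,
    Nat.div_lt_of_lt_mul (by rw [mul_comm B.initLen k]; omega), B.initLen - 1 -
      (k * B.initLen - 1 - q) % B.initLen, by omega, ?_⟩
  rw [add_one_mul]
  have h3 : ((k * B.initLen - 1 - q) / B.initLen + 1) * B.initLen ≤ k * B.initLen :=
    Nat.mul_le_mul_right _ (Nat.div_lt_of_lt_mul (by rw [mul_comm B.initLen k]; omega))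
  rw [add_one_mul] at h3
  omega

theorem exists_termBlock_eq {x : ℕ} (hx : x < k * B.termLen) :
    ∃ t < k, ∃ i < B.termLen, t * B.termLen + i = x := by
  have hb : 0 < B.termLen := by
    by_contra hcon
    rw [show B.termLen = 0 by omega, mul_zero] at hx
    omega
  exact ⟨x / B.termLen, Nat.div_lt_of_lt_mul (by rw [mul_comm B.termLen k]; omega), x % B.termLen,
    Nat.mod_lt _ hb, Nat.div_add_mod' _ _⟩

theorem termBlock_core (hm : 0 < m) (hamb : NoAmbiguousCycle m C) (hB : ¬ B.HasSplittablePair)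
    {j : ℕ} (hj : 0 < j) (hκ : κ ∈ perms (B.balancedPath (j + B.coreLen))) (h : B.term ≠ [])
    {lo hi : Option ℕ} (hgap : IsGap (B.termBlock (j + B.coreLen) κ) B.termLen lo hi) {q : ℕ}
    (hq : j * B.initLen ≤ q) (hq' : q < (j + B.coreLen) * B.initLen + B.midLen) :
    ¬ IsBetween (B.termBlock (j + B.coreLen) κ 0) lo hi (κ.entry q) := fun hb =>
  hB ⟨lo, hi, Or.inr (isTermSplittable_of_isGap hm hamb hj hκ h hgap hq hq' hb)⟩

theorem initBlock_core (hm : 0 < m) (hamb : NoAmbiguousCycle m C) (hB : ¬ B.HasSplittablePair)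
    {j : ℕ} (hj : 0 < j) (hκ : κ ∈ perms (B.balancedPath (j + B.coreLen))) (h : B.init ≠ [])
    {lo hi : Option ℕ} (hgap : IsGap (B.initBlock (j + B.coreLen) κ) B.initLen lo hi) {q : ℕ}
    (hq : (j + B.coreLen) * B.initLen ≤ q)
    (hq' : q < (j + B.coreLen) * B.initLen + B.midLen + B.coreLen * B.termLen) :
    ¬ IsBetween (B.initBlock (j + B.coreLen) κ 0) lo hi (κ.entry q) := fun hb =>
  hB ⟨lo, hi, Or.inl (isInitSplittable_of_isGap hm hamb hj hκ h hgap hq hq' hb)⟩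

theorem initBlock_ne_termBlock (hκ : κ ∈ perms (B.balancedPath k)) {t t' i i' : ℕ}
    (ht : t < k) (ht' : t' < k) (hi : i < B.initLen) (hi' : i' < B.termLen) :
    B.initBlock k κ t i ≠ B.termBlock k κ t' i' := by
  intro heq
  have hl := len_eq hκ
  have h1 : (t + 1) * B.initLen ≤ k * B.initLen := Nat.mul_le_mul_right _ ht
  have h2 := mul_add_lt ht' hi'
  rw [add_one_mul] at h1
  rw [initBlock, termBlock, add_one_mul] at heq
  have := entry_inj (by omega) (by omega) heq
  omega

/-- Without splittable pairs, no entry of `α_k ⋯ α_1 β` lies in a gap of `γ_1`. -/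
theorem termBlock_not_between (hm : 0 < m) (hamb : NoAmbiguousCycle m C)
    (hB : ¬ B.HasSplittablePair) {j : ℕ} (hj : 0 < j)
    (hκ : κ ∈ perms (B.balancedPath (j + B.coreLen))) (h : B.term ≠ []) {lo hi : Option ℕ}
    (hgap : IsGap (B.termBlock (j + B.coreLen) κ) B.termLen lo hi) {q : ℕ}
    (hq : q < (j + B.coreLen) * B.initLen + B.midLen) :
    ¬ IsBetween (B.termBlock (j + B.coreLen) κ 0) lo hi (κ.entry q) := by
  have hg := B.le_termLen h
  have hc := B.termLen_le_coreLen
  have hjc : (j + B.coreLen) * B.initLen = j * B.initLen + B.coreLen * B.initLen := add_mul _ _ _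
  rcases Nat.lt_or_ge q (j * B.initLen) with hqj | hqj
  · obtain ⟨t, ht, r, hr, rfl⟩ :=
      exists_initBlock_eq (show q < (j + B.coreLen) * B.initLen by omega)
    have hi0 : B.init ≠ [] := B.init_ne_nil (by omega)
    refine not_between_of_core (initBlock_blockSeq hm hamb hκ (by omega) hi0) B.initLen_le_coreLen
      (by omega) (fun i hi i' hi' => ?_) (fun lo hi hgap t ht r hr => ?_)
      (fun lo hi hgap t ht r hr => ?_) hgap ht hr
    · exact (initBlock_ne_termBlock hκ (by omega) (by omega) hi' hi).symm
    · have h1 : (t + 1) * B.initLen ≤ B.coreLen * B.initLen := Nat.mul_le_mul_right _ ht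
      have h2 := h1
      rw [add_one_mul] at h2
      exact termBlock_core hm hamb hB hj hκ h hgap (by omega) (by rw [add_one_mul]; omega)
    · have h2 := mul_add_lt ht hr
      rw [termBlock, add_assoc]
      exact initBlock_core hm hamb hB hj hκ hi0 hgap (by omega) (by omega)
  · exact termBlock_core hm hamb hB hj hκ h hgap hqj hq

/-- Without splittable pairs, no entry of `β γ_1 ⋯ γ_k` lies in a gap of `α_1`. -/
theorem initBlock_not_between (hm : 0 < m) (hamb : NoAmbiguousCycle m C)
    (hB : ¬ B.HasSplittablePair) {j : ℕ} (hj : 0 < j)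
    (hκ : κ ∈ perms (B.balancedPath (j + B.coreLen))) (h : B.init ≠ []) {lo hi : Option ℕ}
    (hgap : IsGap (B.initBlock (j + B.coreLen) κ) B.initLen lo hi) {q : ℕ}
    (hq : (j + B.coreLen) * B.initLen ≤ q) (hq' : q < κ.len) :
    ¬ IsBetween (B.initBlock (j + B.coreLen) κ 0) lo hi (κ.entry q) := by
  have hg := B.le_initLen h
  have hc := B.initLen_le_coreLen
  have hl := len_eq hκ
  have hjc : (j + B.coreLen) * B.initLen = j * B.initLen + B.coreLen * B.initLen := add_mul _ _ _
  rcases Nat.lt_or_ge q ((j + B.coreLen) * B.initLen + B.midLen + B.coreLen * B.termLen)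
    with hqj | hqj
  · exact initBlock_core hm hamb hB hj hκ h hgap hq hqj
  · obtain ⟨x, rfl⟩ := Nat.exists_eq_add_of_le
      (show (j + B.coreLen) * B.initLen + B.midLen ≤ q by omega)
    obtain ⟨t, ht, r, hr, rfl⟩ :=
      exists_termBlock_eq (show x < (j + B.coreLen) * B.termLen by omega)
    have ht0 : B.term ≠ [] := B.term_ne_nil (by omega)
    have := not_between_of_core (c := B.coreLen)
      (termBlock_blockSeq hm hamb hκ (by omega) ht0) B.termLen_le_coreLen
      (by omega) (fun i hi i' hi' => ?_) (fun lo hi hgap t ht r hr => ?_)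
      (fun lo hi hgap t ht r hr => ?_) hgap ht hr
    · rwa [termBlock, add_assoc] at this
    · exact initBlock_ne_termBlock hκ (by omega) (by omega) hi hi'
    · have h2 := mul_add_lt ht hr
      rw [termBlock, add_assoc]
      exact initBlock_core hm hamb hB hj hκ h hgap (by omega) (by omega)
    · have h1 : (t + 1) * B.initLen ≤ B.coreLen * B.initLen := Nat.mul_le_mul_right _ ht
      have h2 := h1
      rw [add_one_mul] at h2
      exact termBlock_core hm hamb hB hj hκ ht0 hgap (by omega) (by rw [add_one_mul]; omega)

theorem term_entry_le_iff (hm : 0 < m) (hamb : NoAmbiguousCycle m C)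
    (hκ : κ ∈ perms (B.balancedPath k)) (hκ' : κ' ∈ perms (B.balancedPath k)) {x y : ℕ}
    (hx : x < k * B.termLen) (hy : y < k * B.termLen) :
    κ.entry (k * B.initLen + B.midLen + x) ≤ κ.entry (k * B.initLen + B.midLen + y) ↔
      κ'.entry (k * B.initLen + B.midLen + x) ≤ κ'.entry (k * B.initLen + B.midLen + y) := by
  have hk : 0 < k := Nat.pos_of_ne_zero (by
    rintro rfl
    omega)
  have h : B.term ≠ [] := B.term_ne_nil (by
    intro h0
    rw [h0] at hx
    omega)
  have hU := window_term hm hκ h le_rfl hk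
  rw [← termIterates_entry_le_iff hm hamb hκ h le_rfl hk hU hx hy,
    termIterates_entry_le_iff hm hamb hκ' h le_rfl hk hU hx hy]

theorem init_entry_le_iff (hm : 0 < m) (hamb : NoAmbiguousCycle m C)
    (hκ : κ ∈ perms (B.balancedPath k)) (hκ' : κ' ∈ perms (B.balancedPath k)) {x y : ℕ}
    (hx : x < k * B.initLen) (hy : y < k * B.initLen) :
    κ.entry x ≤ κ.entry y ↔ κ'.entry x ≤ κ'.entry y := by
  have hk : 0 < k := Nat.pos_of_ne_zero (by
    rintro rfl
    omega)
  have h : B.init ≠ [] := B.init_ne_nil (by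
    intro h0
    rw [h0] at hx
    omega)
  have hU := window_init hm hκ hk h hk
  have h1 := initIterates_entry_le_iff hm hamb hκ h hk hU (a := x) (b := y) (by simpa) (by simpa)
  have h2 := initIterates_entry_le_iff hm hamb hκ' h hk hU (a := x) (b := y) (by simpa) (by simpa)
  simp only [zero_mul, zero_add] at h1 h2
  rw [← h1, h2]

/-- For comparisons with entries of `α_k ⋯ α_1 β`, an entry of a late block `γ_t` can be replaced
by an entry of the core, simultaneously in two balanced permutations. -/
theorem exists_core_term (hm : 0 < m) (hamb : NoAmbiguousCycle m C)
    (hB : ¬ B.HasSplittablePair) {j : ℕ} (hj : 0 < j)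
    (hκ : κ ∈ perms (B.balancedPath (j + B.coreLen)))
    (hκ' : κ' ∈ perms (B.balancedPath (j + B.coreLen))) {x : ℕ}
    (hx : x < (j + B.coreLen) * B.termLen) :
    ∃ x' < B.coreLen * B.termLen, ∀ q < (j + B.coreLen) * B.initLen + B.midLen,
      (κ.entry q < κ.entry ((j + B.coreLen) * B.initLen + B.midLen + x) ↔
        κ.entry q < κ.entry ((j + B.coreLen) * B.initLen + B.midLen + x')) ∧
      (κ'.entry q < κ'.entry ((j + B.coreLen) * B.initLen + B.midLen + x) ↔
        κ'.entry q < κ'.entry ((j + B.coreLen) * B.initLen + B.midLen + x')) := by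
  obtain ⟨t, ht, r, hr, rfl⟩ := exists_termBlock_eq hx
  have hc := B.termLen_le_coreLen
  rcases Nat.lt_or_ge t B.coreLen with htc | htc
  · exact ⟨_, mul_add_lt htc hr, fun q _ => ⟨Iff.rfl, Iff.rfl⟩⟩
  have h : B.term ≠ [] := B.term_ne_nil (by omega)
  obtain ⟨lo, hi, hgap, hb⟩ := (termBlock_blockSeq hm hamb hκ (by omega) h).exists_isGap
    (s := t) (by omega) ht hr
  have hPP' : ∀ t < j + B.coreLen, ∀ i < B.termLen, ∀ t' < j + B.coreLen, ∀ i' < B.termLen,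
      (B.termBlock (j + B.coreLen) κ t i ≤ B.termBlock (j + B.coreLen) κ t' i' ↔
        B.termBlock (j + B.coreLen) κ' t i ≤ B.termBlock (j + B.coreLen) κ' t' i') := by
    intro t ht i hi t' ht' i' hi'
    simp only [termBlock, add_assoc _ (t * B.termLen), add_assoc _ (t' * B.termLen)]
    exact term_entry_le_iff hm hamb hκ hκ' (mul_add_lt ht hi) (mul_add_lt ht' hi')
  have hgap' := hgap.congr (by omega) hPP'
  have hb' := hgap.isBetween_congr ht hr hPP' hb
  obtain ⟨i, hig, hi'⟩ := hgap.exists_mem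
  have key : ∀ K ∈ perms (B.balancedPath (j + B.coreLen)),
      IsGap (B.termBlock (j + B.coreLen) K) B.termLen lo hi →
      IsBetween (B.termBlock (j + B.coreLen) K 0) lo hi (B.termBlock (j + B.coreLen) K t r) →
      ∀ q < (j + B.coreLen) * B.initLen + B.midLen,
      (K.entry q < K.entry ((j + B.coreLen) * B.initLen + B.midLen + (t * B.termLen + r)) ↔
        K.entry q < K.entry ((j + B.coreLen) * B.initLen + B.midLen + i)) := by
    intro K hK hgapK hbK q hq
    have hl := len_eq hK
    have h1 := mul_add_lt (show 0 < j + B.coreLen by omega) hig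
    have h2 := hbK.lt_iff (termBlock_not_between hm hamb hB hj hK h hgapK hq) hi' (fun heq => by
      rw [termBlock] at heq
      have := entry_inj (by omega) (by omega) heq
      omega)
    simpa [termBlock, add_assoc] using h2
  refine ⟨i, ?_, fun q hq => ⟨key κ hκ hgap hb q hq, key κ' hκ' hgap' hb' q hq⟩⟩
  have := mul_add_lt (show 0 < B.coreLen by omega) hig
  omega

/-- The counterpart of `exists_core_term` for `β γ_1 ⋯ γ_k` and the blocks `α_t`. -/
theorem exists_core_init (hm : 0 < m) (hamb : NoAmbiguousCycle m C)
    (hB : ¬ B.HasSplittablePair) {j : ℕ} (hj : 0 < j)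
    (hκ : κ ∈ perms (B.balancedPath (j + B.coreLen)))
    (hκ' : κ' ∈ perms (B.balancedPath (j + B.coreLen))) {x : ℕ}
    (hx : x < (j + B.coreLen) * B.initLen) :
    ∃ x', j * B.initLen ≤ x' ∧ x' < (j + B.coreLen) * B.initLen ∧
      ∀ q, (j + B.coreLen) * B.initLen ≤ q → q < κ.len →
        (κ.entry q < κ.entry x ↔ κ.entry q < κ.entry x') ∧
        (κ'.entry q < κ'.entry x ↔ κ'.entry q < κ'.entry x') := by
  obtain ⟨t, ht, r, hr, rfl⟩ := exists_initBlock_eq hx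
  have hc := B.initLen_le_coreLen
  have hjc : (j + B.coreLen) * B.initLen = j * B.initLen + B.coreLen * B.initLen := add_mul _ _ _
  rcases Nat.lt_or_ge t B.coreLen with htc | htc
  · have h1 : (t + 1) * B.initLen ≤ B.coreLen * B.initLen := Nat.mul_le_mul_right _ htc
    exact ⟨_, by omega, hx, fun q _ _ => ⟨Iff.rfl, Iff.rfl⟩⟩
  have h : B.init ≠ [] := B.init_ne_nil (by omega)
  obtain ⟨lo, hi, hgap, hb⟩ := (initBlock_blockSeq hm hamb hκ (by omega) h).exists_isGap
    (s := t) (by omega) ht hr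
  have hlt : ∀ t < j + B.coreLen, ∀ i < B.initLen, (j + B.coreLen) * B.initLen -
      (t + 1) * B.initLen + i < (j + B.coreLen) * B.initLen := by
    intro t ht i hi
    have h1 : (t + 1) * B.initLen ≤ (j + B.coreLen) * B.initLen := Nat.mul_le_mul_right _ ht
    rw [add_one_mul] at h1 ⊢
    omega
  have hPP' : ∀ t < j + B.coreLen, ∀ i < B.initLen, ∀ t' < j + B.coreLen, ∀ i' < B.initLen,
      (B.initBlock (j + B.coreLen) κ t i ≤ B.initBlock (j + B.coreLen) κ t' i' ↔
        B.initBlock (j + B.coreLen) κ' t i ≤ B.initBlock (j + B.coreLen) κ' t' i') := by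
    intro t ht i hi t' ht' i' hi'
    exact init_entry_le_iff hm hamb hκ hκ' (hlt t ht i hi) (hlt t' ht' i' hi')
  have hgap' := hgap.congr (by omega) hPP'
  have hb' := hgap.isBetween_congr ht hr hPP' hb
  obtain ⟨i, hig, hi'⟩ := hgap.exists_mem
  have h0 := hlt 0 (by omega) i hig
  have hl0 := len_eq hκ
  have key : ∀ K ∈ perms (B.balancedPath (j + B.coreLen)),
      IsGap (B.initBlock (j + B.coreLen) K) B.initLen lo hi →
      IsBetween (B.initBlock (j + B.coreLen) K 0) lo hi (B.initBlock (j + B.coreLen) K t r) →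
      ∀ q, (j + B.coreLen) * B.initLen ≤ q → q < κ.len →
      (K.entry q < B.initBlock (j + B.coreLen) K t r ↔
        K.entry q < B.initBlock (j + B.coreLen) K 0 i) := by
    intro K hK hgapK hbK q hq hqκ
    have hl := len_eq hK
    refine hbK.lt_iff (initBlock_not_between hm hamb hB hj hK h hgapK hq (by omega)) hi'
      (fun heq => ?_)
    rw [initBlock] at heq
    have := entry_inj (by omega) (by omega) heq
    omega
  refine ⟨_, ?_, h0, fun q hq hq' => ⟨key κ hκ hgap hb q hq hq', key κ' hκ' hgap' hb' q hq hq'⟩⟩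
  have h1 : (0 + 1) * B.initLen ≤ B.coreLen * B.initLen := Nat.mul_le_mul_right _ (by omega)
  omega

/-- Without ambiguous cycles and splittable pairs, a balanced permutation is determined by its
cycle length and its core. -/
theorem eq_of_core_eq (hm : 0 < m) (hamb : NoAmbiguousCycle m C)
    (hB : ¬ B.HasSplittablePair) {j : ℕ} (hj : 0 < j)
    (hκ : κ ∈ perms (B.balancedPath (j + B.coreLen)))
    (hκ' : κ' ∈ perms (B.balancedPath (j + B.coreLen)))
    (heq : window κ (j * B.initLen) (B.coreLen * B.initLen + B.midLen + B.coreLen * B.termLen) =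
      window κ' (j * B.initLen) (B.coreLen * B.initLen + B.midLen + B.coreLen * B.termLen)) :
    κ = κ' := by
  have hl := len_eq hκ
  have hl' := len_eq hκ'
  have hjc : (j + B.coreLen) * B.initLen = j * B.initLen + B.coreLen * B.initLen := add_mul _ _ _
  have hcore : ∀ p q, j * B.initLen ≤ p →
      p < (j + B.coreLen) * B.initLen + B.midLen + B.coreLen * B.termLen → j * B.initLen ≤ q →
      q < (j + B.coreLen) * B.initLen + B.midLen + B.coreLen * B.termLen →
      (κ.entry p < κ.entry q ↔ κ'.entry p < κ'.entry q) := by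
    intro p q hp hp' hq hq'
    obtain ⟨-, h1, h2⟩ := window_balanced hκ
    obtain ⟨-, h1', -⟩ := window_balanced hκ'
    obtain ⟨p, rfl⟩ := Nat.exists_eq_add_of_le hp
    obtain ⟨q, rfl⟩ := Nat.exists_eq_add_of_le hq
    rw [← heq] at h1'
    rw [h1.lt_iff (by omega) (by omega), h1'.lt_iff (by omega) (by omega)]
  have hsymm : ∀ p q, p < κ.len → q < κ.len →
      (κ.entry p < κ.entry q ↔ κ'.entry p < κ'.entry q) →
      (κ.entry q < κ.entry p ↔ κ'.entry q < κ'.entry p) := by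
    intro p q hp hq h
    by_cases hpq : p = q
    · subst hpq
      simp
    have h1 : κ.entry p ≠ κ.entry q := fun h => hpq (entry_inj hp hq h)
    have h2 : κ'.entry p ≠ κ'.entry q := fun h => hpq (entry_inj (by omega) (by omega) h)
    omega
  have hjb : B.coreLen * B.termLen ≤ (j + B.coreLen) * B.termLen :=
    Nat.mul_le_mul_right _ (by omega)
  -- an entry of `α_k ⋯ α_1` and an entry of the core
  have hinit : ∀ p q, p < (j + B.coreLen) * B.initLen → (j + B.coreLen) * B.initLen ≤ q →
      q < (j + B.coreLen) * B.initLen + B.midLen + B.coreLen * B.termLen →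
      (κ.entry q < κ.entry p ↔ κ'.entry q < κ'.entry p) := by
    intro p q hp hq hq'
    obtain ⟨p', hp1, hp2, hp'⟩ := exists_core_init hm hamb hB hj hκ hκ' hp
    rw [(hp' q hq (by omega)).1, (hp' q hq (by omega)).2]
    exact hcore q p' (by omega) hq' hp1 (by omega)
  have hlt : ∀ p q, p < q → q < κ.len →
      (κ.entry p < κ.entry q ↔ κ'.entry p < κ'.entry q) := by
    intro p q hpq hq
    rcases Nat.lt_or_ge q ((j + B.coreLen) * B.initLen + B.midLen) with hqb | hqb
    · rcases Nat.lt_or_ge p ((j + B.coreLen) * B.initLen) with hpa | hpa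
      · rcases Nat.lt_or_ge q ((j + B.coreLen) * B.initLen) with hqa | hqa
        · have := init_entry_le_iff hm hamb hκ hκ' hqa hpa
          omega
        · exact hsymm _ _ hq (by omega) (hinit p q hpa hqa (by omega))
      · exact hcore p q (by omega) (by omega) (by omega) (by omega)
    · obtain ⟨x, rfl⟩ := Nat.exists_eq_add_of_le hqb
      rcases Nat.lt_or_ge p ((j + B.coreLen) * B.initLen + B.midLen) with hpb | hpb
      · obtain ⟨x', hx', hxx'⟩ := exists_core_term hm hamb hB hj hκ hκ' (x := x) (by omega)
        rw [(hxx' p hpb).1, (hxx' p hpb).2]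
        rcases Nat.lt_or_ge p ((j + B.coreLen) * B.initLen) with hpa | hpa
        · exact hsymm _ _ (by omega) (by omega) (hinit p _ hpa (by omega) (by omega))
        · exact hcore p _ (by omega) (by omega) (by omega) (by omega)
      · obtain ⟨y, rfl⟩ := Nat.exists_eq_add_of_le hpb
        have := term_entry_le_iff hm hamb hκ hκ' (x := x) (y := y) (by omega) (by omega)
        omega
  refine eq_of_entry_le_iff (by omega) fun p hp q hq => ?_
  rcases lt_trichotomy p q with h | rfl | h
  · have := hsymm _ _ hp hq (hlt p q h hq)
    omega
  · simp
  · have := hlt q p h hp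
    omega

end Bicycle

/-! ### Paths in a bicycle as segments of balanced paths -/

theorem cons_seg_cyc {V : Type*} {d : V} {l : List V} (hl : l ≠ []) (hd : l.Nodup) {i s n : ℕ}
    (hy : cyc d l s = cyc d l (i + 1)) :
    cyc d l i :: seg (cyc d l) s n = seg (cyc d l) i (n + 1) := by
  have h := cyc_inj hl hd hy
  rw [← cons_seg]
  congr 1
  exact seg_congr fun j _ => cyc_congr (by rw [Nat.add_mod, h, ← Nat.add_mod])

namespace Bicycle

variable {m : ℕ} {C : Set Permutation} {B : Bicycle (levelGraph m C)}

theorem initCyc_mem (h : B.init ≠ []) (i : ℕ) : B.initCyc i ∈ B.init := cyc_mem h i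

theorem termCyc_mem (h : B.term ≠ []) (i : ℕ) : B.termCyc i ∈ B.term := cyc_mem h i

theorem connSeq_eq_getElem {i : ℕ} (hi : i < B.conn.length) : B.connSeq i = B.conn[i] :=
  List.getD_eq_getElem _ _ hi

theorem connSeq_inj {i j : ℕ} (hi : i < B.conn.length) (hj : j < B.conn.length)
    (h : B.connSeq i = B.connSeq j) : i = j := by
  rw [connSeq_eq_getElem hi, connSeq_eq_getElem hj] at h
  exact B.conn_nodup.getElem_inj_iff.1 h

theorem connSeq_notMem_init {i : ℕ} (h0 : 0 < i) (hi : i < B.conn.length) :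
    B.connSeq i ∉ B.init := by
  refine B.conn_tail_init _ ?_
  rw [conn_eq_seg, seg_tail, mem_seg]
  exact ⟨i - 1, by omega, by congr 1; omega⟩

theorem connSeq_notMem_term {i : ℕ} (hi : i + 1 < B.conn.length) : B.connSeq i ∉ B.term := by
  refine B.conn_dropLast_term _ ?_
  rw [conn_eq_seg, seg_dropLast, mem_seg]
  exact ⟨i, by omega, by rw [zero_add]⟩

theorem adj_cases {u v : Level m C} (h : B.Adj u v) :
    (B.init ≠ [] ∧ ∃ i, u = B.initCyc i ∧ v = B.initCyc (i + 1)) ∨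
    (∃ i, i + 1 < B.conn.length ∧ u = B.connSeq i ∧ v = B.connSeq (i + 1)) ∨
    (B.term ≠ [] ∧ ∃ i, u = B.termCyc i ∧ v = B.termCyc (i + 1)) := by
  have hne : ∀ l : List (Level m C), [u, v] <:+: l ++ l.take 1 → l ≠ [] := by
    rintro l hl rfl
    simpa using hl.length_le
  rcases h with h | h | h
  · have h0 := hne _ h
    rw [append_take_one_eq_seg (d := B.vert) h0] at h
    obtain ⟨i, -, h1, h2⟩ := exists_of_pair_infix_seg h
    exact Or.inl ⟨h0, i, by simpa [initCyc] using h1, by simpa [initCyc] using h2⟩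
  · rw [conn_eq_seg] at h
    obtain ⟨i, hi, h1, h2⟩ := exists_of_pair_infix_seg h
    exact Or.inr (Or.inl ⟨i, hi, by simpa using h1, by simpa using h2⟩)
  · have h0 := hne _ h
    rw [append_take_one_eq_seg (d := B.vert) h0] at h
    obtain ⟨i, -, h1, h2⟩ := exists_of_pair_infix_seg h
    exact Or.inr (Or.inr ⟨h0, i, by simpa [termCyc] using h1, by simpa [termCyc] using h2⟩)

theorem initLen_pos (hm : 0 < m) (h : B.init ≠ []) : 0 < B.initLen := hm.trans_le (B.le_initLen h)

theorem termLen_pos (hm : 0 < m) (h : B.term ≠ []) : 0 < B.termLen := hm.trans_le (B.le_termLen h)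

/-- A path in a bicycle stays on the initial cycle, or stays on the terminal cycle, or visits the
connecting path; in the last case it is a segment of a balanced path. -/
theorem path_cases (hm : 0 < m) (π : List (Level m C)) (hne : π ≠ []) (hv : ∀ v ∈ π, v ∈ B.verts)
    (hadj : π.IsChain B.Adj) :
    (B.init ≠ [] ∧ ∃ s, π = seg B.initCyc s π.length) ∨
    (B.term ≠ [] ∧ ∃ s, π = seg B.termCyc s π.length) ∨
    (∃ k o, π = seg (B.walk k) o π.length ∧ o ≤ k * B.initLen + (B.conn.length - 1) ∧
      k * B.initLen < o + π.length ∧ o + π.length ≤ B.walkLen k) := by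
  have hp := B.conn_length_pos
  induction π with
  | nil => exact absurd rfl hne
  | cons u l ih =>
    rcases l with - | ⟨y, l⟩
    · rcases hv u (by simp) with h | h | h
      · obtain ⟨i, -, hi⟩ := exists_cyc_eq (d := B.vert) h
        exact Or.inl ⟨List.ne_nil_of_mem h, i, by simp [seg, initCyc, ← hi]⟩
      · refine Or.inr (Or.inr ⟨0, ?_⟩)
        obtain ⟨i, hi, rfl⟩ := List.mem_iff_getElem.1 h
        have := walk_conn B (k := 0) hi
        rw [zero_mul, zero_add] at this
        refine ⟨i, by simp [seg, this, connSeq, hi], ?_⟩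
        simp [walkLen]
        omega
      · obtain ⟨i, -, hi⟩ := exists_cyc_eq (d := B.vert) h
        exact Or.inr (Or.inl ⟨List.ne_nil_of_mem h, i, by simp [seg, termCyc, ← hi]⟩)
    rw [List.isChain_cons_cons] at hadj
    have ih := ih (by simp) (fun v hv' => hv v (List.mem_cons_of_mem _ hv')) hadj.2
    have hn : 0 < (y :: l).length := by simp
    have hy : ∀ {x : ℕ → Level m C} {s : ℕ}, y :: l = seg x s (y :: l).length → y = x s := by
      intro x s h
      have h1 := seg_head? (x := x) (a := s) hn.ne'
      rw [← h] at h1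
      simpa using h1
    rw [List.length_cons (a := u)]
    generalize (y :: l).length = n at ih hn hy
    generalize hπ : y :: l = π at ih hy
    have hdisj : ∀ {i j : ℕ}, B.init ≠ [] → B.term ≠ [] → B.initCyc i ≠ B.termCyc j := by
      intro i j h h' heq
      exact B.init_disjoint_term _ (initCyc_mem h i) (heq ▸ termCyc_mem h' j)
    have hinit : ∀ {i j : ℕ}, B.init ≠ [] → 0 < j → j < B.conn.length →
        B.initCyc i ≠ B.connSeq j := by
      intro i j h h1 h2 heq
      exact connSeq_notMem_init h1 h2 (heq ▸ initCyc_mem h i)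
    have hterm : ∀ {i j : ℕ}, B.term ≠ [] → j + 1 < B.conn.length →
        B.termCyc i ≠ B.connSeq j := by
      intro i j h h1 heq
      exact connSeq_notMem_term h1 (heq ▸ termCyc_mem h i)
    rcases ih with ⟨h, s, hs⟩ | ⟨h, s, hs⟩ | ⟨k, o, ho, ho1, ho2, ho3⟩
    · -- an edge that ends on the initial cycle is an edge of that cycle
      rcases adj_cases hadj.1 with ⟨-, i, rfl, hi⟩ | ⟨i, hi', rfl, hi⟩ | ⟨h', i, rfl, hi⟩
      · refine Or.inl ⟨h, i, ?_⟩
        rw [hs]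
        exact cons_seg_cyc h B.init_nodup ((hy hs).symm.trans hi)
      · exact absurd ((hy hs).symm.trans hi) (hinit h (by omega) hi')
      · exact absurd ((hy hs).symm.trans hi) (hdisj h h')
    · rcases adj_cases hadj.1 with ⟨h', i, rfl, hi⟩ | ⟨i, hi', rfl, hi⟩ | ⟨-, i, rfl, hi⟩
      · exact absurd (hi.symm.trans (hy hs)) (hdisj h' h)
      · -- the path enters the terminal cycle from the connecting path
        have hi1 : i + 1 = B.conn.length - 1 := by
          by_contra hcon
          exact hterm h (j := i + 1) (by omega) ((hy hs).symm.trans hi)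
        have hs0 : B.termCyc s = B.termCyc 0 := by
          rw [termCyc_zero B h, ← hi1, ← hi, hy hs]
        have h1 : n ≤ n * B.termLen := Nat.le_mul_of_pos_right _ (termLen_pos hm h)
        refine Or.inr (Or.inr ⟨n, n * B.initLen + i, ?_, by omega, by omega, ?_⟩)
        · rw [← cons_seg, walk_conn B (by omega), hs]
          congr 1
          refine seg_congr fun j hj => ?_
          rw [show n * B.initLen + i + 1 + j = n * B.initLen + (B.conn.length - 1) + j by omega,
            walk_term B h (by omega)]
          have h2 := cyc_inj h B.term_nodup hs0
          refine B.termCyc_congr ?_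
          rw [Nat.add_mod, h2, ← Nat.add_mod, zero_add]
        · rw [walkLen]
          omega
      · refine Or.inr (Or.inl ⟨h, i, ?_⟩)
        rw [hs]
        exact cons_seg_cyc h B.term_nodup ((hy hs).symm.trans hi)
    · have hyo := hy ho
      have hE : (1 + k) * B.initLen = B.initLen + k * B.initLen := by rw [add_mul, one_mul]
      have hlen : B.walkLen (1 + k) = B.initLen + B.walkLen k + B.termLen := by
        rw [walkLen, walkLen, hE, add_mul, one_mul]
        omega
      -- one more turn around the initial cycle makes room for another edge of this cycle
      have hturn : ∀ i, B.init ≠ [] → o ≤ k * B.initLen → y = B.initCyc (i + 1) →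
          ∃ k' o', B.initCyc i :: π = seg (B.walk k') o' (n + 1) ∧
            o' ≤ k' * B.initLen + (B.conn.length - 1) ∧ k' * B.initLen < o' + (n + 1) ∧
            o' + (n + 1) ≤ B.walkLen k' := by
        intro i h hoE hi
        have hI := initLen_pos hm h
        rw [hyo, walk_init B h hoE] at hi
        have h1 := cyc_inj h B.init_nodup hi
        refine ⟨1 + k, B.initLen + o - 1, ?_, by omega, by omega, by omega⟩
        rw [← cons_seg, walk_init B h (by omega), ho, Nat.sub_add_cancel (by omega)]
        congr 1
        · refine B.initCyc_congr (Nat.ModEq.add_right_cancel' (n := B.init.length) 1 ?_)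
          rw [Nat.sub_add_cancel (by omega)]
          refine Nat.ModEq.trans h1.symm ?_
          have h2 := B.mul_initLen_mod 1
          rw [one_mul] at h2
          rw [Nat.ModEq, Nat.add_mod, h2, zero_add, Nat.mod_mod]
        · refine seg_congr fun j hj => ?_
          have h2 := walk_add B (j := 1) (k := k) (i := o + j) (by omega)
          rw [one_mul, ← add_assoc] at h2
          exact h2.symm
      rcases Nat.lt_or_ge o (k * B.initLen) with hoE | hoE
      · have h0 : B.init ≠ [] := B.init_ne_nil (by
          intro h0
          rw [h0] at hoE
          omega)
        rw [walk_init B h0 hoE.le] at hyo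
        rcases adj_cases hadj.1 with ⟨h, i, rfl, hi⟩ | ⟨i, hi', rfl, hi⟩ | ⟨h, i, rfl, hi⟩
        · exact Or.inr (Or.inr (hturn i h hoE.le hi))
        · exact absurd (hyo.symm.trans hi) (hinit h0 (by omega) hi')
        · exact absurd (hyo.symm.trans hi) (hdisj h0 h)
      · obtain ⟨t, rfl⟩ := Nat.exists_eq_add_of_le hoE
        rw [walk_conn B (by omega)] at hyo
        rcases adj_cases hadj.1 with ⟨h, i, rfl, hi⟩ | ⟨i, hi', rfl, hi⟩ | ⟨h, i, rfl, hi⟩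
        · rcases Nat.eq_zero_or_pos t with rfl | ht
          · exact Or.inr (Or.inr (hturn i h (by omega) hi))
          · exact absurd (hi.symm.trans hyo) (hinit h ht (by omega))
        · obtain rfl := connSeq_inj (by omega) (by omega) (hyo.symm.trans hi)
          refine Or.inr (Or.inr ⟨k, k * B.initLen + i, ?_, by omega, by omega, by omega⟩)
          rw [← cons_seg, walk_conn B (by omega), ho, add_assoc]
        · have ht : t = B.conn.length - 1 := by
            by_contra hcon
            exact hterm h (j := t) (by omega) (hi.symm.trans hyo)
          subst ht
          refine Or.inr (Or.inl ⟨h, i, ?_⟩)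
          have h1 : π = seg B.termCyc 0 n := by
            rw [ho]
            refine seg_congr fun j hj => ?_
            rw [walk_term B h (by rw [walkLen] at ho3; omega), zero_add]
          rw [h1]
          refine cons_seg_cyc h B.term_nodup ?_
          change B.termCyc 0 = B.termCyc (i + 1)
          rw [termCyc_zero B h, ← hyo, hi]

/-- Every path in a bicycle is a segment of a balanced path of cycle length more than `coreLen`,
and up to bounded gaps it meets the connecting path. -/
theorem exists_eq_seg_walk (hm : 0 < m) {π : List (Level m C)} (hπ : π ∈ B.paths) :
    ∃ j o, 0 < j ∧ π = seg (B.walk (j + B.coreLen)) o π.length ∧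
      o + π.length ≤ B.walkLen (j + B.coreLen) ∧
      o ≤ (j + B.coreLen) * B.initLen + (B.init.length + B.conn.length + B.term.length) ∧
      (j + B.coreLen) * B.initLen ≤
        o + π.length + (B.init.length + B.conn.length + B.term.length) := by
  have hp := B.conn_length_pos
  rcases path_cases hm π hπ.1 hπ.2.1 hπ.2.2 with ⟨h, s, hs⟩ | ⟨h, s, hs⟩ | ⟨k, o, h1, h2, h3, h4⟩
  · generalize π.length = n at hs
    have hr : 0 < B.init.length := List.length_pos_iff.2 h
    obtain ⟨k, hk⟩ : ∃ k, k = (n + s + 1) + B.coreLen := ⟨_, rfl⟩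
    have hkI : k ≤ k * B.initLen := Nat.le_mul_of_pos_right _ (initLen_pos hm h)
    have hd := Nat.div_add_mod (k * B.initLen - n - s) B.init.length
    have hd' := Nat.mod_lt (k * B.initLen - n - s) hr
    generalize hD : (k * B.initLen - n - s) / B.init.length = D at hd
    refine ⟨n + s + 1, s + B.init.length * D, by omega, ?_⟩
    rw [← hk]
    refine ⟨?_, ?_, by omega, by omega⟩
    · rw [hs]
      refine seg_congr fun i hi => ?_
      rw [walk_init B h (by omega)]
      refine B.initCyc_congr ?_
      rw [add_right_comm, Nat.add_mul_mod_self_left]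
    · rw [walkLen]
      omega
  · generalize π.length = n at hs
    have hr : 0 < B.term.length := List.length_pos_iff.2 h
    have hs' := Nat.mod_lt s hr
    obtain ⟨k, hk⟩ : ∃ k, k = (n + s % B.term.length + 1) + B.coreLen := ⟨_, rfl⟩
    have hkT : k ≤ k * B.termLen := Nat.le_mul_of_pos_right _ (termLen_pos hm h)
    refine ⟨n + s % B.term.length + 1, k * B.initLen + (B.conn.length - 1) + s % B.term.length,
      by omega, ?_⟩
    rw [← hk]
    refine ⟨?_, ?_, by omega, by omega⟩
    · rw [hs]
      refine seg_congr fun i hi => ?_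
      rw [add_assoc (k * B.initLen + (B.conn.length - 1)), walk_term B h (by omega)]
      exact B.termCyc_congr (by rw [Nat.mod_add_mod])
    · rw [walkLen]
      omega
  · have hE : (1 + B.coreLen + k) * B.initLen = (1 + B.coreLen) * B.initLen + k * B.initLen :=
      add_mul _ _ _
    have hlen : B.walkLen (1 + B.coreLen + k) =
        (1 + B.coreLen) * B.initLen + B.walkLen k + (1 + B.coreLen) * B.termLen := by
      rw [walkLen, walkLen, hE, add_mul _ k B.termLen]
      omega
    rw [show 1 + B.coreLen + k = 1 + k + B.coreLen by omega] at hE hlen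
    refine ⟨1 + k, (1 + B.coreLen) * B.initLen + o, by omega, ?_, by omega, by omega, by omega⟩
    conv_lhs => rw [h1]
    refine seg_congr fun i hi => ?_
    rw [show 1 + k + B.coreLen = 1 + B.coreLen + k by omega, add_assoc _ o i, walk_add B (by omega)]

/-! ### Bicycles without splittable pairs -/

/-- Balanced permutations of cycle length larger than `coreLen` with the same core are comparable;
the smaller one is a factor at the place where the middle parts agree. -/
theorem isFactorAt_of_core_eq (hm : 0 < m) (hamb : NoAmbiguousCycle m C)
    (hB : ¬ B.HasSplittablePair) {i j : ℕ} (hj : 0 < j) {κ κ' : Permutation}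
    (hκ : κ ∈ perms (B.balancedPath (j + B.coreLen)))
    (hκ' : κ' ∈ perms (B.balancedPath (i + j + B.coreLen)))
    (heq : window κ (j * B.initLen) (B.coreLen * B.initLen + B.midLen + B.coreLen * B.termLen) =
      window κ' ((i + j) * B.initLen)
        (B.coreLen * B.initLen + B.midLen + B.coreLen * B.termLen)) :
    IsFactorAt κ κ' (i * B.initLen) := by
  obtain ⟨-, h1, h2⟩ := window_balanced hκ'
  rw [add_assoc] at hκ'
  obtain ⟨h3, h4, -⟩ := window_balanced hκ'
  obtain ⟨-, h6, h7⟩ := window_balanced h3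
  have h8 := h6.trans h4
  rw [← add_mul] at h8
  rwa [eq_of_core_eq hm hamb hB hj hκ h3 (heq.trans (h1.unique h8 (h2.trans h7.symm)))]

/-- The permutations that trace a path of `B`. -/
def permSet (B : Bicycle (levelGraph m C)) : Set Permutation := ⋃ π ∈ B.paths, perms π

theorem exists_isFactorAt_balanced (hm : 0 < m) {σ : Permutation} (hσ : σ ∈ B.permSet) :
    ∃ j κ p q o, 0 < j ∧ κ ∈ perms (B.balancedPath (j + B.coreLen)) ∧ IsFactorAt σ κ o ∧
      o + p = (j + B.coreLen) * B.initLen + (B.init.length + B.conn.length + B.term.length) ∧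
      q + (j + B.coreLen) * B.initLen =
        o + σ.len + (B.init.length + B.conn.length + B.term.length) := by
  obtain ⟨π, hπ, hσ⟩ := Set.mem_iUnion₂.1 hσ
  obtain ⟨j, o, hj, h1, h2, h3, h4⟩ := exists_eq_seg_walk hm hπ
  have hn : 0 < π.length := List.length_pos_iff.2 hπ.1
  rw [h1, mem_perms_seg] at hσ
  have hl := hσ.1
  obtain ⟨κ, hκ, h⟩ := Traces.extend (X := fun i => (B.walk (j + B.coreLen) i).1) hσ hn.ne'
    (fun i _ => (B.walk _ i).2.2) (fun i hi => B.walk_adj hi) h2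
  obtain ⟨p, hp⟩ := Nat.exists_eq_add_of_le h3
  obtain ⟨q, hq⟩ := Nat.exists_eq_add_of_le
    (show (j + B.coreLen) * B.initLen ≤
      o + σ.len + (B.init.length + B.conn.length + B.term.length) by omega)
  exact ⟨j, κ, p, q, o, hj, B.mem_perms_balancedPath.2 hκ, h, hp.symm, by omega⟩

/-- Without ambiguous cycles and splittable pairs, the permutations that trace the paths of a
bicycle are well quasi-ordered: they are classified by the core of a balanced permutation that
contains them, and by the numbers of entries to the left and to the right of the exit vertex. -/
theorem isPWO_permSet (hm : 0 < m) (hamb : NoAmbiguousCycle m C)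
    (hB : ¬ B.HasSplittablePair) : B.permSet.IsPWO := by
  intro f
  choose j κ p q o hj hκ hf hp hq using fun n => exists_isFactorAt_balanced hm (f n).2
  set L := B.coreLen * B.initLen + B.midLen + B.coreLen * B.termLen with hL
  have := (finite_len L).to_subtype
  have hwqo := (Finite.wellQuasiOrdered ((· = ·) : {σ : Permutation | σ.len = L} → _ → Prop)).prod
    ((wellQuasiOrdered_le (α := ℕ)).prod (wellQuasiOrdered_le (α := ℕ)))
  obtain ⟨a, b, hab, hcore, hpab, hqab⟩ := hwqo fun n =>
    (⟨window (κ n) (j n * B.initLen) L, (window_balanced (hκ n)).2.2⟩, p n, q n)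
  have hcore : window (κ a) (j a * B.initLen) L = window (κ b) (j b * B.initLen) L :=
    congrArg Subtype.val hcore
  have hpab : p a ≤ p b := hpab
  have hqab : q a ≤ q b := hqab
  refine ⟨a, b, hab, ?_⟩
  have hpa := hp a
  have hpb := hp b
  have hqa := hq a
  have hqb := hq b
  rcases le_total (j a) (j b) with h | h
  · obtain ⟨i, hi⟩ := Nat.exists_eq_add_of_le' h
    have hκb := hκ b
    rw [hi] at hcore hκb hpb hqb
    have hfac := (hf a).trans (isFactorAt_of_core_eq hm hamb hB (hj a) (hκ a) hκb hcore)
    rw [add_assoc, add_mul] at hpb hqb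
    exact ⟨_, hfac.of_nested (hf b) (by omega) (by omega)⟩
  · obtain ⟨i, hi⟩ := Nat.exists_eq_add_of_le' h
    have hκa := hκ a
    rw [hi] at hcore hκa hpa hqa
    have hfac := (hf b).trans (isFactorAt_of_core_eq hm hamb hB (hj b) (hκ b) hκa hcore.symm)
    rw [add_assoc, add_mul] at hpa hqa
    exact ⟨_, (hf a).of_nested hfac (by omega) (by omega)⟩

end Bicycle

/-! ### The equivalence for the whole class -/

theorem exists_path_of_mem {m : ℕ} {C : Set Permutation} (hC : IsLowerSet C) {σ : Permutation}
    (hσ : σ ∈ C) (hl : m ≤ σ.len) : ∃ π ∈ paths (levelGraph m C), σ ∈ perms π := by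
  have hex : ∀ i, ∃ v : Level m C, i + m ≤ σ.len → IsFactorAt v.1 σ i := by
    intro i
    by_cases hi : i + m ≤ σ.len
    · exact ⟨⟨window σ i m, hC ⟨i, window_isFactorAt hi⟩ hσ, window_len hi⟩,
        fun _ => window_isFactorAt hi⟩
    · have h0 : 0 + m ≤ σ.len := by omega
      exact ⟨⟨window σ 0 m, hC ⟨0, window_isFactorAt h0⟩ hσ, window_len h0⟩, fun h => absurd h hi⟩
  choose x hx using hex
  refine ⟨seg x 0 (σ.len - m + 1), ⟨fun h => ?_, ?_⟩, ?_⟩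
  · simpa using congrArg List.length h
  · rw [seg_isChain]
    intro i hi a b ha hb
    rw [zero_add, zero_add]
    rw [← (hx i (by omega)).2 _ _ (by rwa [(x i).2.2]) (by rwa [(x i).2.2]),
      ← (hx (i + 1) (by omega)).2 _ _ (by rw [(x (i + 1)).2.2]; omega)
        (by rw [(x (i + 1)).2.2]; omega)]
    simp only [add_assoc, add_comm 1]
  · rw [mem_perms_seg]
    refine ⟨by omega, fun i hi => ?_⟩
    simpa using hx i (by omega)

/-- A member of `C` of length at least `m` traces a path, which lies in one of the finitely many
bicycles. -/
theorem isWqo_of_isPathComplete {m n : ℕ} {C : Set Permutation} (hC : IsLowerSet C)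
    {B : Fin n → Bicycle (levelGraph m C)} (hB : IsPathComplete B) (hamb : NoAmbiguousCycle m C)
    (hsplit : ∀ i, ¬ (B i).HasSplittablePair) : IsWqo C := by
  rcases Nat.eq_zero_or_pos m with rfl | hm
  · -- the empty permutation would form an ambiguous cycle, and every `σ ∈ C` contains it
    have := hamb.isEmpty_level_zero
    rw [isWqo_iff]
    intro f hf
    have h0 : 0 + 0 ≤ (f 0).len := Nat.zero_le _
    exact isEmptyElim (⟨window (f 0) 0 0, hC ⟨0, window_isFactorAt h0⟩ (hf 0), window_len h0⟩ :
      Level 0 C)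
  have hfin : {σ : Permutation | σ.len < m}.IsPWO := by
    refine (Set.Finite.subset ((Finset.range m).finite_toSet.biUnion fun l _ => finite_len l)
      fun σ hσ => ?_).isPWO
    simpa using hσ
  have hsub : C ⊆ {σ : Permutation | σ.len < m} ∪ ⋃ i ∈ Finset.univ, (B i).permSet := by
    intro σ hσ
    rcases Nat.lt_or_ge σ.len m with h | h
    · exact Or.inl h
    · obtain ⟨π, hπ, hσπ⟩ := exists_path_of_mem hC hσ h
      rw [hB] at hπ
      obtain ⟨i, hi⟩ := Set.mem_iUnion.1 hπ
      exact Or.inr (Set.mem_biUnion (Finset.mem_univ i) (Set.mem_biUnion hi hσπ))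
  rw [isWqo_iff]
  intro f hf
  exact ((hfin.union ((Finset.isPWO_bUnion _).2 fun i _ =>
    Bicycle.isPWO_permSet hm hamb (hsplit i))).mono hsub).exists_lt hf

theorem not_hasSplittablePair_of_isWqo {m : ℕ} {C : Set Permutation} (hw : IsWqo C)
    (hC : WindowClosed m C) (hamb : NoAmbiguousCycle m C) (B : Bicycle (levelGraph m C)) :
    ¬ B.HasSplittablePair := by
  rcases Nat.eq_zero_or_pos m with rfl | hm
  · have := hamb.isEmpty_level_zero
    exact isEmptyElim B.vert
  · rintro ⟨lo, hi, h | h⟩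
    · exact Bicycle.not_isInitSplittable_of_isWqo hw hC hm hamb lo hi h
    · exact Bicycle.not_isTermSplittable_of_isWqo hw hC hm hamb lo hi h

end ConsecPerm

theorem theorem7 (C : Set ConsecPerm.Permutation) (hC : IsLowerSet C)
    (hfin : (ConsecPerm.basis C).Finite) :
    (ConsecPerm.IsWqo C ↔
      ∃ (n : ℕ) (B : Fin n → ConsecPerm.Bicycle (ConsecPerm.factorGraph C)),
        ConsecPerm.IsPathComplete B ∧
        (∀ π, ConsecPerm.IsCycle (ConsecPerm.factorGraph C) π → ¬ ConsecPerm.Ambiguous π) ∧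
        ∀ i, ¬ ConsecPerm.Bicycle.HasSplittablePair (B i)) ∧
    ∀ (n : ℕ) (B : Fin n → ConsecPerm.Bicycle (ConsecPerm.factorGraph C)),
      ConsecPerm.IsPathComplete B →
      (ConsecPerm.IsWqo C ↔
        (∀ π, ConsecPerm.IsCycle (ConsecPerm.factorGraph C) π → ¬ ConsecPerm.Ambiguous π) ∧
        ∀ i, ¬ ConsecPerm.Bicycle.HasSplittablePair (B i)) := by
  have hWC : ∀ M, ConsecPerm.maxBasisLen C ≤ M → ConsecPerm.WindowClosed M C := fun M hM =>
    ConsecPerm.windowClosed_of_maxBasisLen_le hC hfin hM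
  have key : ∀ (n : ℕ) (B : Fin n → ConsecPerm.Bicycle (ConsecPerm.factorGraph C)),
      ConsecPerm.IsPathComplete B →
      (ConsecPerm.IsWqo C ↔
        (∀ π, ConsecPerm.IsCycle (ConsecPerm.factorGraph C) π → ¬ ConsecPerm.Ambiguous π) ∧
        ∀ i, ¬ ConsecPerm.Bicycle.HasSplittablePair (B i)) := by
    intro n B hB
    refine ⟨fun hw => ?_, fun h => ConsecPerm.isWqo_of_isPathComplete hC hB h.1 h.2⟩
    have hamb : ConsecPerm.NoAmbiguousCycle (ConsecPerm.maxBasisLen C) C := fun π hπ =>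
      ConsecPerm.not_ambiguous_of_isWqo hw hWC hπ
    exact ⟨hamb, fun i =>
      ConsecPerm.not_hasSplittablePair_of_isWqo hw (hWC _ le_rfl) hamb (B i)⟩
  refine ⟨⟨fun hw => ?_, ?_⟩, key⟩
  · obtain ⟨n, B, hB⟩ := ConsecPerm.exists_isPathComplete hw (hWC _ le_rfl)
    exact ⟨n, B, hB, (key n B hB).1 hw⟩
  · rintro ⟨n, B, hB, h⟩
    exact (key n B hB).2 h
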